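/- Fermat's principle for Finsler spacetimes. Let $M$ be an $N$-dimensional second-countable Hausdorff $C^\infty$ manifold and write $\overset{o}{T}M$ for its tangent bundle with the zero vectors removed. Let $L:\overset{o}{T}M\to\mathbb{R}$ be a $C^\infty$ function with $L(x,kv)=k^2L(x,v)$ for all $k>0$, such that for every $(x,v)\in\overset{o}{T}M$ the bilinear form $g_{ij}(x,v)=\partial^2L(x,v)/\partial v^i\partial v^j$ is non-degenerate of signature $(+,\dots,+,-)$ (so that $(M,L)$ is a Finsler spacetime). Let $q\in M$, let $I\subseteq\mathbb{R}$ be an interval, and let $\gamma:I\to M$ be a $C^\infty$ embedding with $L(\gamma(t),\dot\gamma(t))<0$ for all $t\in I$. For $t\in I$ let $Z_{\gamma(t)}M$ be the connected component of $\{v\in\overset{o}{T}_{\gamma(t)}M : L(\gamma(t),v)<0\}$ that contains $\dot\gamma(t)$. Let $\mathcal{C}_{q,\gamma}$ be the set of all $C^\infty$ maps $\lambda:[0,1]\to M$ such that: (a) $\lambda(0)=q$; (b) there is a (necessarily unique) $\tau(\lambda)\in I$ with $\lambda(1)=\gamma(\tau(\lambda))$; (c) $\dot\lambda(s)\neq0$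 and $L(\lambda(s),\dot\lambda(s))=0$ for all $s\in[0,1]$, and $\dot\lambda(1)$ lies in the boundary of $Z_{\gamma(\tau(\lambda))}M$ in $\overset{o}{T}_{\gamma(\tau(\lambda))}M$. An allowed variation of $\lambda\in\mathcal{C}_{q,\gamma}$ is a $C^\infty$ map $\Lambda:\,]-\varepsilon_0,\varepsilon_0[\,\times[0,1]\to M$, for some $\varepsilon_0>0$, with $\Lambda(\varepsilon,\cdot)\in\mathcal{C}_{q,\gamma}$ for all $\varepsilon$ and $\Lambda(0,\cdot)=\lambda$. Let $\lambda\in\mathcal{C}_{q,\gamma}$ be such that $\tau(\lambda)$ is an interior point of $I$. Then for every allowed variation $\Lambda$ of $\lambda$ the function $\varepsilon\mapsto\tau(\Lambda(\varepsilon,\cdot))$ is differentiable at $\varepsilon=0$; and $\lambda$ is an arbitrarily parametrized geodesic, i.e. there is a function $w:[0,1]\to\mathbb{R}$ with $$\frac{d}{ds}\frac{\partial L(\lambda(s),\dot\lambda(s))}{\partial\dot\lambda^i(s)}-\frac{\partial L(\lambda(s),\dot\lambda(s))}{\partial\lambda^i(s)}=w(s)\,\frac{\partial L(\lambda(s),\dot\lambda(s))}{\partial\dot\lambda^i(s)}\qquad(s\in[0,1])$$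 in every chart around $\lambda(s)$, if and only if $\delta\tau(\lambda):=\frac{d}{d\varepsilon}\tau(\Lambda(\varepsilon,\cdot))\big|_{\varepsilon=0}=0$ for every allowed variation $\Lambda$ of $\lambda$. -/

import Mathlib

open Set Topology
open scoped Manifold ContDiff

noncomputable section

namespace Finsler

/-- A symmetric bilinear form `g` has Lorentzian signature `(+, …, +, -)` (in particular it is
non-degenerate): it is diagonal, with entries `1, …, 1, -1`, in a suitable basis. -/
def IsLorentzian {E : Type*} [NormedAddCommGroup E] [NormedSpace ℝ E]
    (g : E →L[ℝ] E →L[ℝ] ℝ) : Prop :=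
  ∃ (n : ℕ) (b : Module.Basis (Fin n ⊕ Unit) ℝ E), ∀ i j,
    g (b i) (b j) =
      Matrix.diagonal (Sum.elim (fun _ : Fin n => (1 : ℝ)) (fun _ : Unit => (-1 : ℝ))) i j

section Basic

variable {E : Type*} [NormedAddCommGroup E] [NormedSpace ℝ E]
  {M : Type*} [TopologicalSpace M] [ChartedSpace E M]

/-- The point `(x, v)` of the tangent bundle. -/
def pt (x : M) (v : TangentSpace 𝓘(ℝ, E) x) : TangentBundle 𝓘(ℝ, E) M := ⟨x, v⟩

/-- The Finsler metric `g_{ij}(x, v) = ∂²L(x, v) / ∂v^i ∂v^j`, a bilinear form on the tangent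
space at `x` (which, as a vector space, is the model space `E`). -/
def metric (L : TangentBundle 𝓘(ℝ, E) M → ℝ) (x : M) (v : E) : E →L[ℝ] E →L[ℝ] ℝ :=
  fderiv ℝ (fun u : E => fderiv ℝ (fun z : E => L (pt x z)) u) v

/-- `L` is a Finsler Lagrangian of Lorentzian signature. `L` is a function on the tangent bundle
without the zero section; the values of the Lean function `L` at zero vectors are irrelevant, and
no definition below depends on them. -/
structure IsFinslerLagrangian [IsManifold 𝓘(ℝ, E) ∞ M]
    (L : TangentBundle 𝓘(ℝ, E) M → ℝ) : Prop where
  smooth : ContMDiffOn 𝓘(ℝ, E).tangent 𝓘(ℝ, ℝ) ∞ L {p | p.2 ≠ 0}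
  homogeneous : ∀ (x : M) (v : TangentSpace 𝓘(ℝ, E) x), v ≠ 0 → ∀ k : ℝ, 0 < k →
    L (pt x (k • v)) = k ^ 2 * L (pt x v)
  lorentzian : ∀ (x : M) (v : E), v ≠ 0 → IsLorentzian (metric L x v)

/-- The tangent vector `(c(s), ċ(s))` of a curve `c` with parameter interval `S` (one-sided
derivatives at end-points that belong to `S`). -/
def velocity (S : Set ℝ) (c : ℝ → M) (s : ℝ) : TangentBundle 𝓘(ℝ, E) M :=
  pt (c s) (mfderivWithin 𝓘(ℝ, ℝ) 𝓘(ℝ, E) c S s (1 : ℝ))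

/-- The set `{v ∈ T_x M ∖ {0} | L(x, v) < 0}`. -/
def timelikeVectors (L : TangentBundle 𝓘(ℝ, E) M → ℝ) (x : M) :
    Set (TangentSpace 𝓘(ℝ, E) x) :=
  {v | v ≠ 0 ∧ L (pt x v) < 0}

/-- For a timelike vector `p = (x, u)`: the boundary, taken in `T_x M ∖ {0}`, of the connected
component of `{v ∈ T_x M ∖ {0} | L(x, v) < 0}` that contains `u`. -/
def lightCone (L : TangentBundle 𝓘(ℝ, E) M → ℝ) (p : TangentBundle 𝓘(ℝ, E) M) :
    Set (TangentBundle 𝓘(ℝ, E) M) :=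
  pt p.1 '' {v | v ≠ 0 ∧ v ∈ frontier (connectedComponentIn (timelikeVectors L p.1) p.2)}

/-- `γ : I → M` is a timelike `C^∞` embedding of the interval `I`. -/
structure IsTimelikeEmbedding (L : TangentBundle 𝓘(ℝ, E) M → ℝ) (I : Set ℝ) (γ : ℝ → M) :
    Prop where
  interval : I.OrdConnected
  smooth : ContMDiffOn 𝓘(ℝ, ℝ) 𝓘(ℝ, E) ∞ γ I
  embedding : IsEmbedding (fun t : I => γ t)
  immersion : ∀ t ∈ I, (velocity (E := E) I γ t).2 ≠ 0
  timelike : ∀ t ∈ I, L (velocity I γ t) < 0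

/-- `lam` (restricted to `[0,1]`) is a trial curve from `q` to `γ`. As `L` is a function on
non-zero vectors, `L(λ, λ̇) = 0` includes `λ̇ ≠ 0`. -/
structure IsTrialCurve (L : TangentBundle 𝓘(ℝ, E) M → ℝ) (q : M) (I : Set ℝ) (γ : ℝ → M)
    (lam : ℝ → M) : Prop where
  smooth : ContMDiffOn 𝓘(ℝ, ℝ) 𝓘(ℝ, E) ∞ lam (Icc 0 1)
  start : lam 0 = q
  regular : ∀ s ∈ Icc (0 : ℝ) 1, (velocity (E := E) (Icc 0 1) lam s).2 ≠ 0
  lightlike : ∀ s ∈ Icc (0 : ℝ) 1, L (velocity (Icc 0 1) lam s) = 0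
  arrival : ∃ t ∈ I, lam 1 = γ t ∧ velocity (Icc 0 1) lam 1 ∈ lightCone L (velocity I γ t)

/-- The arrival time `τ(λ)`: the parameter `t ∈ I` with `λ(1) = γ(t)`, which for trial curves
exists and is unique because `γ` is injective on `I`. -/
def arrivalTime (I : Set ℝ) (γ : ℝ → M) (lam : ℝ → M) : ℝ :=
  Function.invFunOn γ I (lam 1)

/-- `Lam`, restricted to `]-ε₀, ε₀[ × [0,1]`, is an allowed variation of the trial curve `lam`. -/
structure IsAllowedVariation (L : TangentBundle 𝓘(ℝ, E) M → ℝ) (q : M) (I : Set ℝ) (γ : ℝ → M)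
    (lam : ℝ → M) (ε₀ : ℝ) (Lam : ℝ → ℝ → M) : Prop where
  pos : 0 < ε₀
  smooth : ContMDiffOn 𝓘(ℝ, ℝ × ℝ) 𝓘(ℝ, E) ∞ (fun z : ℝ × ℝ => Lam z.1 z.2)
    (Ioo (-ε₀) ε₀ ×ˢ Icc (0 : ℝ) 1)
  trial : ∀ ε ∈ Ioo (-ε₀) ε₀, IsTrialCurve L q I γ (Lam ε)
  base : ∀ s ∈ Icc (0 : ℝ) 1, Lam 0 s = lam s

/-- The Lagrangian in the natural coordinates of the tangent bundle that are induced by a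
chart `e` of `M`. -/
def chartLagrangian (L : TangentBundle 𝓘(ℝ, E) M → ℝ) (e : OpenPartialHomeomorph M E)
    (y u : E) : ℝ :=
  L (pt (e.symm y) (mfderiv 𝓘(ℝ, E) 𝓘(ℝ, E) e.symm y u))

/-- `∂L(c, ċ)/∂ċ^i` at the parameter value `s`, for a curve `c` in the coordinate space of
the chart `e`; this is a covector. -/
def momentum (L : TangentBundle 𝓘(ℝ, E) M → ℝ) (e : OpenPartialHomeomorph M E)
    (S : Set ℝ) (c : ℝ → E) (s : ℝ) : E →L[ℝ] ℝ :=
  fderiv ℝ (fun u : E => chartLagrangian L e (c s) u) (derivWithin c S s)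

/-- `∂L(c, ċ)/∂c^i` at the parameter value `s`, for a curve `c` in the coordinate space of
the chart `e`. -/
def force (L : TangentBundle 𝓘(ℝ, E) M → ℝ) (e : OpenPartialHomeomorph M E)
    (S : Set ℝ) (c : ℝ → E) (s : ℝ) : E →L[ℝ] ℝ :=
  fderiv ℝ (fun y : E => chartLagrangian L e y (derivWithin c S s)) (c s)

/-- `lam`, with parameter interval `S`, is an arbitrarily parametrized geodesic of `L`: there is
a function `w` of the curve parameter such that, in every smooth chart around `lam s`,
`d/ds ∂L/∂ċ^i - ∂L/∂c^i = w(s) ∂L/∂ċ^i`. -/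
structure IsArbParamGeodesic (L : TangentBundle 𝓘(ℝ, E) M → ℝ) (S : Set ℝ)
    (lam : ℝ → M) : Prop where
  smooth : ContMDiffOn 𝓘(ℝ, ℝ) 𝓘(ℝ, E) ∞ lam S
  regular : ∀ s ∈ S, (velocity (E := E) S lam s).2 ≠ 0
  eulerLagrange : ∃ w : ℝ → ℝ, ∀ s ∈ S, ∀ e ∈ IsManifold.maximalAtlas 𝓘(ℝ, E) ∞ M,
    lam s ∈ e.source →
      HasDerivWithinAt (momentum L e S (e ∘ lam))
        (force L e S (e ∘ lam) s + w s • momentum L e S (e ∘ lam) s) S s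

end Basic

end Finsler

end

/-! Write `p` for the momentum `∂L/∂λ̇` along `λ` and `f` for the force `∂L/∂λ`. Two facts about a
single tangent space carry the argument. Euler's relation and the non-degeneracy of the Hessian show
that `p` never vanishes (`fderiv_ne_zero`). The reverse Cauchy-Schwarz inequality makes `√(-L)`
concave on timelike segments; hence each component of timelike vectors is convex, and the
differential of `L` at a non-zero boundary vector is negative on the whole component
(`of_mem_frontier`). In particular `p(γ̇) < 0` at the arrival.

Geodesics are stationary: let `ξ` be the variational field. Differentiating `L = 0` along the
variation gives `f(ξ) + p(ξ') = 0`, so the Euler-Lagrange equation turns into `(p(ξ))' = w p(ξ)`.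
Since `ξ(0) = 0`, this forces `p(ξ) = 0` at `s = 1`, where `ξ = δτ γ̇`. As `p(γ̇) ≠ 0` there, `δτ =
0`.

Stationary curves are geodesics: the difficulty is to produce enough variations that stay lightlike.
Take a family `Φ(s, ε, r)` around `λ` whose end-point is `γ(τ + r)` and whose slope `S = p(∂Φ/∂r)`
is negative for all `s`. Such a family is assembled from bumps by compactness: near the arrival one
moves along `γ̇`, elsewhere in any direction on which `p` is negative (`exists_family_slope_neg`).
Substituting a delay `r(ε, s)` into `L = 0` gives an implicit scalar differential equation; its
derivative in `r'` is `S ≠ 0`, so it is solvable with `r(ε, 0) = 0`, smoothly in `ε`. The condition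
on the final tangent vector is stable, so the result is an allowed variation
(`exists_allowedVariation`).

If `Φ` is perturbed by `ε ρ(s) z` in a chart, the derivative `η` of the delay satisfies `ρ f(z) + ρ'
p(z) + η R + η' S = 0`, where `R` is the derivative of `L` in `r`. Also `η(0) = 0`, and `η(1) = δτ =
0` by stationarity. An integrating factor removes `η` and leaves the integral of `ρ X`, with a
weight of constant sign, equal to zero, where `X = p'(z) - f(z) - w p(z)` and `w = (S' - R) / S`. As
`ρ` is an arbitrary bump, `X = 0` (`eulerLagrange_interior`). -/

open Set Topology
open scoped Manifold ContDiff

noncomputable section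

namespace Finsler

/-! ### Linear algebra of Lorentzian forms. -/

section Lorentzian

variable {E : Type*} [NormedAddCommGroup E] [NormedSpace ℝ E] {g : E →L[ℝ] E →L[ℝ] ℝ}

/-- In a basis that diagonalizes a Lorentzian form, the form is `∑ xᵢ yᵢ - x₀ y₀`. -/
theorem IsLorentzian.exists_basis_apply (hg : IsLorentzian g) :
    ∃ (n : ℕ) (b : Module.Basis (Fin n ⊕ Unit) ℝ E), ∀ x y, g x y =
      ∑ i, b.repr x (Sum.inl i) * b.repr y (Sum.inl i) -
        b.repr x (Sum.inr ()) * b.repr y (Sum.inr ()) := by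
  obtain ⟨n, b, hb⟩ := hg
  refine ⟨n, b, fun x y => ?_⟩
  conv_lhs => rw [← b.sum_repr x, ← b.sum_repr y]
  simp only [map_sum, map_smul, _root_.sum_apply, _root_.smul_apply,
    hb, Matrix.diagonal_apply, smul_eq_mul]
  simp [Fintype.sum_sum_type, sub_eq_add_neg, mul_comm]

theorem IsLorentzian.symm (hg : IsLorentzian g) (x y : E) : g x y = g y x := by
  obtain ⟨n, b, hb⟩ := hg.exists_basis_apply
  simp only [hb, mul_comm]

theorem IsLorentzian.eq_zero_of_forall (hg : IsLorentzian g) {x : E} (h : ∀ y, g x y = 0) :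
    x = 0 := by
  obtain ⟨n, b, hb⟩ := hg
  have hx : ∀ j, b.repr x j = 0 := by
    intro j
    have := h (b j)
    rw [← b.sum_repr x] at this
    simp only [map_sum, map_smul, _root_.sum_apply, _root_.smul_apply,
      hb, Matrix.diagonal_apply, smul_eq_mul] at this
    rcases j with j | j <;> simpa using this
  apply b.repr.injective
  ext j
  simp [hx j]

/-- Vectors orthogonal to a non-spacelike vector are non-timelike. -/
theorem IsLorentzian.nonneg_of_orthogonal (hg : IsLorentzian g) {y w : E} (hy : y ≠ 0)
    (hyy : g y y ≤ 0) (hyw : g y w = 0) : 0 ≤ g w w := by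
  obtain ⟨n, b, hb⟩ := hg.exists_basis_apply
  rw [hb] at hyy hyw ⊢
  set a := fun i => b.repr y (Sum.inl i)
  set c := fun i => b.repr w (Sum.inl i)
  set t := b.repr y (Sum.inr ())
  set x := b.repr w (Sum.inr ())
  have hcs : (∑ i, a i * c i) ^ 2 ≤ (∑ i, a i ^ 2) * ∑ i, c i ^ 2 :=
    Finset.sum_mul_sq_le_sq_mul_sq _ _ _
  have e1 : ∑ i, a i * a i = ∑ i, a i ^ 2 := by simp only [sq]
  have e2 : ∑ i, c i * c i = ∑ i, c i ^ 2 := by simp only [sq]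
  change ∑ i, a i * a i - t * t ≤ 0 at hyy
  change ∑ i, a i * c i - t * x = 0 at hyw
  change 0 ≤ ∑ i, c i * c i - x * x
  rw [e1] at hyy
  rw [e2]
  have hA : 0 ≤ ∑ i, a i ^ 2 := Finset.sum_nonneg fun i _ => sq_nonneg _
  have hC : 0 ≤ ∑ i, c i ^ 2 := Finset.sum_nonneg fun i _ => sq_nonneg _
  have ht : t ≠ 0 := by
    intro ht
    have hA0 : ∑ i, a i ^ 2 = 0 := by rw [ht] at hyy; linarith
    have ha : ∀ i, a i = 0 := fun i => by
      have := (Finset.sum_eq_zero_iff_of_nonneg (fun i _ => sq_nonneg (a i))).1 hA0 i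
        (Finset.mem_univ i)
      exact pow_eq_zero_iff (two_ne_zero) |>.1 this
    apply hy
    apply b.repr.injective
    ext j
    rcases j with j | j
    · simpa using ha j
    · simpa using ht
  -- Orthogonality says that `t x` is the Euclidean product of the spatial parts `a` and `c`, and
  -- `y` non-spacelike says that `|a| ≤ |t|`.
  have h1 : (t * x) ^ 2 ≤ t ^ 2 * ∑ i, c i ^ 2 := by
    rw [← sub_eq_zero.1 hyw]
    refine hcs.trans ?_
    gcongr
    linarith [sq t]
  have ht2 : 0 < t ^ 2 := by positivity
  have : x ^ 2 ≤ ∑ i, c i ^ 2 := by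
    rw [mul_pow] at h1
    exact le_of_mul_le_mul_left h1 ht2
  linarith [sq x]

/-- The reverse Cauchy-Schwarz inequality. -/
theorem IsLorentzian.reverse_cauchySchwarz (hg : IsLorentzian g) {y : E} (hyy : g y y < 0) (w : E) :
    g w w * g y y ≤ (g y w) ^ 2 := by
  have hy : y ≠ 0 := by rintro rfl; simp at hyy
  -- With this `k`, `w - k y` is orthogonal to the timelike `y`, hence has non-negative square;
  -- expanding that square is the inequality.
  set k := g y w / g y y with hk
  have hort : g y (w - k • y) = 0 := by
    rw [map_sub, map_smul, smul_eq_mul, hk, div_mul_cancel₀ _ hyy.ne, sub_self]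
  have h := hg.nonneg_of_orthogonal hy hyy.le hort
  have e : g (w - k • y) (w - k • y) = g w w - k * g y w := by
    have e1 : g (w - k • y) (w - k • y) = g (w - k • y) w - k * g (w - k • y) y := by
      rw [map_sub (g (w - k • y)), map_smul, smul_eq_mul]
    rw [e1, hg.symm _ y, hort, hg.symm _ w, map_sub, map_smul, hg.symm w y]
    simp
  rw [e, hk] at h
  have h2 : (g w w - g y w / g y y * g y w) * g y y ≤ 0 :=
    mul_nonpos_of_nonneg_of_nonpos h hyy.le
  have h3 : (g w w - g y w / g y y * g y w) * g y y = g w w * g y y - g y w ^ 2 := by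
    field_simp [hyy.ne]
  linarith

end Lorentzian

/-! ### Timelike vectors and their boundary in a single tangent space. -/

/-- If `φ < 0` and `2 φ φ'' ≤ φ'²`, then `√(-φ)` is concave. -/
theorem concaveOn_sqrt_neg {φ φ' φ'' : ℝ → ℝ} (h : ∀ σ ∈ Icc (0 : ℝ) 1, φ σ < 0)
    (hd1 : ∀ σ ∈ Icc (0 : ℝ) 1, HasDerivAt φ (φ' σ) σ)
    (hd2 : ∀ σ ∈ Icc (0 : ℝ) 1, HasDerivAt φ' (φ'' σ) σ)
    (hle : ∀ σ ∈ Icc (0 : ℝ) 1, 2 * φ σ * φ'' σ ≤ φ' σ ^ 2) :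
    ConcaveOn ℝ (Icc 0 1) fun σ : ℝ => √(-φ σ) := by
  have hs1 : ∀ σ ∈ Icc (0 : ℝ) 1, HasDerivAt (fun σ : ℝ => √(-φ σ))
      (-(φ' σ) / (2 * √(-φ σ))) σ := fun σ hσ =>
    (hd1 σ hσ).neg.sqrt (by have := h σ hσ; simp; linarith)
  have hs2 : ∀ σ ∈ Icc (0 : ℝ) 1, ∃ c ≤ 0, HasDerivAt
      (fun σ : ℝ => -(φ' σ) / (2 * √(-φ σ))) c σ := by
    intro σ hσ
    have hneg := h σ hσ
    have hpos : 0 < √(-φ σ) := Real.sqrt_pos.2 (by linarith)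
    have hsq : √(-φ σ) ^ 2 = -φ σ := Real.sq_sqrt (by linarith)
    have hl := hle σ hσ
    refine ⟨_, ?_, (hd2 σ hσ).neg.div ((hs1 σ hσ).const_mul 2) (by positivity)⟩
    apply div_nonpos_of_nonpos_of_nonneg _ (by positivity)
    have e : -φ'' σ * (2 * √(-φ σ)) - (-φ') σ * (2 * (-φ' σ / (2 * √(-φ σ)))) =
        (φ'' σ * (-(2 * √(-φ σ) ^ 2)) - φ' σ ^ 2) / √(-φ σ) := by
      simp only [Pi.neg_apply]
      field_simp
    rw [e, hsq]
    apply div_nonpos_of_nonpos_of_nonneg _ hpos.le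
    linarith
  choose! c hc0 hc using hs2
  exact concaveOn_of_hasDerivWithinAt2_nonpos (convex_Icc 0 1)
    (fun σ hσ => (hs1 σ hσ).continuousAt.continuousWithinAt)
    (fun σ hσ => (hs1 σ (interior_subset hσ)).hasDerivWithinAt)
    (fun σ hσ => (hc σ (interior_subset hσ)).hasDerivWithinAt)
    (fun σ hσ => hc0 σ (interior_subset hσ))

/-- A fibre Lagrangian: smooth and positively homogeneous of degree two away from the origin, with
Hessian of Lorentzian signature. -/
structure IsFibreLagrangian {E : Type*} [NormedAddCommGroup E] [NormedSpace ℝ E] (f : E → ℝ) :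
    Prop where
  smooth : ContDiffOn ℝ ∞ f {0}ᶜ
  homogeneous : ∀ v, v ≠ 0 → ∀ k : ℝ, 0 < k → f (k • v) = k ^ 2 * f v
  lorentzian : ∀ v, v ≠ 0 → IsLorentzian (fderiv ℝ (fun u => fderiv ℝ f u) v)

namespace IsFibreLagrangian

variable {E : Type*} [NormedAddCommGroup E] [NormedSpace ℝ E] {f : E → ℝ}

theorem contDiffAt (hf : IsFibreLagrangian f) {v : E} (hv : v ≠ 0) : ContDiffAt ℝ ∞ f v :=
  hf.smooth.contDiffAt (isOpen_compl_singleton.mem_nhds hv)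

theorem differentiableAt (hf : IsFibreLagrangian f) {v : E} (hv : v ≠ 0) :
    DifferentiableAt ℝ f v :=
  (hf.contDiffAt hv).differentiableAt (by simp)

theorem continuousAt (hf : IsFibreLagrangian f) {v : E} (hv : v ≠ 0) : ContinuousAt f v :=
  (hf.contDiffAt hv).continuousAt

theorem hasFDerivAt_fderiv (hf : IsFibreLagrangian f) {v : E} (hv : v ≠ 0) :
    HasFDerivAt (fun u => fderiv ℝ f u) (fderiv ℝ (fun u => fderiv ℝ f u) v) v :=
  (((hf.contDiffAt hv).fderiv_right (m := 1) (by norm_cast)).differentiableAt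
    (by simp)).hasFDerivAt

theorem fderiv_smul (hf : IsFibreLagrangian f) {v : E} (hv : v ≠ 0) {k : ℝ} (hk : 0 < k) :
    fderiv ℝ f (k • v) = k • fderiv ℝ f v := by
  have hkv : k • v ≠ 0 := smul_ne_zero hk.ne' hv
  have h1 : HasFDerivAt (fun u => f (k • u)) ((fderiv ℝ f (k • v)).comp
      (k • ContinuousLinearMap.id ℝ E)) v :=
    (hf.differentiableAt hkv).hasFDerivAt.comp v ((hasFDerivAt_id v).const_smul k)
  have h2 : HasFDerivAt (fun u => k ^ 2 * f u) (k ^ 2 • fderiv ℝ f v) v :=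
    (hf.differentiableAt hv).hasFDerivAt.const_mul _
  have he : (fun u => f (k • u)) =ᶠ[𝓝 v] fun u => k ^ 2 * f u := by
    filter_upwards [isOpen_compl_singleton.mem_nhds hv] with u hu
    exact hf.homogeneous u hu k hk
  have h3 := (h2.congr_of_eventuallyEq he).unique h1
  ext w
  have h4 := congrArg (fun A : E →L[ℝ] ℝ => A w) h3
  simp only [_root_.smul_apply, ContinuousLinearMap.comp_apply,
    ContinuousLinearMap.id_apply, map_smul, smul_eq_mul] at h4 ⊢
  have : k * (k * fderiv ℝ f v w - fderiv ℝ f (k • v) w) = 0 := by linarith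
  rcases mul_eq_zero.1 this with h | h
  · exact absurd h hk.ne'
  · linarith

/-- Euler's relation for the differential. -/
theorem hessian_self (hf : IsFibreLagrangian f) {v : E} (hv : v ≠ 0) :
    fderiv ℝ (fun u => fderiv ℝ f u) v v = fderiv ℝ f v := by
  have hl : HasDerivAt (fun k : ℝ => k • v) v 1 := by
    simpa using (hasDerivAt_id (1 : ℝ)).smul_const v
  have h1 : HasDerivAt (fun k : ℝ => fderiv ℝ f (k • v))
      (fderiv ℝ (fun u => fderiv ℝ f u) v v) 1 := by
    exact (hf.hasFDerivAt_fderiv hv).comp_hasDerivAt_of_eq (1 : ℝ) hl (one_smul ℝ v).symm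
  have h2 : HasDerivAt (fun k : ℝ => k • fderiv ℝ f v) (fderiv ℝ f v) 1 := by
    simpa using (hasDerivAt_id (1 : ℝ)).smul_const (fderiv ℝ f v)
  have he : (fun k : ℝ => fderiv ℝ f (k • v)) =ᶠ[𝓝 1] fun k => k • fderiv ℝ f v := by
    filter_upwards [lt_mem_nhds (zero_lt_one (α := ℝ))] with k hk
    exact hf.fderiv_smul hv hk
  exact h1.unique (h2.congr_of_eventuallyEq he)

/-- Euler's relation. -/
theorem fderiv_self (hf : IsFibreLagrangian f) {v : E} (hv : v ≠ 0) :
    fderiv ℝ f v v = 2 * f v := by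
  have hl : HasDerivAt (fun k : ℝ => k • v) v 1 := by
    simpa using (hasDerivAt_id (1 : ℝ)).smul_const v
  have h1 : HasDerivAt (fun k : ℝ => f (k • v)) (fderiv ℝ f v v) 1 := by
    exact (hf.differentiableAt hv).hasFDerivAt.comp_hasDerivAt_of_eq (1 : ℝ) hl
      (one_smul ℝ v).symm
  have h2 : HasDerivAt (fun k : ℝ => k ^ 2 * f v) (2 * f v) 1 := by
    simpa using (hasDerivAt_pow 2 (1 : ℝ)).mul_const (f v)
  have he : (fun k : ℝ => f (k • v)) =ᶠ[𝓝 1] fun k => k ^ 2 * f v := by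
    filter_upwards [lt_mem_nhds (zero_lt_one (α := ℝ))] with k hk
    exact hf.homogeneous v hv k hk
  exact h1.unique (h2.congr_of_eventuallyEq he)

/-- By Euler's relation the differential at `v` is the Hessian applied to `v`, and the Hessian has
no kernel. -/
theorem fderiv_ne_zero (hf : IsFibreLagrangian f) {v : E} (hv : v ≠ 0) : fderiv ℝ f v ≠ 0 := by
  intro h
  refine hv ((hf.lorentzian v hv).eq_zero_of_forall fun y => ?_)
  rw [hf.hessian_self hv, h]
  rfl

/-- On a segment of timelike vectors, `√(-f)` is concave. -/
theorem concaveOn_sqrt (hf : IsFibreLagrangian f) {u w : E}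
    (h : ∀ σ ∈ Icc (0 : ℝ) 1, u + σ • w ≠ 0 ∧ f (u + σ • w) < 0) :
    ConcaveOn ℝ (Icc 0 1) fun σ : ℝ => √(-f (u + σ • w)) := by
  have hline : ∀ σ : ℝ, HasDerivAt (fun σ : ℝ => u + σ • w) w σ := fun σ => by
    simpa using ((hasDerivAt_id σ).smul_const w).const_add u
  refine concaveOn_sqrt_neg (fun σ hσ => (h σ hσ).2) (φ' := fun σ => fderiv ℝ f (u + σ • w) w)
    (φ'' := fun σ => fderiv ℝ (fun u => fderiv ℝ f u) (u + σ • w) w w) ?_ ?_ ?_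
  · exact fun σ hσ => (hf.differentiableAt (h σ hσ).1).hasFDerivAt.comp_hasDerivAt σ (hline σ)
  · intro σ hσ
    have h1 := (hf.hasFDerivAt_fderiv (h σ hσ).1).comp_hasDerivAt σ (hline σ)
    simpa using h1.clm_apply (hasDerivAt_const σ w)
  · intro σ hσ
    -- For `y = u + σ w`, Euler's relations turn `g(y, y)` and `g(y, w)` into `2 φ` and `φ'`, so
    -- this is exactly `2 φ φ'' ≤ φ'²`.
    have hrc := (hf.lorentzian _ (h σ hσ).1).reverse_cauchySchwarz (y := u + σ • w)
      (by rw [hf.hessian_self (h σ hσ).1, hf.fderiv_self (h σ hσ).1]; linarith [(h σ hσ).2]) w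
    rw [hf.hessian_self (h σ hσ).1, hf.fderiv_self (h σ hσ).1] at hrc
    linarith

/-- The extension by zero of `√(-f)` at the origin, cut off where `f` is positive, is continuous. -/
def speed (f : E → ℝ) (v : E) : ℝ :=
  open Classical in if v = 0 then 0 else √(-f v)

omit [NormedSpace ℝ E] in
theorem speed_of_ne (f : E → ℝ) {v : E} (hv : v ≠ 0) : speed f v = √(-f v) := if_neg hv

omit [NormedSpace ℝ E] in
theorem timelike_of_speed_pos {v : E} (h : 0 < speed f v) : v ≠ 0 ∧ f v < 0 := by
  unfold speed at h
  split_ifs at h with h0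
  · exact absurd h (lt_irrefl _)
  · exact ⟨h0, by simpa using Real.sqrt_pos.1 h⟩

omit [NormedSpace ℝ E] in
theorem speed_pos {v : E} (h0 : v ≠ 0) (h : f v < 0) : 0 < speed f v := by
  rw [speed_of_ne f h0]
  exact Real.sqrt_pos.2 (by linarith)

/-- Only the origin needs an argument: homogeneity and the compactness of the unit sphere bound
`speed f v` by a multiple of `‖v‖`. -/
theorem continuous_speed [FiniteDimensional ℝ E] (hf : IsFibreLagrangian f) :
    Continuous (speed f) := by
  rw [continuous_iff_continuousAt]
  intro v
  by_cases hv : v = 0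
  · subst hv
    obtain ⟨C, hC⟩ := (isCompact_sphere (0 : E) 1).exists_bound_of_continuousOn (f := f)
      (fun u hu => (hf.continuousAt (by
        rintro rfl
        simp at hu)).continuousWithinAt)
    have hb : ∀ v : E, |speed f v| ≤ √|C| * ‖v‖ := by
      intro v
      by_cases hv : v = 0
      · simp [speed, hv]
      · have hn : 0 < ‖v‖ := norm_pos_iff.2 hv
        have h1 : f v = ‖v‖ ^ 2 * f (‖v‖⁻¹ • v) := by
          rw [← hf.homogeneous _ (smul_ne_zero (inv_ne_zero hn.ne') hv) _ hn, smul_smul,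
            mul_inv_cancel₀ hn.ne', one_smul]
        have h2 := hC (‖v‖⁻¹ • v) (by simp [norm_smul, hn.ne'])
        rw [speed_of_ne f hv, abs_of_nonneg (Real.sqrt_nonneg _)]
        apply Real.sqrt_le_iff.2 ⟨by positivity, ?_⟩
        rw [mul_pow, Real.sq_sqrt (abs_nonneg C), h1]
        have h3 : -f (‖v‖⁻¹ • v) ≤ |C| := by
          have := neg_le_of_abs_le h2
          linarith [le_abs_self C]
        nlinarith [sq_nonneg ‖v‖]
    have h0 : speed f 0 = 0 := by simp [speed]
    rw [ContinuousAt, h0]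
    apply squeeze_zero_norm hb
    have : Filter.Tendsto (fun v : E => √|C| * ‖v‖) (𝓝 0) (𝓝 (√|C| * ‖(0 : E)‖)) :=
      (continuous_const.mul continuous_norm).tendsto 0
    simpa using this
  · have h1 : ContinuousAt (fun u => √(-f u)) v := (hf.continuousAt hv).neg.sqrt
    apply h1.congr
    filter_upwards [isOpen_compl_singleton.mem_nhds hv] with u hu
    exact (speed_of_ne f hu).symm

/-- The set of timelike vectors of a fibre Lagrangian. -/
def timelike (f : E → ℝ) : Set E := {v | v ≠ 0 ∧ f v < 0}

theorem isOpen_timelike (hf : IsFibreLagrangian f) : IsOpen (timelike f) := by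
  have : timelike f = {0}ᶜ ∩ f ⁻¹' Iio 0 := by ext; simp [timelike]
  rw [this]
  exact hf.smooth.continuousOn.isOpen_inter_preimage isOpen_compl_singleton isOpen_Iio

/-- This form of concavity is used because it is a closed condition on the end-points: it survives
limits of end-points for which the segment is not yet known to be timelike. -/
theorem speed_segment (hf : IsFibreLagrangian f) {u v : E} (h : segment ℝ u v ⊆ timelike f)
    {σ : ℝ} (hσ : σ ∈ Icc (0 : ℝ) 1) :
    (1 - σ) * speed f u + σ * speed f v ≤ speed f (u + σ • (v - u)) := by
  have hseg : ∀ σ ∈ Icc (0 : ℝ) 1, u + σ • (v - u) ≠ 0 ∧ f (u + σ • (v - u)) < 0 := by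
    intro σ hσ
    apply h
    rw [segment_eq_image']
    exact ⟨σ, hσ, rfl⟩
  have hc := (hf.concaveOn_sqrt hseg).2 (left_mem_Icc.2 zero_le_one)
    (right_mem_Icc.2 zero_le_one) (sub_nonneg.2 hσ.2) hσ.1 (by ring)
  have h0 := hseg 0 (left_mem_Icc.2 zero_le_one)
  have h1 := hseg 1 (right_mem_Icc.2 zero_le_one)
  simp only [zero_smul, add_zero, one_smul, add_sub_cancel] at h0 h1
  rw [speed_of_ne f h0.1, speed_of_ne f h1.1, speed_of_ne f (hseg σ hσ).1]
  simpa using hc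

/-- Timelike vectors in the same component are joined by timelike segments. -/
theorem segment_subset_timelike [FiniteDimensional ℝ E] (hf : IsFibreLagrangian f) {u v : E}
    (hu : u ∈ timelike f) (hv : v ∈ connectedComponentIn (timelike f) u) :
    segment ℝ u v ⊆ timelike f := by
  set Z := connectedComponentIn (timelike f) u with hZ
  have huZ : u ∈ Z := mem_connectedComponentIn hu
  have hZt : Z ⊆ timelike f := connectedComponentIn_subset _ _
  -- The points visible from `u` along timelike segments form a set that is open and relatively
  -- closed in the connected set `Z`.
  set A : Set E := {w | segment ℝ u w ⊆ timelike f} with hA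
  have hAopen : IsOpen A := by
    have hc : Continuous fun p : E × ℝ => u + p.2 • (p.1 - u) := by fun_prop
    rw [isOpen_iff_mem_nhds]
    intro w hw
    have := (isCompact_Icc (a := (0 : ℝ)) (b := 1)).eventually_forall_of_forall_eventually
      (x₀ := w) (P := fun w σ => u + σ • (w - u) ∈ timelike f) (fun σ hσ => by
        apply hc.continuousAt.eventually (hf.isOpen_timelike.mem_nhds _)
        apply hw
        rw [segment_eq_image']
        exact ⟨σ, hσ, rfl⟩)
    filter_upwards [this] with w hw
    rw [hA, mem_ofPred_eq, segment_eq_image']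
    rintro _ ⟨σ, hσ, rfl⟩
    exact hw σ hσ
  have hAclosed : ∀ w ∈ Z, w ∈ closure A → w ∈ A := by
    intro w hw hwA
    have hw' := hZt hw
    have key : ∀ σ ∈ Icc (0 : ℝ) 1,
        (1 - σ) * speed f u + σ * speed f w ≤ speed f (u + σ • (w - u)) := by
      intro σ hσ
      have hcl : IsClosed {w | (1 - σ) * speed f u + σ * speed f w ≤
          speed f (u + σ • (w - u))} := by
        have := hf.continuous_speed
        apply isClosed_le <;> fun_prop
      exact closure_minimal (fun w hw => hf.speed_segment hw hσ) hcl hwA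
    rw [hA, mem_ofPred_eq, segment_eq_image']
    rintro _ ⟨σ, hσ, rfl⟩
    -- Positive `speed` excludes lightlike vectors and also the origin, where `speed` is zero by
    -- definition.
    apply timelike_of_speed_pos
    refine lt_of_lt_of_le ?_ (key σ hσ)
    have h1 := speed_pos hu.1 hu.2
    have h2 := speed_pos hw'.1 hw'.2
    rcases eq_or_lt_of_le hσ.1 with h | h
    · rw [← h]; simpa using h1
    · have := mul_nonneg (sub_nonneg.2 hσ.2) h1.le
      have := mul_pos h h2
      linarith
  have hZA : Z ⊆ A := by
    apply isPreconnected_connectedComponentIn.subset_of_closure_inter_subset hAopen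
    · exact ⟨u, huZ, by simpa [hA] using hu⟩
    · rintro w ⟨h1, h2⟩
      exact hAclosed w h2 h1
  exact hZA hv

/-- A non-zero boundary vector of the component of timelike vectors that contains `u` is lightlike
and joined to `u` by a timelike segment. -/
theorem of_mem_frontier [FiniteDimensional ℝ E] (hf : IsFibreLagrangian f) {u v : E}
    (hu : u ∈ timelike f) (hv0 : v ≠ 0)
    (hv : v ∈ frontier (connectedComponentIn (timelike f) u)) :
    f v = 0 ∧ fderiv ℝ f v u < 0 ∧ ∀ σ ∈ Ioc (0 : ℝ) 1, v + σ • (u - v) ∈ timelike f := by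
  set Z := connectedComponentIn (timelike f) u with hZ
  have hZt : Z ⊆ timelike f := connectedComponentIn_subset _ _
  have hZo : IsOpen Z := hf.isOpen_timelike.connectedComponentIn
  have hvc : v ∈ closure Z := frontier_subset_closure hv
  have hvZ : v ∉ Z := by
    rw [hZo.frontier_eq] at hv
    exact hv.2
  -- The concavity inequality holds for `w` in `Z` and passes to the limit `v`.
  have key : ∀ σ ∈ Icc (0 : ℝ) 1,
      (1 - σ) * speed f v + σ * speed f u ≤ speed f (v + σ • (u - v)) := by
    intro σ hσ
    have hcl : IsClosed {v | (1 - σ) * speed f v + σ * speed f u ≤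
        speed f (v + σ • (u - v))} := by
      have := hf.continuous_speed
      apply isClosed_le <;> fun_prop
    refine closure_minimal (fun w hw => hf.speed_segment ?_ hσ) hcl hvc
    rw [segment_symm]
    exact hf.segment_subset_timelike hu hw
  have hsu := speed_pos hu.1 hu.2
  have hsv : 0 ≤ speed f v := by
    rw [speed_of_ne f hv0]; exact Real.sqrt_nonneg _
  have hpos : ∀ σ ∈ Ioc (0 : ℝ) 1, v + σ • (u - v) ∈ timelike f := by
    intro σ hσ
    apply timelike_of_speed_pos
    refine lt_of_lt_of_le ?_ (key σ (Ioc_subset_Icc_self hσ))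
    have := mul_nonneg (sub_nonneg.2 hσ.2) hsv
    have := mul_pos hσ.1 hsu
    linarith
  have hfv : f v = 0 := by
    have hle : f v ≤ 0 := by
      have hcl : v ∈ closure (Z : Set E) := hvc
      by_contra hlt
      push Not at hlt
      have := mem_closure_iff_nhds.1 hcl _ ((hf.continuousAt hv0).eventually (lt_mem_nhds hlt))
      obtain ⟨w, hw1, hw2⟩ := this
      exact absurd hw1 (not_lt.2 (hZt hw2).2.le)
    by_contra hne
    have hvt : v ∈ timelike f := ⟨hv0, lt_of_le_of_ne hle hne⟩
    apply hvZ
    have hs : segment ℝ u v ⊆ timelike f := by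
      rw [segment_symm, segment_eq_image']
      rintro _ ⟨σ, hσ, rfl⟩
      rcases eq_or_lt_of_le hσ.1 with h | h
      · rw [← h]; simpa using hvt
      · exact hpos σ ⟨h, hσ.2⟩
    exact (convex_segment u v).isPreconnected.subset_connectedComponentIn (left_mem_segment _ _ _)
      hs (right_mem_segment _ _ _)
  refine ⟨hfv, ?_, hpos⟩
  have hsv0 : speed f v = 0 := by rw [speed_of_ne f hv0, hfv]; simp
  have hbd : ∀ σ ∈ Icc (0 : ℝ) 1, f (v + σ • (u - v)) ≤ -(σ * speed f u) ^ 2 := by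
    intro σ hσ
    rcases eq_or_lt_of_le hσ.1 with h | h
    · rw [← h]; simp [hfv]
    · have h1 := key σ hσ
      have h2 := hpos σ ⟨h, hσ.2⟩
      rw [hsv0, mul_zero, zero_add, speed_of_ne f h2.1] at h1
      have h3 := pow_le_pow_left₀ (mul_nonneg hσ.1 hsu.le) h1 2
      rw [Real.sq_sqrt (by linarith [h2.2])] at h3
      linarith
  set c := speed f u
  set w := u - v with hw
  have hvv : fderiv ℝ f v v = 0 := by rw [hf.fderiv_self hv0, hfv, mul_zero]
  have hpw : fderiv ℝ f v u = fderiv ℝ f v w := by rw [hw, map_sub, hvv, sub_zero]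
  rw [hpw]
  by_contra hge
  push Not at hge
  have hline : ∀ σ : ℝ, HasDerivAt (fun σ : ℝ => v + σ • w) w σ := fun σ => by
    simpa using ((hasDerivAt_id σ).smul_const w).const_add v
  have hne : ∀ σ ∈ Icc (0 : ℝ) 1, v + σ • w ≠ 0 := by
    intro σ hσ
    rcases eq_or_lt_of_le hσ.1 with h | h
    · rw [← h]; simpa using hv0
    · exact (hpos σ ⟨h, hσ.2⟩).1
  -- The added term `c² σ² / 2` is weaker than the decay `-c² σ²` of `hbd`, so the sum cannot
  -- increase from its value 0 at `σ = 0`; but if the differential of `f` at `v` were non-negative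
  -- on `w`, the sum would increase.
  have hd1 : ∀ σ ∈ Icc (0 : ℝ) 1, HasDerivAt (fun σ : ℝ => f (v + σ • w) + c ^ 2 / 2 * σ ^ 2)
      (fderiv ℝ f (v + σ • w) w + c ^ 2 * σ) σ := by
    intro σ hσ
    have h1 := (hf.differentiableAt (hne σ hσ)).hasFDerivAt.comp_hasDerivAt σ (hline σ)
    exact (h1.add ((hasDerivAt_pow 2 σ).const_mul (c ^ 2 / 2))).congr_deriv (by simp; ring)
  have hd2 : HasDerivAt (fun σ : ℝ => fderiv ℝ f (v + σ • w) w + c ^ 2 * σ)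
      (fderiv ℝ (fun u => fderiv ℝ f u) v w w + c ^ 2) 0 := by
    have h1 := (hf.hasFDerivAt_fderiv hv0).comp_hasDerivAt_of_eq (0 : ℝ) (hline 0) (by simp)
    have h2 := h1.clm_apply (hasDerivAt_const (0 : ℝ) w)
    exact (h2.add ((hasDerivAt_id (0 : ℝ)).const_mul (c ^ 2))).congr_deriv (by simp)
  have hev : ∀ᶠ σ in 𝓝[>] (0 : ℝ), 0 < fderiv ℝ f (v + σ • w) w + c ^ 2 * σ := by
    rcases eq_or_lt_of_le hge with h0 | h0
    -- In the borderline case `w` is orthogonal to the lightlike `v`, so the second derivative is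
    -- non-negative and the added `c²` makes it positive.
    · have hH : 0 ≤ fderiv ℝ (fun u => fderiv ℝ f u) v w w := by
        refine (hf.lorentzian v hv0).nonneg_of_orthogonal hv0 ?_ ?_
        · rw [hf.hessian_self hv0, hvv]
        · rw [hf.hessian_self hv0, ← h0]
      have h1 := hd2.tendsto_slope_zero_right
      have h2 : 0 < fderiv ℝ (fun u => fderiv ℝ f u) v w w + c ^ 2 := by positivity
      filter_upwards [h1.eventually (lt_mem_nhds h2), self_mem_nhdsWithin] with σ h3 (h4 : 0 < σ)
      simp only [zero_add, zero_smul, add_zero, ← h0, mul_zero, sub_zero, smul_eq_mul] at h3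
      exact pos_of_mul_pos_right h3 (inv_pos.2 h4).le
    · have h1 : ∀ᶠ σ in 𝓝 (0 : ℝ), 0 < fderiv ℝ f (v + σ • w) w + c ^ 2 * σ := by
        apply hd2.continuousAt.eventually (lt_mem_nhds _)
        simpa using h0
      exact nhdsWithin_le_nhds h1
  obtain ⟨δ, hδ0, hδ⟩ := mem_nhdsGT_iff_exists_Ioc_subset.1 hev
  set δ' := min δ 1
  have hδ'0 : 0 < δ' := lt_min hδ0 one_pos
  have hmono : StrictMonoOn (fun σ : ℝ => f (v + σ • w) + c ^ 2 / 2 * σ ^ 2) (Icc 0 δ') := by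
    apply strictMonoOn_of_hasDerivWithinAt_pos (convex_Icc 0 δ')
      (f' := fun σ => fderiv ℝ f (v + σ • w) w + c ^ 2 * σ)
    · exact fun σ hσ => (hd1 σ ⟨hσ.1, hσ.2.trans (min_le_right _ _)⟩).continuousAt.continuousWithinAt
    · intro σ hσ
      rw [interior_Icc] at hσ
      exact (hd1 σ ⟨hσ.1.le, hσ.2.le.trans (min_le_right _ _)⟩).hasDerivWithinAt
    · intro σ hσ
      rw [interior_Icc] at hσ
      exact hδ ⟨hσ.1, hσ.2.le.trans (min_le_left _ _)⟩
  have h1 := hmono (left_mem_Icc.2 hδ'0.le) (right_mem_Icc.2 hδ'0.le) hδ'0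
  have h2 := hbd δ' ⟨hδ'0.le, min_le_right _ _⟩
  simp only [zero_smul, add_zero, hfv] at h1
  have h3 : 0 < c ^ 2 * δ' ^ 2 := by positivity
  nlinarith

/-- A lightlike vector that is joined to a timelike vector `u` by a timelike segment lies in the
boundary of the component of timelike vectors that contains `u`. -/
theorem mem_frontier (hf : IsFibreLagrangian f) {u v : E}
    (hfv : f v = 0) (h : ∀ σ ∈ Ioc (0 : ℝ) 1, v + σ • (u - v) ∈ timelike f) :
    v ∈ frontier (connectedComponentIn (timelike f) u) := by
  have hZo : IsOpen (connectedComponentIn (timelike f) u) := hf.isOpen_timelike.connectedComponentIn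
  rw [hZo.frontier_eq]
  have hc : Continuous fun σ : ℝ => v + σ • (u - v) := by fun_prop
  have hsub : (fun σ : ℝ => v + σ • (u - v)) '' Ioc 0 1 ⊆ connectedComponentIn (timelike f) u := by
    apply (isPreconnected_Ioc.image _ hc.continuousOn).subset_connectedComponentIn
    · exact ⟨1, by simp, by simp⟩
    · rintro _ ⟨σ, hσ, rfl⟩
      exact h σ hσ
  refine ⟨?_, fun hv => ?_⟩
  · apply closure_mono hsub
    have h0 : (0 : ℝ) ∈ closure (Ioc (0 : ℝ) 1) := by
      rw [closure_Ioc zero_ne_one]; simp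
    have := image_closure_subset_closure_image hc ⟨0, h0, rfl⟩
    simpa using this
  · have := (connectedComponentIn_subset _ _ hv : v ∈ timelike f).2
    rw [hfv] at this
    exact lt_irrefl _ this

end IsFibreLagrangian

/-! ### Regularity of functions on a strip, up to its boundary. -/

section Strip

/-- A function on a strip with continuous partial derivative in the first variable and a partial
derivative in the second variable is differentiable. -/
theorem hasFDerivWithinAt_of_partial {a b : ℝ} {S : Set ℝ} {g A : ℝ × ℝ → ℝ} {p : ℝ × ℝ} {B : ℝ}
    (hA : ∀ q ∈ Ioo a b ×ˢ S, HasDerivAt (fun x => g (x, q.2)) (A q) q.1)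
    (hAc : ContinuousOn A (Ioo a b ×ˢ S)) (hp : p ∈ Ioo a b ×ˢ S)
    (hB : HasDerivWithinAt (fun s => g (p.1, s)) B S p.2) :
    HasFDerivWithinAt g (A p • ContinuousLinearMap.fst ℝ ℝ ℝ + B • ContinuousLinearMap.snd ℝ ℝ ℝ)
      (Ioo a b ×ˢ S) p := by
  have h2 : HasFDerivWithinAt (fun q : ℝ × ℝ => g (p.1, q.2)) (B • ContinuousLinearMap.snd ℝ ℝ ℝ)
      (Ioo a b ×ˢ S) p := by
    have h := hB.comp_hasFDerivWithinAt (s := Ioo a b ×ˢ S) (f := Prod.snd) p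
      (ContinuousLinearMap.snd ℝ ℝ ℝ).hasFDerivWithinAt (fun q hq => hq.2)
    exact h
  have h1 : HasFDerivWithinAt (fun q : ℝ × ℝ => g q - g (p.1, q.2))
      (A p • ContinuousLinearMap.fst ℝ ℝ ℝ) (Ioo a b ×ˢ S) p := by
    rw [hasFDerivWithinAt_iff_isLittleO, Asymptotics.isLittleO_iff]
    intro c hc
    have hev := (hAc p hp).eventually (Metric.ball_mem_nhds (A p) hc)
    obtain ⟨δ, hδ0, hδ⟩ := Metric.mem_nhdsWithin_iff.1 hev
    filter_upwards [inter_mem_nhdsWithin (Ioo a b ×ˢ S) (Metric.ball_mem_nhds p hδ0)]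
      with q hq
    have hq1 : dist q.1 p.1 < δ := lt_of_le_of_lt (le_max_left _ _) hq.2
    have hq2 : dist q.2 p.2 < δ := lt_of_le_of_lt (le_max_right _ _) hq.2
    have hseg : ∀ x ∈ uIcc p.1 q.1, (x, q.2) ∈ Ioo a b ×ˢ S ∧ dist (A (x, q.2)) (A p) < c := by
      intro x hx
      have hxa : x ∈ Ioo a b := (ordConnected_Ioo.uIcc_subset hp.1 hq.1.1) hx
      refine ⟨⟨hxa, hq.1.2⟩, hδ ⟨?_, ⟨hxa, hq.1.2⟩⟩⟩
      refine max_lt ?_ hq2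
      have : dist x p.1 ≤ dist q.1 p.1 := by
        rw [Real.dist_eq, Real.dist_eq]
        exact abs_sub_left_of_mem_uIcc hx
      exact this.trans_lt hq1
    -- Mean value inequality in the first variable at the fixed height `q.2`; continuity of `A`
    -- makes the error uniform in that height.
    have hmv := (convex_uIcc p.1 q.1).norm_image_sub_le_of_norm_hasDerivWithin_le
      (f := fun x => g (x, q.2) - A p * x) (f' := fun x => A (x, q.2) - A p) (C := c)
      (fun x hx => by
        have h := (hA (x, q.2) (hseg x hx).1).hasDerivWithinAt (s := uIcc p.1 q.1)
        exact (h.sub ((hasDerivWithinAt_id _ _).const_mul (A p))).congr_deriv (by simp))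
      (fun x hx => by simpa [Real.dist_eq] using (hseg x hx).2.le)
      left_mem_uIcc right_mem_uIcc
    have e : g q - g (p.1, q.2) - (g p - g (p.1, p.2)) -
        (A p • ContinuousLinearMap.fst ℝ ℝ ℝ) (q - p) =
        g (q.1, q.2) - A p * q.1 - (g (p.1, q.2) - A p * p.1) := by
      simp
      ring
    rw [e]
    refine hmv.trans ?_
    gcongr
    exact le_max_left _ _
  refine (h1.add h2).congr_of_eventuallyEq ?_ ?_
  · filter_upwards with q
    simp
  · simp

theorem uniqueDiffOn_strip {a b : ℝ} : UniqueDiffOn ℝ (Ioo a b ×ˢ Icc (0 : ℝ) 1) :=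
  (uniqueDiffOn_Ioo a b).prod (uniqueDiffOn_Icc zero_lt_one)

/-- This is the step of the regularity inductions for primitives and for solutions of differential
equations, where both partial derivatives are known explicitly. -/
theorem contDiffOn_succ_of_partial {a b : ℝ} {g A B : ℝ × ℝ → ℝ} {n : ℕ}
    (hA : ∀ q ∈ Ioo a b ×ˢ Icc (0 : ℝ) 1, HasDerivAt (fun x => g (x, q.2)) (A q) q.1)
    (hB : ∀ q ∈ Ioo a b ×ˢ Icc (0 : ℝ) 1,
      HasDerivWithinAt (fun s => g (q.1, s)) (B q) (Icc 0 1) q.2)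
    (hAn : ContDiffOn ℝ n A (Ioo a b ×ˢ Icc (0 : ℝ) 1))
    (hBn : ContDiffOn ℝ n B (Ioo a b ×ˢ Icc (0 : ℝ) 1)) :
    ContDiffOn ℝ (n + 1 : ℕ) g (Ioo a b ×ˢ Icc (0 : ℝ) 1) := by
  have hd : ∀ q ∈ Ioo a b ×ˢ Icc (0 : ℝ) 1, HasFDerivWithinAt g
      (A q • ContinuousLinearMap.fst ℝ ℝ ℝ + B q • ContinuousLinearMap.snd ℝ ℝ ℝ)
      (Ioo a b ×ˢ Icc (0 : ℝ) 1) q := fun q hq =>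
    hasFDerivWithinAt_of_partial hA hAn.continuousOn hq (hB q hq)
  push_cast
  rw [contDiffOn_succ_iff_fderivWithin uniqueDiffOn_strip]
  refine ⟨fun q hq => (hd q hq).differentiableWithinAt, by simp, ?_⟩
  have : ContDiffOn ℝ n (fun q => A q • ContinuousLinearMap.fst ℝ ℝ ℝ +
      B q • ContinuousLinearMap.snd ℝ ℝ ℝ) (Ioo a b ×ˢ Icc (0 : ℝ) 1) :=
    (hAn.smul contDiffOn_const).add (hBn.smul contDiffOn_const)
  exact this.congr fun q hq => (hd q hq).fderivWithin (uniqueDiffOn_strip q hq)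

/-- Primitives in the second variable of a function on a strip. -/
def primitive (h : ℝ × ℝ → ℝ) (p : ℝ × ℝ) : ℝ := ∫ σ in (0 : ℝ)..p.2, h (p.1, σ)

theorem continuousOn_primitive {a b : ℝ} {h : ℝ × ℝ → ℝ}
    (hh : ContinuousOn h (Ioo a b ×ˢ Icc (0 : ℝ) 1)) :
    ContinuousOn (primitive h) (Ioo a b ×ˢ Icc (0 : ℝ) 1) := by
  intro p hp
  obtain ⟨a', ha'⟩ := exists_between hp.1.1
  obtain ⟨b', hb'⟩ := exists_between hp.1.2
  have hab : a' ≤ b' := (ha'.2.trans hb'.1).le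
  -- Projecting onto a compact rectangle extends `h` continuously to the plane, without changing it
  -- on the part of the strip near `p`.
  set k : ℝ × ℝ → ℝ := fun q =>
    h (projIcc a' b' hab q.1, projIcc (0 : ℝ) 1 zero_le_one q.2)
  have hk : Continuous k := by
    apply hh.comp_continuous (by fun_prop)
    intro q
    have h1 := (projIcc a' b' hab q.1).2
    exact ⟨⟨ha'.1.trans_le h1.1, h1.2.trans_lt hb'.2⟩, (projIcc (0 : ℝ) 1 zero_le_one q.2).2⟩
  have hc : Continuous (fun q : ℝ × ℝ => ∫ σ in (0 : ℝ)..q.2, k (q.1, σ)) :=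
    intervalIntegral.continuous_parametric_intervalIntegral_of_continuous
      (f := fun q σ => k (q.1, σ)) (by fun_prop) continuous_snd
  refine hc.continuousWithinAt.congr_of_eventuallyEq ?_ ?_
  · have hn : Ioo a' b' ×ˢ (univ : Set ℝ) ∈ 𝓝 p :=
      prod_mem_nhds (Ioo_mem_nhds ha'.2 hb'.1) Filter.univ_mem
    filter_upwards [inter_mem_nhdsWithin (Ioo a b ×ˢ Icc (0 : ℝ) 1) hn] with q hq
    apply intervalIntegral.integral_congr
    intro σ hσ
    rw [uIcc_of_le hq.1.2.1] at hσ
    have h1 : σ ∈ Icc (0 : ℝ) 1 := ⟨hσ.1, hσ.2.trans hq.1.2.2⟩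
    simp only [k]
    rw [projIcc_of_mem hab (Ioo_subset_Icc_self hq.2.1), projIcc_of_mem zero_le_one h1]
  · apply intervalIntegral.integral_congr
    intro σ hσ
    rw [uIcc_of_le hp.2.1] at hσ
    have h1 : σ ∈ Icc (0 : ℝ) 1 := ⟨hσ.1, hσ.2.trans hp.2.2⟩
    simp only [k]
    rw [projIcc_of_mem hab ⟨ha'.2.le, hb'.1.le⟩, projIcc_of_mem zero_le_one h1]

/-- The fundamental theorem of calculus on `[0, 1]`, with one-sided derivatives at the ends. -/
theorem hasDerivWithinAt_integral {k : ℝ → ℝ} (hk : ContinuousOn k (Icc 0 1)) {s : ℝ}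
    (hs : s ∈ Icc (0 : ℝ) 1) :
    HasDerivWithinAt (fun s => ∫ σ in (0 : ℝ)..s, k σ) (k s) (Icc 0 1) s := by
  set k' : ℝ → ℝ := fun σ => k (projIcc (0 : ℝ) 1 zero_le_one σ)
  have hk' : Continuous k' := hk.comp_continuous (by fun_prop) fun σ => Subtype.coe_prop _
  have h1 : HasDerivAt (fun s => ∫ σ in (0 : ℝ)..s, k' σ) (k' s) s :=
    hk'.integral_hasStrictDerivAt 0 s |>.hasDerivAt
  have e : ∀ s ∈ Icc (0 : ℝ) 1, k' s = k s := fun s hs => by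
    simp only [k']; rw [projIcc_of_mem zero_le_one hs]
  rw [← e s hs]
  refine h1.hasDerivWithinAt.congr (fun t ht => ?_) ?_ <;>
  · apply intervalIntegral.integral_congr
    intro σ hσ
    rw [uIcc_of_le (by first | exact ht.1 | exact hs.1)] at hσ
    refine (e σ ⟨hσ.1, hσ.2.trans ?_⟩).symm
    first | exact ht.2 | exact hs.2

/-- The partial derivatives of a primitive are `h` itself and, by differentiation under the integral
sign, the primitive of the derivative of `h` in the parameter; the induction hypothesis applies to
the latter. -/
theorem contDiffOn_primitive {a b : ℝ} (n : ℕ) : ∀ {h : ℝ × ℝ → ℝ},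
    ContDiffOn ℝ n h (Ioo a b ×ˢ Icc (0 : ℝ) 1) →
    ContDiffOn ℝ n (primitive h) (Ioo a b ×ˢ Icc (0 : ℝ) 1) := by
  induction n with
  | zero =>
    intro h hh
    simp only [Nat.cast_zero, contDiffOn_zero] at hh ⊢
    exact continuousOn_primitive hh
  | succ n ih =>
    intro h hh
    set D := Ioo a b ×ˢ Icc (0 : ℝ) 1
    set hε : ℝ × ℝ → ℝ := fun q => fderivWithin ℝ h D q (1, 0)
    have hεn : ContDiffOn ℝ n hε D := by
      have := hh.fderivWithin (m := n) uniqueDiffOn_strip (by norm_cast)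
      exact this.clm_apply contDiffOn_const
    have hdiff : ∀ q ∈ D, HasDerivAt (fun x => h (x, q.2)) (hε q) q.1 := by
      intro q hq
      have h1 : HasFDerivWithinAt h (fderivWithin ℝ h D q) D q :=
        (hh.differentiableOn (by simp) q hq).hasFDerivWithinAt
      have h2 : HasDerivWithinAt (fun x : ℝ => ((x, q.2) : ℝ × ℝ)) (1, 0) (Ioo a b) q.1 :=
        ((hasDerivAt_id q.1).prodMk (hasDerivAt_const q.1 q.2)).hasDerivWithinAt
      have h3 := h1.comp_hasDerivWithinAt (f := fun x : ℝ => ((x, q.2) : ℝ × ℝ)) q.1 h2 (fun x hx => ⟨hx, hq.2⟩)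
      exact h3.hasDerivAt (Ioo_mem_nhds hq.1.1 hq.1.2)
    refine contDiffOn_succ_of_partial (A := primitive hε) (B := h) ?_ ?_ (ih hεn)
      (hh.of_le (by norm_cast; omega))
    · intro p hp
      obtain ⟨a', ha'⟩ := exists_between hp.1.1
      obtain ⟨b', hb'⟩ := exists_between hp.1.2
      have hsub : Icc a' b' ×ˢ Icc (0 : ℝ) 1 ⊆ D :=
        prod_mono (fun x hx => ⟨ha'.1.trans_le hx.1, hx.2.trans_lt hb'.2⟩) subset_rfl
      obtain ⟨C, hC⟩ := (isCompact_Icc.prod isCompact_Icc).exists_bound_of_continuousOn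
        (hεn.continuousOn.mono hsub)
      have hsec : ∀ {k : ℝ × ℝ → ℝ}, ContinuousOn k D → ∀ x ∈ Ioo a b,
          ContinuousOn (fun σ => k (x, σ)) (uIcc 0 p.2) := by
        intro k hk x hx
        refine hk.comp (by fun_prop) fun σ hσ => ?_
        rw [uIcc_of_le hp.2.1] at hσ
        exact ⟨hx, hσ.1, hσ.2.trans hp.2.2⟩
      have hmeas : ∀ {k : ℝ × ℝ → ℝ}, ContinuousOn k D → ∀ x ∈ Ioo a b,
          MeasureTheory.AEStronglyMeasurable (fun σ => k (x, σ))
            (MeasureTheory.volume.restrict (uIoc 0 p.2)) := fun hk x hx =>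
        ((hsec hk x hx).mono uIoc_subset_uIcc).aestronglyMeasurable measurableSet_uIoc
      refine (intervalIntegral.hasDerivAt_integral_of_dominated_loc_of_deriv_le
        (F := fun x σ => h (x, σ)) (F' := fun x σ => hε (x, σ)) (bound := fun _ => C)
        (Icc_mem_nhds ha'.2 hb'.1) ?_ ?_ ?_ ?_ ?_ ?_).2
      · filter_upwards [Ioo_mem_nhds hp.1.1 hp.1.2] with x hx
        exact hmeas hh.continuousOn x hx
      · exact (hsec hh.continuousOn _ hp.1).intervalIntegrable
      · exact hmeas hεn.continuousOn _ hp.1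
      · filter_upwards with σ hσ x hx
        rw [uIoc_of_le hp.2.1] at hσ
        exact hC (x, σ) ⟨hx, hσ.1.le, hσ.2.trans hp.2.2⟩
      · exact intervalIntegrable_const
      · filter_upwards with σ hσ x hx
        rw [uIoc_of_le hp.2.1] at hσ
        exact hdiff (x, σ) (hsub ⟨hx, hσ.1.le, hσ.2.trans hp.2.2⟩)
    · intro p hp
      exact hasDerivWithinAt_integral (k := fun σ => h (p.1, σ))
        (hh.continuousOn.comp (by fun_prop) fun σ hσ => ⟨hp.1, hσ⟩) hp.2

end Strip

/-! ### Regularity of implicitly defined functions. -/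

section Implicit

variable {X : Type*} [NormedAddCommGroup X] [NormedSpace ℝ X]

/-- Smoothness of a continuous scalar function that is defined implicitly on a set with unique
derivatives. -/
theorem contDiffOn_implicit {S : Set X} (hS : UniqueDiffOn ℝ S) {T : Set ℝ} {F : X × ℝ → ℝ}
    {F' : X × ℝ → X × ℝ →L[ℝ] ℝ} (hF : ∀ z ∈ S ×ˢ T, HasFDerivWithinAt F (F' z) (S ×ˢ T) z)
    (hF' : ContDiffOn ℝ ∞ F' (S ×ˢ T)) {f : X → ℝ} (hfc : ContinuousOn f S) (hfT : MapsTo f S T)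
    (hz : ∀ x ∈ S, F (x, f x) = 0) (hv : ∀ x ∈ S, F' (x, f x) (0, 1) ≠ 0) :
    (∀ x ∈ S, HasFDerivWithinAt f (-(F' (x, f x) (0, 1))⁻¹ •
      (F' (x, f x)).comp (ContinuousLinearMap.inl ℝ X ℝ)) S x) ∧ ContDiffOn ℝ ∞ f S := by
  have hd : ∀ x ∈ S, HasFDerivWithinAt f (-(F' (x, f x) (0, 1))⁻¹ •
      (F' (x, f x)).comp (ContinuousLinearMap.inl ℝ X ℝ)) S x := by
    intro x hx
    set A := (F' (x, f x)).comp (ContinuousLinearMap.inl ℝ X ℝ)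
    set c := F' (x, f x) (0, 1)
    have hc : c ≠ 0 := hv x hx
    have hG : HasFDerivWithinAt (fun z : X × ℝ => (z.1, F z))
        ((ContinuousLinearMap.fst ℝ X ℝ).prod (F' (x, f x))) (S ×ˢ T) (x, f x) :=
      (ContinuousLinearMap.fst ℝ X ℝ).hasFDerivWithinAt.prodMk (hF _ ⟨hx, hfT hx⟩)
    have hH : HasFDerivWithinAt (fun y : X => (y, (0 : ℝ)))
        ((ContinuousLinearMap.id ℝ X).prod (0 : X →L[ℝ] ℝ)) S x :=
      (hasFDerivWithinAt_id x S).prodMk (hasFDerivWithinAt_const _ _ _)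
    -- The map `(x, v) ↦ (x, F(x, v))` sends the graph of `f` to `(x, 0)`. Inverting its
    -- differential turns the continuity of `f` into differentiability, and this needs no interior
    -- points of `S`.
    set inv : X × ℝ →L[ℝ] X × ℝ := (ContinuousLinearMap.fst ℝ X ℝ).prod
      (c⁻¹ • (ContinuousLinearMap.snd ℝ X ℝ - A.comp (ContinuousLinearMap.fst ℝ X ℝ)))
    have hinv : Function.LeftInverse inv
        ((ContinuousLinearMap.fst ℝ X ℝ).prod (F' (x, f x))) := by
      rintro ⟨y, v⟩
      have hsplit : F' (x, f x) (y, v) = A y + v * c := by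
        have : ((y, v) : X × ℝ) = (y, 0) + v • (0, 1) := by simp
        rw [this, map_add, map_smul]
        rfl
      simp [inv, hsplit]
      field_simp
    have h := HasFDerivWithinAt.of_comp_of_leftInverse (g := fun y => (y, f y)) (a := x)
      (s := S) (t := S ×ˢ T) ?_ hG hH ?_ hinv hx
    · have h2 := (ContinuousLinearMap.snd ℝ X ℝ).hasFDerivAt.comp_hasFDerivWithinAt x h
      refine h2.congr_fderiv ?_
      ext y
      simp [inv, A]
    · refine tendsto_nhdsWithin_of_tendsto_nhds_of_eventually_within _ ?_ ?_
      · exact (continuousWithinAt_id.prodMk (hfc x hx))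
      · filter_upwards [self_mem_nhdsWithin] with y hy
        exact ⟨hy, hfT hy⟩
    · filter_upwards [self_mem_nhdsWithin] with y hy
      simp [hz y hy]
  refine ⟨hd, contDiffOn_infty.2 fun n => ?_⟩
  -- The derivative of `f` is an algebraic expression in `F' (x, f x)`, hence as smooth as `f`.
  induction n with
  | zero => simpa using hfc
  | succ n ih =>
    push_cast
    rw [contDiffOn_succ_iff_fderivWithin hS]
    refine ⟨fun x hx => (hd x hx).differentiableWithinAt, by simp, ?_⟩
    have h1 : ContDiffOn ℝ n (fun x => F' (x, f x)) S :=
      (hF'.of_le (by exact_mod_cast le_top)).comp (contDiffOn_id.prodMk ih) fun x hx => ⟨hx, hfT hx⟩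
    have h2 : ContDiffOn ℝ n (fun x => -(F' (x, f x) (0, 1))⁻¹ •
      (F' (x, f x)).comp (ContinuousLinearMap.inl ℝ X ℝ)) S :=
      ((h1.clm_apply contDiffOn_const).inv hv).neg.smul (h1.clm_comp contDiffOn_const)
    exact h2.congr fun x hx => (hd x hx).fderivWithin (hS x hx)

end Implicit

/-! ### Scalar differential equations with a parameter, explicit and implicit. -/

section ODE

/-- A function that is continuously differentiable on a compact convex set is Lipschitz there. -/
theorem exists_norm_sub_le_of_contDiffOn {X Y : Type*} [NormedAddCommGroup X] [NormedSpace ℝ X]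
    [NormedAddCommGroup Y] [NormedSpace ℝ Y] {D : Set X} (hD : UniqueDiffOn ℝ D)
    (hDc : IsCompact D) (hDv : Convex ℝ D) {f : X → Y} (hf : ContDiffOn ℝ 1 f D) :
    ∃ K : ℝ, 1 ≤ K ∧ ∀ x ∈ D, ∀ y ∈ D, ‖f x - f y‖ ≤ K * ‖x - y‖ := by
  obtain ⟨C, hC⟩ := hDc.exists_bound_of_continuousOn (hf.continuousOn_fderivWithin hD (by simp))
  refine ⟨max C 1, le_max_right _ _, fun x hx y hy => ?_⟩
  exact hDv.norm_image_sub_le_of_norm_fderivWithin_le (hf.differentiableOn (by simp))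
    (fun z hz => (hC z hz).trans (le_max_left _ _)) hy hx

theorem hasDerivWithinAt_Ici_of_Icc {f : ℝ → ℝ} {c s : ℝ} (hs : s ∈ Ico (0 : ℝ) 1)
    (h : HasDerivWithinAt f c (Icc 0 1) s) : HasDerivWithinAt f c (Ici s) s :=
  h.mono_of_mem_nhdsWithin (Filter.mem_of_superset (Icc_mem_nhdsGE hs.2)
    (Icc_subset_Icc_left hs.1))

/-- Grönwall's inequality on `[0, 1]` with zero initial value. -/
theorem abs_le_of_abs_deriv_le {f f' : ℝ → ℝ} {K c : ℝ} (hK : 1 ≤ K) (hc : 0 ≤ c)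
    (hf : ∀ s ∈ Icc (0 : ℝ) 1, HasDerivWithinAt f (f' s) (Icc 0 1) s) (h0 : f 0 = 0)
    (hb : ∀ s ∈ Icc (0 : ℝ) 1, |f' s| ≤ K * |f s| + c) {s : ℝ} (hs : s ∈ Icc (0 : ℝ) 1) :
    |f s| ≤ Real.exp K * c := by
  have h := norm_le_gronwallBound_of_norm_deriv_right_le (δ := 0) (ε := c) (K := K)
    (fun s hs => (hf s hs).continuousWithinAt)
    (fun s hs => hasDerivWithinAt_Ici_of_Icc hs (hf s (Ico_subset_Icc_self hs)))
    (by simp [h0]) (fun s hs => hb s (Ico_subset_Icc_self hs)) s hs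
  rw [gronwallBound_of_K_ne_0 (by linarith)] at h
  simp only [zero_mul, zero_add, sub_zero, Real.norm_eq_abs] at h
  refine h.trans ?_
  have h1 : Real.exp (K * s) ≤ Real.exp K := by
    apply Real.exp_le_exp.2
    nlinarith [hs.2]
  have h2 : c / K ≤ c := div_le_self hc hK
  have h3 : 0 ≤ c / K := by positivity
  nlinarith [Real.exp_pos (K * s), Real.exp_pos K]

/-- The closed box in which an ODE with parameter is considered. -/
def box (δ : ℝ) : Set (ℝ × ℝ × ℝ) := Icc 0 1 ×ˢ Icc (-δ) δ ×ˢ Icc (-δ) δ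

theorem isCompact_box (δ : ℝ) : IsCompact (box δ) :=
  isCompact_Icc.prod (isCompact_Icc.prod isCompact_Icc)

theorem convex_box (δ : ℝ) : Convex ℝ (box δ) :=
  (convex_Icc _ _).prod ((convex_Icc _ _).prod (convex_Icc _ _))

theorem uniqueDiffOn_box {δ : ℝ} (hδ : 0 < δ) : UniqueDiffOn ℝ (box δ) :=
  (uniqueDiffOn_Icc zero_lt_one).prod
    ((uniqueDiffOn_Icc (by linarith)).prod (uniqueDiffOn_Icc (by linarith)))

variable {δ : ℝ} {f : ℝ × ℝ × ℝ → ℝ}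

/-- Existence of solutions of a scalar ODE with parameter, near a trivial solution. -/
theorem exists_solution (hδ : 0 < δ) (hf : ContDiffOn ℝ ∞ f (box δ))
    (h0 : ∀ s ∈ Icc (0 : ℝ) 1, f (s, 0, 0) = 0) :
    ∃ ε₀, 0 < ε₀ ∧ ε₀ ≤ δ ∧ ∃ r : ℝ × ℝ → ℝ, (∀ s ∈ Icc (0 : ℝ) 1, r (0, s) = 0) ∧
      ∀ ε ∈ Ioo (-ε₀) ε₀, r (ε, 0) = 0 ∧ ∀ s ∈ Icc (0 : ℝ) 1, r (ε, s) ∈ Icc (-δ) δ ∧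
        HasDerivWithinAt (fun s => r (ε, s)) (f (s, ε, r (ε, s))) (Icc 0 1) s := by
  obtain ⟨K, hK1, hK⟩ := exists_norm_sub_le_of_contDiffOn (uniqueDiffOn_box hδ) (isCompact_box δ)
    (convex_box δ) (hf.of_le (by exact_mod_cast le_top))
  obtain ⟨C, hC⟩ := (isCompact_box δ).exists_bound_of_continuousOn hf.continuousOn
  have hδ' : -δ ≤ δ := by linarith
  have h00 : (0 : ℝ) ∈ Icc (-δ) δ := ⟨by linarith, hδ.le⟩
  have hC0 : 0 ≤ C := (norm_nonneg _).trans (hC (0, 0, 0) ⟨⟨le_rfl, zero_le_one⟩, h00, h00⟩)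
  have hlip : ∀ x y : ℝ, |(projIcc (-δ) δ hδ' x : ℝ) - projIcc (-δ) δ hδ' y| ≤ |x - y| := by
    intro x y
    simpa [Real.dist_eq, Subtype.dist_eq] using
      (LipschitzWith.projIcc hδ').dist_le_mul x y
  have hp0 : (projIcc (-δ) δ hδ' 0 : ℝ) = 0 := by rw [projIcc_of_mem hδ' h00]
  -- Clamping the unknown to `[-δ, δ]` makes the right-hand side bounded and Lipschitz for all
  -- values of the unknown, so solutions exist on all of `[0, 1]`.
  have hex : ∀ ε ∈ Icc (-δ) δ, ∃ α : ℝ → ℝ, α 0 = 0 ∧ ∀ s ∈ Icc (0 : ℝ) 1,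
      HasDerivWithinAt α (f (s, ε, projIcc (-δ) δ hδ' (α s))) (Icc 0 1) s := by
    intro ε hε
    have hmem : ∀ s ∈ Icc (0 : ℝ) 1, ∀ x : ℝ,
        (s, ε, (projIcc (-δ) δ hδ' x : ℝ)) ∈ box δ :=
      fun s hs x => ⟨hs, hε, Subtype.coe_prop _⟩
    have hpl : IsPicardLindelof (fun s x => f (s, ε, projIcc (-δ) δ hδ' x))
        (tmin := 0) (tmax := 1) ⟨0, left_mem_Icc.2 zero_le_one⟩ (0 : ℝ) C.toNNReal 0 C.toNNReal
        K.toNNReal := by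
      constructor
      · intro s hs
        apply LipschitzOnWith.of_dist_le_mul
        intro x _ y _
        rw [Real.dist_eq, Real.dist_eq, Real.coe_toNNReal _ (by linarith)]
        refine (hK _ (hmem s hs x) _ (hmem s hs y)).trans ?_
        gcongr
        simpa [Prod.norm_def] using hlip x y
      · intro x _
        exact hf.continuousOn.comp (by fun_prop) fun s hs => hmem s hs x
      · intro s hs x _
        rw [Real.coe_toNNReal _ hC0]
        exact hC _ (hmem s hs x)
      · simp
    exact hpl.exists_eq_forall_mem_Icc_hasDerivWithinAt₀
  choose! α hα0 hα using hex
  -- Grönwall bounds the clamped solution by `exp K * K * |ε|`; for these `ε` that is at most `δ`,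
  -- so the clamp has no effect.
  set ε₀ := min δ (δ / (Real.exp K * K))
  have hε₀ : 0 < ε₀ := lt_min hδ (by positivity)
  have hαb : ∀ ε ∈ Icc (-δ) δ, ∀ s ∈ Icc (0 : ℝ) 1, |α ε s| ≤ Real.exp K * (K * |ε|) := by
    intro ε hεδ s hs
    refine abs_le_of_abs_deriv_le hK1 (c := K * |ε|) (by positivity) (hα ε hεδ) (hα0 ε hεδ)
      (fun s hs => ?_) hs
    have h1 := hK (s, ε, projIcc (-δ) δ hδ' (α ε s)) ⟨hs, hεδ, Subtype.coe_prop _⟩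
      (s, 0, 0) ⟨hs, h00, h00⟩
    rw [h0 s hs, sub_zero] at h1
    refine h1.trans ?_
    have h2 := hlip (α ε s) 0
    rw [hp0, sub_zero, sub_zero] at h2
    rw [← mul_add]
    gcongr
    simp only [Prod.mk_sub_mk, sub_self, sub_zero, Prod.norm_def, norm_zero, Real.norm_eq_abs]
    refine max_le (by positivity) (max_le ?_ ?_)
    · linarith [abs_nonneg (α ε s)]
    · linarith [abs_nonneg ε]
  refine ⟨ε₀, hε₀, min_le_left _ _, fun p => α p.1 p.2, fun s hs => ?_, fun ε hε => ?_⟩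
  · have := hαb 0 h00 s hs
    simpa using this
  have hεδ : ε ∈ Icc (-δ) δ :=
    ⟨by linarith [hε.1, min_le_left δ (δ / (Real.exp K * K))],
      hε.2.le.trans (min_le_left _ _)⟩
  have hb : ∀ s ∈ Icc (0 : ℝ) 1, α ε s ∈ Icc (-δ) δ := by
    intro s hs
    rw [mem_Icc, ← abs_le]
    refine (hαb ε hεδ s hs).trans ?_
    have h1 : |ε| ≤ δ / (Real.exp K * K) := (abs_lt.2 hε).le.trans (min_le_right _ _)
    rw [le_div_iff₀ (by positivity)] at h1
    linarith
  refine ⟨hα0 ε hεδ, fun s hs => ⟨hb s hs, ?_⟩⟩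
  have h1 := hα ε hεδ s hs
  rwa [projIcc_of_mem hδ' (hb s hs)] at h1

/-- The derivative of the solutions with respect to the parameter, by the variation of constants
formula. -/
def paramDeriv (δ : ℝ) (f : ℝ × ℝ × ℝ → ℝ) (r : ℝ × ℝ → ℝ) (p : ℝ × ℝ) : ℝ :=
  Real.exp (primitive (fun q => fderivWithin ℝ f (box δ) (q.2, q.1, r q) (0, 0, 1)) p) *
    primitive (fun p => Real.exp
      (-primitive (fun q => fderivWithin ℝ f (box δ) (q.2, q.1, r q) (0, 0, 1)) p) *
        fderivWithin ℝ f (box δ) (p.2, p.1, r p) (0, 1, 0)) p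

/-- Solutions of a scalar ODE with parameter depend smoothly on the parameter. -/
theorem contDiffOn_solution (hδ : 0 < δ) (hf : ContDiffOn ℝ ∞ f (box δ)) {ε₀ : ℝ}
    (hε₀ : ε₀ ≤ δ) {r : ℝ × ℝ → ℝ} (hr0 : ∀ ε ∈ Ioo (-ε₀) ε₀, r (ε, 0) = 0)
    (hrδ : ∀ ε ∈ Ioo (-ε₀) ε₀, ∀ s ∈ Icc (0 : ℝ) 1, r (ε, s) ∈ Icc (-δ) δ)
    (hr : ∀ ε ∈ Ioo (-ε₀) ε₀, ∀ s ∈ Icc (0 : ℝ) 1,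
        HasDerivWithinAt (fun s => r (ε, s)) (f (s, ε, r (ε, s))) (Icc 0 1) s) :
    ContDiffOn ℝ ∞ r (Ioo (-ε₀) ε₀ ×ˢ Icc 0 1) ∧
    ∀ ε ∈ Ioo (-ε₀) ε₀, ∀ s ∈ Icc (0 : ℝ) 1,
      HasDerivAt (fun ε => r (ε, s)) (paramDeriv δ f r (ε, s)) ε ∧
      HasDerivWithinAt (fun s => paramDeriv δ f r (ε, s))
        (fderivWithin ℝ f (box δ) (s, ε, r (ε, s)) (0, 1, paramDeriv δ f r (ε, s)))
        (Icc 0 1) s := by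
  set R := Ioo (-ε₀) ε₀ ×ˢ Icc (0 : ℝ) 1
  have hbox : ∀ p ∈ R, (p.2, p.1, r p) ∈ box δ := fun p hp =>
    ⟨hp.2, ⟨by linarith [hp.1.1], by linarith [hp.1.2]⟩, hrδ _ hp.1 _ hp.2⟩
  obtain ⟨K, hK1, hK⟩ := exists_norm_sub_le_of_contDiffOn (uniqueDiffOn_box hδ) (isCompact_box δ)
    (convex_box δ) (hf.of_le (by exact_mod_cast le_top))
  have hf' : ContDiffOn ℝ ∞ (fderivWithin ℝ f (box δ)) (box δ) :=
    hf.fderivWithin (uniqueDiffOn_box hδ) (by norm_cast)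
  obtain ⟨K', hK'1, hK'⟩ := exists_norm_sub_le_of_contDiffOn (uniqueDiffOn_box hδ)
    (isCompact_box δ) (convex_box δ) (hf'.of_le (by exact_mod_cast le_top))
  obtain ⟨C, hC⟩ := (isCompact_box δ).exists_bound_of_continuousOn hf.continuousOn
  obtain ⟨C', hC'⟩ := (isCompact_box δ).exists_bound_of_continuousOn hf'.continuousOn
  -- Grönwall gives a Lipschitz bound in `ε`, uniform in `s`; together with continuity in `s` it
  -- yields joint continuity.
  have hε : ∀ ε ∈ Ioo (-ε₀) ε₀, ∀ ε' ∈ Ioo (-ε₀) ε₀, ∀ s ∈ Icc (0 : ℝ) 1,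
      |r (ε', s) - r (ε, s)| ≤ Real.exp K * (K * |ε' - ε|) := by
    intro ε hε ε' hε' s hs
    refine abs_le_of_abs_deriv_le (f := fun s => r (ε', s) - r (ε, s)) hK1 (by positivity)
      (fun s hs => (hr ε' hε' s hs).sub (hr ε hε s hs)) (by simp [hr0 _ hε, hr0 _ hε']) ?_ hs
    intro s hs
    refine (hK _ (hbox (ε', s) ⟨hε', hs⟩) _ (hbox (ε, s) ⟨hε, hs⟩)).trans ?_
    rw [← mul_add]
    gcongr
    simp only [Prod.mk_sub_mk, sub_self, Prod.norm_def, norm_zero, Real.norm_eq_abs]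
    refine max_le (by positivity) (max_le ?_ ?_)
    · linarith [abs_nonneg (r (ε', s) - r (ε, s))]
    · linarith [abs_nonneg (ε' - ε)]
  have hcont : ContinuousOn r R := by
    intro p hp
    have hb : ∀ q ∈ R, ‖r q - r p‖ ≤ Real.exp K * (K * |q.1 - p.1|) + |r (p.1, q.2) - r p| := by
      intro q hq
      have h1 := hε p.1 hp.1 q.1 hq.1 q.2 hq.2
      calc ‖r q - r p‖ = |(r (q.1, q.2) - r (p.1, q.2)) + (r (p.1, q.2) - r p)| := by
            rw [Real.norm_eq_abs]; ring_nf
        _ ≤ _ := (abs_add_le _ _).trans (by gcongr)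
    have h2 : Filter.Tendsto (fun q : ℝ × ℝ => r (p.1, q.2)) (𝓝[R] p) (𝓝 (r p)) := by
      have h3 : Filter.Tendsto Prod.snd (𝓝[R] p) (𝓝[Icc 0 1] p.2) :=
        tendsto_nhdsWithin_of_tendsto_nhds_of_eventually_within _
          (continuous_snd.continuousWithinAt.tendsto)
          (by filter_upwards [self_mem_nhdsWithin] with q hq using hq.2)
      exact ((hr p.1 hp.1 p.2 hp.2).continuousWithinAt.tendsto).comp h3
    have h4 : Filter.Tendsto (fun q : ℝ × ℝ => Real.exp K * (K * |q.1 - p.1|) +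
        |r (p.1, q.2) - r p|) (𝓝[R] p) (𝓝 0) := by
      have h5 : Filter.Tendsto (fun q : ℝ × ℝ => Real.exp K * (K * |q.1 - p.1|)) (𝓝[R] p)
          (𝓝 (Real.exp K * (K * |p.1 - p.1|))) :=
        (Continuous.continuousWithinAt (by fun_prop)).tendsto
      have h6 := (h2.sub_const (r p)).abs
      simpa using h5.add h6
    rw [ContinuousWithinAt, tendsto_iff_norm_sub_tendsto_zero]
    refine squeeze_zero' (Filter.Eventually.of_forall fun q => norm_nonneg _) ?_ h4
    filter_upwards [self_mem_nhdsWithin] with q hq using hb q hq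
  have hcoef : ∀ {n : ℕ}, ContDiffOn ℝ n r R → ∀ w : ℝ × ℝ × ℝ,
      ContDiffOn ℝ n (fun q => fderivWithin ℝ f (box δ) (q.2, q.1, r q) w) R := by
    intro n hn w
    have h1 : ContDiffOn ℝ n (fun q : ℝ × ℝ => (q.2, q.1, r q)) R :=
      contDiffOn_snd.prodMk (contDiffOn_fst.prodMk hn)
    exact (((hf'.of_le (by exact_mod_cast le_top)).comp h1 hbox)).clm_apply contDiffOn_const
  have hY : ∀ {n : ℕ}, ContDiffOn ℝ n r R → ContDiffOn ℝ n (paramDeriv δ f r) R := by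
    intro n hn
    have h1 := contDiffOn_primitive n (hcoef hn (0, 0, 1))
    exact h1.exp.mul (contDiffOn_primitive n (h1.neg.exp.mul (hcoef hn (0, 1, 0))))
  have hYd : ∀ ε ∈ Ioo (-ε₀) ε₀, ∀ s ∈ Icc (0 : ℝ) 1,
      HasDerivWithinAt (fun s => paramDeriv δ f r (ε, s))
        (fderivWithin ℝ f (box δ) (s, ε, r (ε, s)) (0, 1, paramDeriv δ f r (ε, s)))
        (Icc 0 1) s := by
    intro ε hε s hs
    have hr0' : ContDiffOn ℝ (0 : ℕ) r R := by simpa using hcont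
    have hsec : ∀ {k : ℝ × ℝ → ℝ}, ContinuousOn k R → ContinuousOn (fun σ => k (ε, σ)) (Icc 0 1) :=
      fun hk => hk.comp (by fun_prop) fun σ hσ => ⟨hε, hσ⟩
    have hu := hasDerivWithinAt_integral (hsec (hcoef hr0' (0, 0, 1)).continuousOn) hs
    have hv := hasDerivWithinAt_integral (hsec ((contDiffOn_primitive 0
      (hcoef hr0' (0, 0, 1))).neg.exp.mul (hcoef hr0' (0, 1, 0))).continuousOn) hs
    refine (hu.exp.mul hv).congr_deriv ?_
    have e : ((0, 1, paramDeriv δ f r (ε, s)) : ℝ × ℝ × ℝ) =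
      (0, 1, 0) + paramDeriv δ f r (ε, s) • (0, 0, 1) := by simp
    rw [e, map_add, map_smul, smul_eq_mul]
    simp only [paramDeriv, primitive, Real.exp_neg]
    field_simp
    ring
  have hYε : ∀ ε ∈ Ioo (-ε₀) ε₀, ∀ s ∈ Icc (0 : ℝ) 1,
      HasDerivAt (fun ε => r (ε, s)) (paramDeriv δ f r (ε, s)) ε := by
    intro ε hεR s hs
    set Lc := Real.exp K * K
    have hLc : 1 ≤ Lc := by
      have : 1 ≤ Real.exp K := Real.one_le_exp (by linarith)
      nlinarith
    set C₁ := max C' 1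
    -- The remainder vanishes at `s = 0` and satisfies the linearized equation up to the Taylor
    -- error of `f`, which is quadratic in `ε' - ε`; Grönwall preserves the order.
    have key : ∀ ε' ∈ Ioo (-ε₀) ε₀,
        ‖r (ε', s) - r (ε, s) - (ε' - ε) • paramDeriv δ f r (ε, s)‖ ≤
          (Real.exp C₁ * (K' * Lc ^ 2)) * ‖(ε' - ε) ^ 2‖ := by
      intro ε' hε'
      have hg := abs_le_of_abs_deriv_le (K := C₁) (c := K' * (Lc * |ε' - ε|) ^ 2)
        (f := fun s => r (ε', s) - r (ε, s) - (ε' - ε) * paramDeriv δ f r (ε, s))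
        (le_max_right _ _) (by positivity)
        (fun s hs => ((hr ε' hε' s hs).sub (hr ε hεR s hs)).sub ((hYd ε hεR s hs).const_mul _))
        (by simp [hr0 _ hεR, hr0 _ hε', paramDeriv, primitive]) (fun s hs => ?_) hs
      · rw [Real.norm_eq_abs, smul_eq_mul, Real.norm_eq_abs, abs_of_nonneg (sq_nonneg (ε' - ε)),
          ← sq_abs (ε' - ε)]
        refine hg.trans_eq ?_
        ring
      · set z : ℝ × ℝ × ℝ := (s, ε, r (ε, s)) with hz
        set z' : ℝ × ℝ × ℝ := (s, ε', r (ε', s)) with hz'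
        have hzb : z ∈ box δ := hbox (ε, s) ⟨hεR, hs⟩
        have hzb' : z' ∈ box δ := hbox (ε', s) ⟨hε', hs⟩
        set A := fderivWithin ℝ f (box δ) z
        set Δ := r (ε', s) - r (ε, s) - (ε' - ε) * paramDeriv δ f r (ε, s)
        have hzz : ‖z' - z‖ ≤ Lc * |ε' - ε| := by
          simp only [hz, hz', Prod.mk_sub_mk, sub_self, Prod.norm_def, norm_zero, Real.norm_eq_abs]
          refine max_le (by positivity) (max_le ?_ ?_)
          · exact le_mul_of_one_le_left (abs_nonneg _) hLc
          · exact (hε ε hεR ε' hε' s hs).trans_eq (by ring)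
        have hrem : ‖f z' - f z - A (z' - z)‖ ≤ K' * (Lc * |ε' - ε|) ^ 2 := by
          have hseg : segment ℝ z z' ⊆ box δ := (convex_box δ).segment_subset hzb hzb'
          have h1 := (convex_segment z z').norm_image_sub_le_of_norm_hasFDerivWithin_le'
            (f := f) (f' := fderivWithin ℝ f (box δ)) (φ := A) (C := K' * (Lc * |ε' - ε|))
            (fun x hx => ((hf.differentiableOn (by simp) x (hseg hx)).hasFDerivWithinAt).mono hseg)
            (fun x hx => ?_) (left_mem_segment _ _ _) (right_mem_segment _ _ _)
          · refine h1.trans ((mul_le_mul_of_nonneg_left hzz (by positivity)).trans_eq ?_)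
            ring
          · refine (hK' x (hseg hx) z hzb).trans ?_
            gcongr
            refine le_trans ?_ hzz
            rw [segment_eq_image'] at hx
            obtain ⟨t, ht, rfl⟩ := hx
            rw [add_sub_cancel_left, norm_smul, Real.norm_eq_abs, abs_of_nonneg ht.1]
            exact mul_le_of_le_one_left (norm_nonneg _) ht.2
        have hsplit : f z' - f z - (ε' - ε) * A (0, 1, paramDeriv δ f r (ε, s)) =
            (f z' - f z - A (z' - z)) + A (0, 0, Δ) := by
          have e : z' - z = (ε' - ε) • (0, 1, paramDeriv δ f r (ε, s)) + (0, 0, Δ) := by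
            simp [hz, hz', Δ]
          rw [e, map_add, map_smul, smul_eq_mul]
          ring
        rw [hsplit]
        have hA : |A (0, 0, Δ)| ≤ C₁ * |Δ| := by
          have h1 := A.le_opNorm (0, 0, Δ)
          have h2 : ‖((0, 0, Δ) : ℝ × ℝ × ℝ)‖ = |Δ| := by simp [Prod.norm_def]
          rw [h2] at h1
          exact h1.trans (by gcongr; exact (hC' z hzb).trans (le_max_left _ _))
        refine (abs_add_le _ _).trans ?_
        rw [add_comm]
        exact add_le_add hA hrem
    rw [hasDerivAt_iff_isLittleO]
    have hO : (fun ε' => r (ε', s) - r (ε, s) - (ε' - ε) • paramDeriv δ f r (ε, s))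
        =O[𝓝 ε] fun ε' => (ε' - ε) ^ 2 := by
      apply Asymptotics.IsBigO.of_bound
      filter_upwards [Ioo_mem_nhds hεR.1 hεR.2] with ε' hε' using key ε' hε'
    refine hO.trans_isLittleO ?_
    have h1 : (fun x : ℝ => x ^ 2) =o[𝓝 0] fun x => x := by
      simpa using Asymptotics.isLittleO_pow_pow (𝕜 := ℝ) one_lt_two
    have h2 : Filter.Tendsto (fun ε' : ℝ => ε' - ε) (𝓝 ε) (𝓝 0) := by
      have : Filter.Tendsto (fun ε' : ℝ => ε' - ε) (𝓝 ε) (𝓝 (ε - ε)) :=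
        (continuous_id.sub continuous_const).tendsto ε
      simpa using this
    exact h1.comp_tendsto h2
  refine ⟨contDiffOn_infty.2 fun n => ?_, fun ε hε s hs => ⟨hYε ε hε s hs, hYd ε hε s hs⟩⟩
  -- The `ε`-derivative is built from `r` by primitives and the `s`-derivative is `f(s, ε, r)`; both
  -- are as smooth as `r`.
  induction n with
  | zero => simpa using hcont
  | succ n ih =>
    refine contDiffOn_succ_of_partial (A := paramDeriv δ f r) (B := fun q => f (q.2, q.1, r q))
      (fun q hq => hYε _ hq.1 _ hq.2) (fun q hq => hr _ hq.1 _ hq.2) (hY ih) ?_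
    exact (hf.of_le (by exact_mod_cast le_top)).comp
      (contDiffOn_snd.prodMk (contDiffOn_fst.prodMk ih)) hbox

theorem box_mono {δ δ' : ℝ} (h : δ ≤ δ') : box δ ⊆ box δ' :=
  prod_mono subset_rfl (prod_mono (Icc_subset_Icc (neg_le_neg h) h)
    (Icc_subset_Icc (neg_le_neg h) h))

theorem mem_box_zero {δ s : ℝ} (hδ : 0 ≤ δ) (hs : s ∈ Icc (0 : ℝ) 1) : (s, 0, 0) ∈ box δ :=
  ⟨hs, ⟨by simpa, hδ⟩, ⟨by simpa, hδ⟩⟩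

/-- An eventuality that is uniform along the compact core of a box. -/
theorem eventually_box {P : ℝ × ℝ × ℝ → Prop}
    (h : ∀ s ∈ Icc (0 : ℝ) 1, ∀ᶠ x in 𝓝[box δ] (s, 0, 0), P x) (hδ : 0 < δ) :
    ∃ δ', 0 < δ' ∧ δ' ≤ δ ∧ ∀ x ∈ box δ', P x := by
  have h1 : ∀ᶠ y : ℝ × ℝ in 𝓝 (0, 0), ∀ s ∈ Icc (0 : ℝ) 1, (s, y) ∈ box δ → P (s, y) := by
    apply isCompact_Icc.eventually_forall_of_forall_eventually
    intro s hs
    have h2 : Filter.Tendsto (fun z : (ℝ × ℝ) × ℝ => ((z.2, z.1) : ℝ × ℝ × ℝ)) (𝓝 ((0, 0), s))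
        (𝓝 (s, 0, 0)) := (continuous_snd.prodMk continuous_fst).tendsto _
    exact h2.eventually (eventually_nhdsWithin_iff.1 (h s hs))
  obtain ⟨η, hη0, hη⟩ := Metric.eventually_nhds_iff.1 h1
  refine ⟨min δ (η / 2), by positivity, min_le_left _ _, fun x hx => ?_⟩
  have h3 : ∀ y ∈ Icc (-(min δ (η / 2))) (min δ (η / 2)), |y| < η := fun y hy =>
    (abs_le.2 hy).trans_lt ((min_le_right _ _).trans_lt (by linarith))
  refine hη ?_ x.1 hx.1 (box_mono (min_le_left _ _) hx)
  rw [Prod.dist_eq]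
  exact max_lt (by simpa [Real.dist_eq] using h3 _ hx.2.1)
    (by simpa [Real.dist_eq] using h3 _ hx.2.2)

/-- An implicit function theorem, uniform along a compact core and up to its boundary. -/
theorem exists_implicit (hδ : 0 < δ) {F : (ℝ × ℝ × ℝ) × ℝ → ℝ}
    (hF : ContDiffOn ℝ ∞ F (box δ ×ˢ Icc (-δ) δ))
    (h0 : ∀ s ∈ Icc (0 : ℝ) 1, F ((s, 0, 0), 0) = 0)
    (hv : ∀ s ∈ Icc (0 : ℝ) 1,
      fderivWithin ℝ F (box δ ×ˢ Icc (-δ) δ) ((s, 0, 0), 0) (0, 1) < 0) :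
    ∃ δ', 0 < δ' ∧ δ' ≤ δ ∧ ∃ f : ℝ × ℝ × ℝ → ℝ, ContDiffOn ℝ ∞ f (box δ') ∧
      (∀ s ∈ Icc (0 : ℝ) 1, f (s, 0, 0) = 0) ∧
      (∀ x ∈ box δ', f x ∈ Icc (-δ) δ ∧ F (x, f x) = 0) ∧
      ∀ s ∈ Icc (0 : ℝ) 1, ∀ w, fderivWithin ℝ F (box δ ×ˢ Icc (-δ) δ) ((s, 0, 0), 0)
        (w, fderivWithin ℝ f (box δ') (s, 0, 0) w) = 0 := by
  set B := box δ ×ˢ Icc (-δ) δ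
  have hBu : UniqueDiffOn ℝ B := (uniqueDiffOn_box hδ).prod (uniqueDiffOn_Icc (by linarith))
  set F' := fderivWithin ℝ F B
  have hF'd : ∀ z ∈ B, HasFDerivWithinAt F (F' z) B z := fun z hz =>
    (hF.differentiableOn (by simp) z hz).hasFDerivWithinAt
  have hF' : ContDiffOn ℝ ∞ F' B := hF.fderivWithin hBu (by norm_cast)
  have hFv : ContinuousOn (fun z => F' z (0, 1)) B :=
    (hF'.clm_apply contDiffOn_const).continuousOn
  -- a box on which the partial derivative is negative
  obtain ⟨δ₁, hδ₁0, hδ₁, hneg⟩ : ∃ δ₁, 0 < δ₁ ∧ δ₁ ≤ δ ∧ ∀ x ∈ box δ₁, ∀ v ∈ Icc (-δ₁) δ₁,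
      F' (x, v) (0, 1) < 0 := by
    have h1 : ∀ᶠ y : (ℝ × ℝ) × ℝ in 𝓝 ((0, 0), 0), ∀ s ∈ Icc (0 : ℝ) 1,
        (((s, y.1), y.2) : (ℝ × ℝ × ℝ) × ℝ) ∈ B → F' ((s, y.1), y.2) (0, 1) < 0 := by
      apply isCompact_Icc.eventually_forall_of_forall_eventually
      intro s hs
      have hmem : (((s, 0, 0), 0) : (ℝ × ℝ × ℝ) × ℝ) ∈ B :=
        ⟨mem_box_zero hδ.le hs, by simpa using hδ.le, hδ.le⟩
      have h3 := (hFv _ hmem).eventually (gt_mem_nhds (hv s hs))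
      have h2 : Filter.Tendsto (fun z : ((ℝ × ℝ) × ℝ) × ℝ =>
          (((z.2, z.1.1), z.1.2) : (ℝ × ℝ × ℝ) × ℝ)) (𝓝 (((0, 0), 0), s))
          (𝓝 ((s, 0, 0), 0)) := Continuous.tendsto (by fun_prop) _
      exact h2.eventually (eventually_nhdsWithin_iff.1 h3)
    obtain ⟨η, hη0, hη⟩ := Metric.eventually_nhds_iff.1 h1
    refine ⟨min δ (η / 2), by positivity, min_le_left _ _, fun x hx v hv => ?_⟩
    have h3 : ∀ y ∈ Icc (-(min δ (η / 2))) (min δ (η / 2)), |y| < η := fun y hy =>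
      (abs_le.2 hy).trans_lt ((min_le_right _ _).trans_lt (by linarith))
    refine hη (y := (x.2, v)) ?_ x.1 hx.1 ⟨box_mono (min_le_left _ _) hx,
      Icc_subset_Icc (neg_le_neg (min_le_left _ _)) (min_le_left _ _) hv⟩
    rw [Prod.dist_eq, Prod.dist_eq]
    exact max_lt (max_lt (by simpa [Real.dist_eq] using h3 _ hx.2.1)
      (by simpa [Real.dist_eq] using h3 _ hx.2.2)) (by simpa [Real.dist_eq] using h3 _ hv)
  have hB₁ : box δ₁ ×ˢ Icc (-δ₁) δ₁ ⊆ B :=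
    prod_mono (box_mono hδ₁) (Icc_subset_Icc (neg_le_neg hδ₁) hδ₁)
  have hδ₁' : -δ₁ ≤ δ₁ := by linarith
  have hsec : ∀ x ∈ box δ₁, ∀ v ∈ Icc (-δ₁) δ₁,
      HasDerivWithinAt (fun v => F (x, v)) (F' (x, v) (0, 1)) (Icc (-δ₁) δ₁) v := by
    intro x hx v hv
    have h1 : HasDerivWithinAt (fun v : ℝ => (x, v)) (0, 1) (Icc (-δ₁) δ₁) v :=
      ((hasDerivAt_const v x).prodMk (hasDerivAt_id v)).hasDerivWithinAt
    exact (hF'd _ (hB₁ ⟨hx, hv⟩)).comp_hasDerivWithinAt (f := fun v : ℝ => (x, v)) v h1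
      fun v hv => hB₁ ⟨hx, hv⟩
  have hanti : ∀ x ∈ box δ₁, StrictAntiOn (fun v => F (x, v)) (Icc (-δ₁) δ₁) := fun x hx =>
    strictAntiOn_of_hasDerivWithinAt_neg (convex_Icc _ _)
      (fun v hv => (hsec x hx v hv).continuousWithinAt)
      (fun v hv => (hsec x hx v (interior_subset hv)).mono interior_subset)
      (fun v hv => hneg x hx v (interior_subset hv))
  have hFc : ∀ v ∈ Icc (-δ₁) δ₁, ContinuousOn (fun x => F (x, v)) (box δ₁) := fun v hv =>
    hF.continuousOn.comp (by fun_prop) fun x hx => hB₁ ⟨hx, hv⟩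
  -- a smaller box on which a zero exists
  obtain ⟨δ₂, hδ₂0, hδ₂, hsign⟩ : ∃ δ₂, 0 < δ₂ ∧ δ₂ ≤ δ₁ ∧ ∀ x ∈ box δ₂,
      F (x, δ₁) < 0 ∧ 0 < F (x, -δ₁) := by
    refine eventually_box (fun s hs => ?_) hδ₁0
    have hm := mem_box_zero hδ₁0.le hs
    have hz : (0 : ℝ) ∈ Icc (-δ₁) δ₁ := ⟨by linarith, hδ₁0.le⟩
    have h1 := hanti _ hm hz (right_mem_Icc.2 hδ₁') hδ₁0
    have h2 := hanti _ hm (left_mem_Icc.2 hδ₁') hz (by linarith)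
    simp only [h0 s hs] at h1 h2
    exact ((hFc _ (right_mem_Icc.2 hδ₁') _ hm).eventually (gt_mem_nhds h1)).and
      ((hFc _ (left_mem_Icc.2 hδ₁') _ hm).eventually (lt_mem_nhds h2))
  have hzero : ∀ x ∈ box δ₂, ∃ v ∈ Ioo (-δ₁) δ₁, F (x, v) = 0 := by
    intro x hx
    have h1 : ContinuousOn (fun v => F (x, v)) (Icc (-δ₁) δ₁) := fun v hv =>
      (hsec x (box_mono hδ₂ hx) v hv).continuousWithinAt
    exact intermediate_value_Ioo' hδ₁' h1 (hsign x hx)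
  choose! f hfI hfz using hzero
  -- Since `F` decreases strictly in `v`, comparing `a` with `f x` amounts to the sign of `F (x,
  -- a)`, which is stable in `x`.
  have hfc : ContinuousOn f (box δ₂) := by
    intro x hx
    have hxf := Ioo_subset_Icc_self (hfI x hx)
    refine tendsto_order.2 ⟨fun a ha => ?_, fun a ha => ?_⟩
    · by_cases ha1 : a < -δ₁
      · filter_upwards [self_mem_nhdsWithin] with y hy using ha1.trans (hfI y hy).1
      · have haI : a ∈ Icc (-δ₁) δ₁ := ⟨not_lt.1 ha1, ha.le.trans hxf.2⟩
        have h1 : 0 < F (x, a) := by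
          have := hanti x (box_mono hδ₂ hx) haI hxf ha
          simpa [hfz x hx] using this
        filter_upwards [((hFc a haI).mono (box_mono hδ₂) x hx).eventually (lt_mem_nhds h1),
          self_mem_nhdsWithin] with y hy1 hy2
        by_contra hle
        have := (hanti y (box_mono hδ₂ hy2)).antitoneOn (Ioo_subset_Icc_self (hfI y hy2)) haI
          (not_lt.1 hle)
        simp only [hfz y hy2] at this
        linarith
    · by_cases ha1 : δ₁ < a
      · filter_upwards [self_mem_nhdsWithin] with y hy using (hfI y hy).2.trans ha1
      · have haI : a ∈ Icc (-δ₁) δ₁ := ⟨hxf.1.trans ha.le, not_lt.1 ha1⟩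
        have h1 : F (x, a) < 0 := by
          have := hanti x (box_mono hδ₂ hx) hxf haI ha
          simpa [hfz x hx] using this
        filter_upwards [((hFc a haI).mono (box_mono hδ₂) x hx).eventually (gt_mem_nhds h1),
          self_mem_nhdsWithin] with y hy1 hy2
        by_contra hle
        have := (hanti y (box_mono hδ₂ hy2)).antitoneOn haI (Ioo_subset_Icc_self (hfI y hy2))
          (not_lt.1 hle)
        simp only [hfz y hy2] at this
        linarith
  have hB₂ : box δ₂ ×ˢ Icc (-δ₁) δ₁ ⊆ B := (prod_mono (box_mono hδ₂) subset_rfl).trans hB₁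
  have hvne : ∀ x ∈ box δ₂, F' (x, f x) (0, 1) ≠ 0 := fun x hx =>
    (hneg x (box_mono hδ₂ hx) _ (Ioo_subset_Icc_self (hfI x hx))).ne
  obtain ⟨hfd, hfs⟩ := contDiffOn_implicit (uniqueDiffOn_box hδ₂0) (T := Icc (-δ₁) δ₁)
    (fun z hz => (hF'd z (hB₂ hz)).mono hB₂) (hF'.mono hB₂) hfc
    (fun x hx => Ioo_subset_Icc_self (hfI x hx)) hfz hvne
  have hf0 : ∀ s ∈ Icc (0 : ℝ) 1, f (s, 0, 0) = 0 := by
    intro s hs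
    have hm := mem_box_zero hδ₂0.le hs
    refine (hanti _ (box_mono hδ₂ hm)).injOn (Ioo_subset_Icc_self (hfI _ hm))
      ⟨by linarith, hδ₁0.le⟩ ?_
    simp only [hfz _ hm, h0 s hs]
  refine ⟨δ₂, hδ₂0, hδ₂.trans hδ₁, f, hfs, hf0, fun x hx => ⟨?_, hfz x hx⟩, fun s hs w => ?_⟩
  · exact ⟨by linarith [(hfI x hx).1], by linarith [(hfI x hx).2]⟩
  · have hm := mem_box_zero hδ₂0.le hs
    rw [(hfd _ hm).fderivWithin (uniqueDiffOn_box hδ₂0 _ hm)]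
    have hc := hvne _ hm
    rw [hf0 s hs] at hc ⊢
    set c := F' ((s, 0, 0), 0) (0, 1)
    have hsplit : ∀ t : ℝ, F' ((s, 0, 0), 0) (w, t) = F' ((s, 0, 0), 0) (w, 0) + t * c := by
      intro t
      have : ((w, t) : (ℝ × ℝ × ℝ) × ℝ) = (w, 0) + t • (0, 1) := by simp
      rw [this, map_add, map_smul, smul_eq_mul]
    rw [hsplit]
    simp
    field_simp
    ring

/-- Solutions of an implicit scalar ODE with parameter near a trivial solution: existence, smooth
dependence on the parameter, and linearization. -/
theorem exists_implicit_solution (hδ : 0 < δ) {F : (ℝ × ℝ × ℝ) × ℝ → ℝ}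
    (hF : ContDiffOn ℝ ∞ F (box δ ×ˢ Icc (-δ) δ))
    (h0 : ∀ s ∈ Icc (0 : ℝ) 1, F ((s, 0, 0), 0) = 0)
    (hv : ∀ s ∈ Icc (0 : ℝ) 1,
      fderivWithin ℝ F (box δ ×ˢ Icc (-δ) δ) ((s, 0, 0), 0) (0, 1) < 0) :
    ∃ ε₀, 0 < ε₀ ∧ ∃ r : ℝ × ℝ → ℝ, ContDiffOn ℝ ∞ r (Ioo (-ε₀) ε₀ ×ˢ Icc 0 1) ∧
      (∀ s ∈ Icc (0 : ℝ) 1, r (0, s) = 0) ∧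
      (∀ ε ∈ Ioo (-ε₀) ε₀, r (ε, 0) = 0 ∧ ∀ s ∈ Icc (0 : ℝ) 1, (s, ε, r (ε, s)) ∈ box δ ∧
        ∃ v ∈ Icc (-δ) δ, HasDerivWithinAt (fun s => r (ε, s)) v (Icc 0 1) s ∧
          F ((s, ε, r (ε, s)), v) = 0) ∧
      ∃ ρ ρ' : ℝ → ℝ, ∀ s ∈ Icc (0 : ℝ) 1, HasDerivAt (fun ε => r (ε, s)) (ρ s) 0 ∧
        HasDerivWithinAt ρ (ρ' s) (Icc 0 1) s ∧
        fderivWithin ℝ F (box δ ×ˢ Icc (-δ) δ) ((s, 0, 0), 0) ((0, 1, ρ s), ρ' s) = 0 := by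
  obtain ⟨δ', hδ'0, hδ', f, hf, hf0, hfF, hfl⟩ := exists_implicit hδ hF h0 hv
  obtain ⟨ε₀, hε₀, hε₀', r, hr0, hr⟩ := exists_solution hδ'0 hf hf0
  obtain ⟨hrs, hrd⟩ := contDiffOn_solution hδ'0 hf hε₀' (fun ε hε => (hr ε hε).1)
    (fun ε hε s hs => ((hr ε hε).2 s hs).1) (fun ε hε s hs => ((hr ε hε).2 s hs).2)
  refine ⟨ε₀, hε₀, r, hrs, hr0, fun ε hε => ⟨(hr ε hε).1, fun s hs => ?_⟩,
    fun s => paramDeriv δ' f r (0, s), fun s => fderivWithin ℝ f (box δ') (s, 0, 0)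
      (0, 1, paramDeriv δ' f r (0, s)), fun s hs => ?_⟩
  · have h1 := (hr ε hε).2 s hs
    have hm : (s, ε, r (ε, s)) ∈ box δ' :=
      ⟨hs, ⟨by linarith [hε.1], by linarith [hε.2]⟩, h1.1⟩
    exact ⟨box_mono hδ' hm, _, (hfF _ hm).1, h1.2, (hfF _ hm).2⟩
  · have h1 := hrd 0 ⟨by linarith, hε₀⟩ s hs
    rw [hr0 s hs] at h1
    exact ⟨h1.1, h1.2, hfl s hs _⟩

end ODE

/-! ### The Lagrangian in a chart. -/

section Charts

variable {E : Type*} [NormedAddCommGroup E] [NormedSpace ℝ E]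
  {M : Type*} [TopologicalSpace M] [ChartedSpace E M]

theorem pt_congr {x y : M} (h : x = y) {v w : E} (hvw : v = w) :
    (pt x v : TangentBundle 𝓘(ℝ, E) M) = pt y w := by
  subst h; subst hvw; rfl

variable [IsManifold 𝓘(ℝ, E) ∞ M] {L : TangentBundle 𝓘(ℝ, E) M → ℝ}

omit [IsManifold 𝓘(ℝ, E) ∞ M] in
theorem mdifferentiable_chart_of_mem {e : OpenPartialHomeomorph M E}
    (he : e ∈ IsManifold.maximalAtlas 𝓘(ℝ, E) ∞ M) :
    e.MDifferentiable 𝓘(ℝ, E) 𝓘(ℝ, E) :=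
  ⟨(contMDiffOn_of_mem_maximalAtlas he).mdifferentiableOn (by simp),
    (contMDiffOn_symm_of_mem_maximalAtlas he).mdifferentiableOn (by simp)⟩

/-- The differential of the inverse of a chart, read in the model space. -/
def chartDeriv (e : OpenPartialHomeomorph M E) (y : E) : E →L[ℝ] E :=
  mfderiv 𝓘(ℝ, E) 𝓘(ℝ, E) e.symm y

omit [IsManifold 𝓘(ℝ, E) ∞ M] in
theorem chartLagrangian_eq (L : TangentBundle 𝓘(ℝ, E) M → ℝ) (e : OpenPartialHomeomorph M E)
    (y u : E) : chartLagrangian L e y u = L (pt (e.symm y) (chartDeriv e y u)) := rfl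

omit [IsManifold 𝓘(ℝ, E) ∞ M] in
theorem chartDeriv_bijective {e : OpenPartialHomeomorph M E}
    (he : e ∈ IsManifold.maximalAtlas 𝓘(ℝ, E) ∞ M) {y : E} (hy : y ∈ e.target) :
    Function.Bijective (chartDeriv e y) :=
  (mdifferentiable_chart_of_mem he).symm.mfderiv_bijective hy

omit [IsManifold 𝓘(ℝ, E) ∞ M] in
theorem chartDeriv_ne_zero {e : OpenPartialHomeomorph M E}
    (he : e ∈ IsManifold.maximalAtlas 𝓘(ℝ, E) ∞ M) {y : E} (hy : y ∈ e.target) {u : E} :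
    chartDeriv e y u ≠ 0 ↔ u ≠ 0 := by
  refine ⟨fun h hu => h (by rw [hu, map_zero]), fun hu h => hu ?_⟩
  exact (chartDeriv_bijective he hy).1 (by rw [h, map_zero])

theorem isFibreLagrangian (hL : IsFinslerLagrangian L) (x : M) :
    IsFibreLagrangian (fun v : E => L (pt x v)) where
  smooth := by
    have h1 : ContMDiff 𝓘(ℝ, E) 𝓘(ℝ, E).tangent ∞
        (fun v : E => (pt x v : TangentBundle 𝓘(ℝ, E) M)) := by
      intro v
      rw [Bundle.contMDiffAt_totalSpace]
      refine ⟨contMDiffAt_const, ?_⟩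
      -- In the trivialization at `x`, the fibre coordinate over `x` is the vector itself: the
      -- coordinate change of a chart with itself is the identity.
      have : (fun z : E => (trivializationAt E (TangentSpace 𝓘(ℝ, E) (M := M)) x (pt x z)).2) =
          fun z => z := by
        funext z
        exact (tangentBundleCore 𝓘(ℝ, E) M).coordChange_self (achart E x) x
          (mem_chart_source E x) z
      exact this ▸ contMDiffAt_id
    have h2 := hL.smooth.comp (s := {0}ᶜ) h1.contMDiffOn (fun v hv => hv)
    exact h2.contDiffOn
  homogeneous := fun v hv k hk => hL.homogeneous x v hv k hk
  lorentzian := fun v hv => hL.lorentzian x v hv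

/-- It is `L` after the tangent map of `e.symm`, which is smooth and does not annihilate non-zero
vectors over `e.target`. -/
theorem contDiffOn_chartLagrangian (hL : IsFinslerLagrangian L) {e : OpenPartialHomeomorph M E}
    (he : e ∈ IsManifold.maximalAtlas 𝓘(ℝ, E) ∞ M) :
    ContDiffOn ℝ ∞ (fun q : E × E => chartLagrangian L e q.1 q.2) (e.target ×ˢ {0}ᶜ) := by
  have h1 : ContMDiff 𝓘(ℝ, E × E) 𝓘(ℝ, E).tangent ∞
      (fun q : E × E => (⟨q.1, q.2⟩ : TangentBundle 𝓘(ℝ, E) E)) := by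
    intro q
    rw [Bundle.contMDiffAt_totalSpace]
    refine ⟨contDiff_fst.contMDiff.contMDiffAt, ?_⟩
    simp only [trivializationAt_model_space_apply]
    exact contDiff_snd.contMDiff.contMDiffAt
  have h2 := (contMDiffOn_symm_of_mem_maximalAtlas he).contMDiffOn_tangentMapWithin
    (m := ∞) (by simp) e.open_target.uniqueMDiffOn
  have h3 := hL.smooth.comp (s := e.target ×ˢ {0}ᶜ) (f := fun q : E × E =>
    tangentMapWithin 𝓘(ℝ, E) 𝓘(ℝ, E) e.symm e.target ⟨q.1, q.2⟩)
    (h2.comp h1.contMDiffOn fun q hq => hq.1) ?_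
  · refine h3.contDiffOn.congr fun q hq => ?_
    rw [chartLagrangian_eq]
    simp only [Function.comp, tangentMapWithin]
    rw [mfderivWithin_of_isOpen e.open_target hq.1]
    rfl
  · intro q hq
    have h4 := (chartDeriv_ne_zero he hq.1).2 hq.2
    change (mfderivWithin 𝓘(ℝ, E) 𝓘(ℝ, E) e.symm e.target q.1 : E →L[ℝ] E) q.2 ≠ 0
    rw [mfderivWithin_of_isOpen e.open_target hq.1]
    exact h4

/-- The fibre derivative in a chart. -/
theorem fderiv_chartLagrangian_fibre (hL : IsFinslerLagrangian L) {e : OpenPartialHomeomorph M E}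
    (he : e ∈ IsManifold.maximalAtlas 𝓘(ℝ, E) ∞ M) {y u : E} (hy : y ∈ e.target) (hu : u ≠ 0)
    (w : E) : fderiv ℝ (fun u => chartLagrangian L e y u) u w =
      fderiv ℝ (fun v : E => L (pt (e.symm y) v)) (chartDeriv e y u) (chartDeriv e y w) := by
  have h1 := ((isFibreLagrangian hL (e.symm y)).differentiableAt
    ((chartDeriv_ne_zero he hy).2 hu)).hasFDerivAt.comp u (chartDeriv e y).hasFDerivAt
  have h2 : HasFDerivAt (fun u => chartLagrangian L e y u) _ u := h1
  rw [h2.fderiv]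
  rfl

theorem fderiv_chartLagrangian_ne_zero (hL : IsFinslerLagrangian L)
    {e : OpenPartialHomeomorph M E} (he : e ∈ IsManifold.maximalAtlas 𝓘(ℝ, E) ∞ M) {y u : E}
    (hy : y ∈ e.target) (hu : u ≠ 0) : fderiv ℝ (fun u => chartLagrangian L e y u) u ≠ 0 := by
  intro h
  apply (isFibreLagrangian hL (e.symm y)).fderiv_ne_zero ((chartDeriv_ne_zero he hy).2 hu)
  ext w
  obtain ⟨w, rfl⟩ := (chartDeriv_bijective he hy).2 w
  rw [← fderiv_chartLagrangian_fibre hL he hy hu, h]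
  rfl

/-- The differential of the Lagrangian in a chart splits into its partial differentials. -/
theorem hasFDerivAt_chartLagrangian (hL : IsFinslerLagrangian L)
    {e : OpenPartialHomeomorph M E} (he : e ∈ IsManifold.maximalAtlas 𝓘(ℝ, E) ∞ M) {y u : E}
    (hy : y ∈ e.target) (hu : u ≠ 0) :
    HasFDerivAt (fun q : E × E => chartLagrangian L e q.1 q.2)
      ((fderiv ℝ (fun y => chartLagrangian L e y u) y).coprod
        (fderiv ℝ (fun u => chartLagrangian L e y u) u)) (y, u) := by
  have hopen : IsOpen (e.target ×ˢ ({0}ᶜ : Set E)) := e.open_target.prod isOpen_compl_singleton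
  have h1 := (((contDiffOn_chartLagrangian hL he).contDiffAt
    (hopen.mem_nhds (show (y, u) ∈ _ from ⟨hy, hu⟩))).differentiableAt (by simp)).hasFDerivAt
  have h2 : HasFDerivAt (fun y => chartLagrangian L e y u) _ y :=
    h1.comp y (f := fun y => (y, u)) ((hasFDerivAt_id y).prodMk (hasFDerivAt_const u y))
  have h3 : HasFDerivAt (fun u => chartLagrangian L e y u) _ u :=
    h1.comp u (f := fun u => (y, u)) ((hasFDerivAt_const y u).prodMk (hasFDerivAt_id u))
  rw [h2.fderiv, h3.fderiv]
  refine h1.congr_fderiv ?_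
  ext p <;> simp

end Charts

/-! ### Pull-back of the Lagrangian along maps from a vector space. -/

section Pullback

variable {E : Type*} [NormedAddCommGroup E] [NormedSpace ℝ E]
  {M : Type*} [TopologicalSpace M] [ChartedSpace E M]
  {W : Type*} [NormedAddCommGroup W] [NormedSpace ℝ W]

/-- The differential of a map from a vector space to the manifold, read in the model space. -/
def tangentOf (Φ : W → M) (D : Set W) (z w : W) : E :=
  (mfderivWithin 𝓘(ℝ, W) 𝓘(ℝ, E) Φ D z : W →L[ℝ] E) w

/-- The pull-back of a Lagrangian along a map from a vector space. -/
def pullback (L : TangentBundle 𝓘(ℝ, E) M → ℝ) (Φ : W → M) (D : Set W) (q : W × W) : ℝ :=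
  L (pt (Φ q.1) (tangentOf (E := E) Φ D q.1 q.2))

theorem velocity_eq (c : ℝ → M) (S : Set ℝ) (s : ℝ) :
    (velocity S c s : TangentBundle 𝓘(ℝ, E) M) = pt (c s) (tangentOf (E := E) c S s 1) := rfl

variable [IsManifold 𝓘(ℝ, E) ∞ M] {L : TangentBundle 𝓘(ℝ, E) M → ℝ} {Φ : W → M} {D : Set W}
  {e : OpenPartialHomeomorph M E}

omit [IsManifold 𝓘(ℝ, E) ∞ M] in
theorem tangentOf_eq (he : e ∈ IsManifold.maximalAtlas 𝓘(ℝ, E) ∞ M) {z : W}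
    (hD : UniqueDiffWithinAt ℝ D z) (hΦ : MDifferentiableWithinAt 𝓘(ℝ, W) 𝓘(ℝ, E) Φ D z)
    (hz : Φ z ∈ e.source) (w : W) :
    (tangentOf Φ D z w : E) = chartDeriv e (e (Φ z)) (fderivWithin ℝ (e ∘ Φ) D z w) := by
  have hem := mdifferentiable_chart_of_mem he
  obtain ⟨A, B, h1, hA, hB⟩ : ∃ (A : W →L[ℝ] E) (B : E →L[ℝ] E),
      HasFDerivWithinAt (e ∘ Φ) (B.comp A) D z ∧ A w = tangentOf Φ D z w ∧
        ∀ v, chartDeriv e (e (Φ z)) (B v) = v := by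
    refine ⟨mfderivWithin 𝓘(ℝ, W) 𝓘(ℝ, E) Φ D z, mfderiv 𝓘(ℝ, E) 𝓘(ℝ, E) e (Φ z), ?_, rfl,
      fun v => ?_⟩
    · have h := (hem.mdifferentiableAt hz).hasMFDerivAt.comp_hasMFDerivWithinAt z
        hΦ.hasMFDerivWithinAt
      exact hasMFDerivWithinAt_iff_hasFDerivWithinAt.1 h
    · exact congrArg (fun A : E →L[ℝ] E => A v) (hem.symm_comp_deriv hz)
  rw [h1.fderivWithin hD, ← hA]
  exact (hB _).symm

omit [IsManifold 𝓘(ℝ, E) ∞ M] in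
theorem pt_tangentOf_eq (he : e ∈ IsManifold.maximalAtlas 𝓘(ℝ, E) ∞ M) {z : W}
    (hD : UniqueDiffWithinAt ℝ D z) (hΦ : MDifferentiableWithinAt 𝓘(ℝ, W) 𝓘(ℝ, E) Φ D z)
    (hz : Φ z ∈ e.source) (w : W) :
    (pt (Φ z) (tangentOf (E := E) Φ D z w) : TangentBundle 𝓘(ℝ, E) M) =
      pt (e.symm (e (Φ z))) (chartDeriv e (e (Φ z)) (fderivWithin ℝ (e ∘ Φ) D z w)) :=
  pt_congr (e.left_inv hz).symm (tangentOf_eq he hD hΦ hz w)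

omit [IsManifold 𝓘(ℝ, E) ∞ M] in
theorem pullback_eq (he : e ∈ IsManifold.maximalAtlas 𝓘(ℝ, E) ∞ M) {z : W}
    (hD : UniqueDiffWithinAt ℝ D z) (hΦ : MDifferentiableWithinAt 𝓘(ℝ, W) 𝓘(ℝ, E) Φ D z)
    (hz : Φ z ∈ e.source) (w : W) :
    pullback L Φ D (z, w) = chartLagrangian L e (e (Φ z)) (fderivWithin ℝ (e ∘ Φ) D z w) := by
  rw [chartLagrangian_eq, ← pt_tangentOf_eq he hD hΦ hz w]
  rfl

omit [IsManifold 𝓘(ℝ, E) ∞ M] in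
theorem tangentOf_ne_zero_iff (he : e ∈ IsManifold.maximalAtlas 𝓘(ℝ, E) ∞ M) {z : W}
    (hD : UniqueDiffWithinAt ℝ D z) (hΦ : MDifferentiableWithinAt 𝓘(ℝ, W) 𝓘(ℝ, E) Φ D z)
    (hz : Φ z ∈ e.source) (w : W) :
    (tangentOf Φ D z w : E) ≠ 0 ↔ fderivWithin ℝ (e ∘ Φ) D z w ≠ 0 := by
  rw [tangentOf_eq he hD hΦ hz, chartDeriv_ne_zero he (e.map_source hz)]

omit [IsManifold 𝓘(ℝ, E) ∞ M] in
theorem contDiffWithinAt_chart_comp (he : e ∈ IsManifold.maximalAtlas 𝓘(ℝ, E) ∞ M) {z : W}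
    (hΦ : ContMDiffWithinAt 𝓘(ℝ, W) 𝓘(ℝ, E) ∞ Φ D z) (hz : Φ z ∈ e.source) :
    ContDiffWithinAt ℝ ∞ (e ∘ Φ) D z :=
  ((contMDiffAt_of_mem_maximalAtlas he hz).comp_contMDiffWithinAt z hΦ).contDiffWithinAt

/-- In a chart at the base point, the pull-back is the chart Lagrangian evaluated on `e ∘ Φ` and its
differential, which is smooth up to the boundary of `D`. -/
theorem contDiffWithinAt_pullback (hL : IsFinslerLagrangian L) (hD : UniqueDiffOn ℝ D)
    (hΦ : ContMDiffOn 𝓘(ℝ, W) 𝓘(ℝ, E) ∞ Φ D) {q : W × W} (hq : q.1 ∈ D)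
    (hne : (tangentOf Φ D q.1 q.2 : E) ≠ 0) :
    ContDiffWithinAt ℝ ∞ (pullback L Φ D) (D ×ˢ univ) q := by
  set e := chartAt E (Φ q.1)
  have he : e ∈ IsManifold.maximalAtlas 𝓘(ℝ, E) ∞ M := IsManifold.chart_mem_maximalAtlas _
  have hs : Φ q.1 ∈ e.source := mem_chart_source E _
  have hmd : ∀ z ∈ D, MDifferentiableWithinAt 𝓘(ℝ, W) 𝓘(ℝ, E) Φ D z := fun z hz =>
    (hΦ z hz).mdifferentiableWithinAt (by simp)
  have h1 : ContDiffWithinAt ℝ ∞ (e ∘ Φ) D q.1 := contDiffWithinAt_chart_comp he (hΦ _ hq) hs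
  have h2 : ContDiffWithinAt ℝ ∞ (fderivWithin ℝ (e ∘ Φ) D) D q.1 :=
    h1.fderivWithin_right hD (by simp) hq
  have hfst : MapsTo Prod.fst (D ×ˢ (univ : Set W)) D := fun z hz => hz.1
  have h3 : ContDiffWithinAt ℝ ∞ (fun z : W × W =>
      (e (Φ z.1), fderivWithin ℝ (e ∘ Φ) D z.1 z.2)) (D ×ˢ univ) q :=
    (h1.comp q contDiffWithinAt_fst hfst).prodMk
      ((h2.comp q contDiffWithinAt_fst hfst).clm_apply contDiffWithinAt_snd)
  have hopen : IsOpen (e.target ×ˢ ({0}ᶜ : Set E)) := e.open_target.prod isOpen_compl_singleton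
  have h4 := ((contDiffOn_chartLagrangian hL he).contDiffAt (hopen.mem_nhds
    (show (e (Φ q.1), fderivWithin ℝ (e ∘ Φ) D q.1 q.2) ∈ _ from ⟨e.map_source hs,
      (tangentOf_ne_zero_iff he (hD _ hq) (hmd _ hq) hs _).1 hne⟩))).comp_contDiffWithinAt q h3
  have hev : ∀ᶠ z : W × W in 𝓝[D ×ˢ univ] q, Φ z.1 ∈ e.source := by
    have h5 : ContinuousWithinAt (fun z : W × W => Φ z.1) (D ×ˢ univ) q :=
      ((hΦ _ hq).continuousWithinAt).comp continuousWithinAt_fst hfst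
    exact h5.eventually (e.open_source.mem_nhds hs)
  refine h4.congr_of_eventuallyEq ?_ ?_
  · filter_upwards [hev, self_mem_nhdsWithin] with z hz hzD
    exact pullback_eq he (hD _ hzD.1) (hmd _ hzD.1) hz z.2
  · exact pullback_eq he (hD _ hq) (hmd _ hq) hs q.2

theorem eventually_tangentOf_ne_zero (hD : UniqueDiffOn ℝ D)
    (hΦ : ContMDiffOn 𝓘(ℝ, W) 𝓘(ℝ, E) ∞ Φ D) {q : W × W} (hq : q.1 ∈ D)
    (hne : (tangentOf Φ D q.1 q.2 : E) ≠ 0) :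
    ∀ᶠ z in 𝓝[D ×ˢ univ] q, (tangentOf Φ D z.1 z.2 : E) ≠ 0 := by
  set e := chartAt E (Φ q.1)
  have he : e ∈ IsManifold.maximalAtlas 𝓘(ℝ, E) ∞ M := IsManifold.chart_mem_maximalAtlas _
  have hs : Φ q.1 ∈ e.source := mem_chart_source E _
  have hmd : ∀ z ∈ D, MDifferentiableWithinAt 𝓘(ℝ, W) 𝓘(ℝ, E) Φ D z := fun z hz =>
    (hΦ z hz).mdifferentiableWithinAt (by simp)
  have h1 : ContDiffWithinAt ℝ ∞ (e ∘ Φ) D q.1 := contDiffWithinAt_chart_comp he (hΦ _ hq) hs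
  have h2 : ContDiffWithinAt ℝ ∞ (fderivWithin ℝ (e ∘ Φ) D) D q.1 :=
    h1.fderivWithin_right hD (by simp) hq
  have hfst : MapsTo Prod.fst (D ×ˢ (univ : Set W)) D := fun z hz => hz.1
  have h3 : ContinuousWithinAt (fun z : W × W => fderivWithin ℝ (e ∘ Φ) D z.1 z.2)
      (D ×ˢ univ) q :=
    ((h2.comp q contDiffWithinAt_fst hfst).clm_apply contDiffWithinAt_snd).continuousWithinAt
  have hev : ∀ᶠ z : W × W in 𝓝[D ×ˢ univ] q, Φ z.1 ∈ e.source := by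
    have h5 : ContinuousWithinAt (fun z : W × W => Φ z.1) (D ×ˢ univ) q :=
      ((hΦ _ hq).continuousWithinAt).comp continuousWithinAt_fst hfst
    exact h5.eventually (e.open_source.mem_nhds hs)
  have h6 := h3.eventually (isOpen_compl_singleton.mem_nhds
    ((tangentOf_ne_zero_iff he (hD _ hq) (hmd _ hq) hs _).1 hne))
  filter_upwards [hev, h6, self_mem_nhdsWithin] with z hz hz0 hzD
  exact (tangentOf_ne_zero_iff he (hD _ hzD.1) (hmd _ hzD.1) hz _).2 hz0

omit [IsManifold 𝓘(ℝ, E) ∞ M] in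
/-- The velocity of a curve inside a surface. -/
theorem velocity_comp {S : Set ℝ} {s : ℝ} (hS : UniqueDiffWithinAt ℝ S s) {ζ : ℝ → W} {ζ' : W}
    (hζ : HasDerivWithinAt ζ ζ' S s) (hmaps : MapsTo ζ S D)
    (hΦ : MDifferentiableWithinAt 𝓘(ℝ, W) 𝓘(ℝ, E) Φ D (ζ s)) :
    (velocity S (fun s => Φ (ζ s)) s : TangentBundle 𝓘(ℝ, E) M) =
      pt (Φ (ζ s)) (tangentOf (E := E) Φ D (ζ s) ζ') := by
  have h1 := hΦ.hasMFDerivWithinAt.comp s hζ.hasFDerivWithinAt.hasMFDerivWithinAt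
    hmaps
  have h2 := h1.mfderivWithin hS.uniqueMDiffWithinAt
  refine pt_congr rfl ?_
  change (mfderivWithin 𝓘(ℝ, ℝ) 𝓘(ℝ, E) (Φ ∘ ζ) S s : ℝ →L[ℝ] E) 1 = _
  rw [h2]
  change (mfderivWithin 𝓘(ℝ, W) 𝓘(ℝ, E) Φ D (ζ s) : W →L[ℝ] E)
    ((ContinuousLinearMap.toSpanSingleton ℝ ζ') 1) = _
  simp
  rfl

end Pullback

/-! ### Regularity of momentum, force and the geodesic factor. -/

section Momentum

variable {E : Type*} [NormedAddCommGroup E] [NormedSpace ℝ E]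
  {M : Type*} [TopologicalSpace M] [ChartedSpace E M] [IsManifold 𝓘(ℝ, E) ∞ M]
  {L : TangentBundle 𝓘(ℝ, E) M → ℝ} {e : OpenPartialHomeomorph M E}

theorem contDiffAt_fderiv_chartLagrangian (hL : IsFinslerLagrangian L)
    (he : e ∈ IsManifold.maximalAtlas 𝓘(ℝ, E) ∞ M) {y u : E} (hy : y ∈ e.target) (hu : u ≠ 0) :
    ContDiffAt ℝ ∞ (fderiv ℝ (fun q : E × E => chartLagrangian L e q.1 q.2)) (y, u) := by
  have hopen : IsOpen (e.target ×ˢ ({0}ᶜ : Set E)) := e.open_target.prod isOpen_compl_singleton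
  exact ((contDiffOn_chartLagrangian hL he).contDiffAt
    (hopen.mem_nhds (show (y, u) ∈ _ from ⟨hy, hu⟩))).fderiv_right (by simp)

variable {S : Set ℝ} {c : ℝ → E} {s : ℝ}

/-- Both are restrictions, by `inr` and `inl`, of the total differential of the chart Lagrangian
along `(c, ċ)`; this turns separate fibre and base derivatives into one smooth object. -/
theorem contDiffWithinAt_momentum_force (hL : IsFinslerLagrangian L)
    (he : e ∈ IsManifold.maximalAtlas 𝓘(ℝ, E) ∞ M) (hS : UniqueDiffOn ℝ S) (hs : s ∈ S)
    (hc : ContDiffWithinAt ℝ ∞ c S s) (hy : c s ∈ e.target) (hu : derivWithin c S s ≠ 0) :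
    ContDiffWithinAt ℝ ∞ (momentum L e S c) S s ∧ ContDiffWithinAt ℝ ∞ (force L e S c) S s := by
  have h1 : ContDiffWithinAt ℝ ∞ (derivWithin c S) S s :=
    (hc.fderivWithin_right (m := ∞) hS (by simp) hs).clm_apply contDiffWithinAt_const
  have h2 := (contDiffAt_fderiv_chartLagrangian hL he hy hu).comp_contDiffWithinAt s
    (hc.prodMk h1)
  have hev : ∀ᶠ t in 𝓝[S] s, c t ∈ e.target ∧ derivWithin c S t ≠ 0 :=
    (hc.continuousWithinAt.eventually (e.open_target.mem_nhds hy)).and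
      (h1.continuousWithinAt.eventually (isOpen_compl_singleton.mem_nhds hu))
  constructor
  · have h3 := h2.clm_comp (g := fun _ => _) (contDiffWithinAt_const
      (c := ContinuousLinearMap.inr ℝ E E))
    refine h3.congr_of_eventuallyEq ?_ ?_
    · filter_upwards [hev] with t ht
      simp only [Function.comp]
      rw [(hasFDerivAt_chartLagrangian hL he ht.1 ht.2).fderiv]
      simp [momentum]
    · simp only [Function.comp]
      rw [(hasFDerivAt_chartLagrangian hL he hy hu).fderiv]
      simp [momentum]
  · have h3 := h2.clm_comp (g := fun _ => _) (contDiffWithinAt_const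
      (c := ContinuousLinearMap.inl ℝ E E))
    refine h3.congr_of_eventuallyEq ?_ ?_
    · filter_upwards [hev] with t ht
      simp only [Function.comp]
      rw [(hasFDerivAt_chartLagrangian hL he ht.1 ht.2).fderiv]
      simp [force]
    · simp only [Function.comp]
      rw [(hasFDerivAt_chartLagrangian hL he hy hu).fderiv]
      simp [force]

/-- The factor in the Euler-Lagrange equation of an arbitrarily parametrized geodesic is
continuous. -/
theorem continuousWithinAt_factor (hL : IsFinslerLagrangian L)
    (he : e ∈ IsManifold.maximalAtlas 𝓘(ℝ, E) ∞ M) (hS : UniqueDiffOn ℝ S) (hs : s ∈ S)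
    (hc : ContDiffWithinAt ℝ ∞ c S s) (hy : c s ∈ e.target) (hu : derivWithin c S s ≠ 0)
    {w : ℝ → ℝ} (hw : ∀ᶠ t in 𝓝[S] s, HasDerivWithinAt (momentum L e S c)
      (force L e S c t + w t • momentum L e S c t) S t) :
    ContinuousWithinAt w S s := by
  obtain ⟨hm, hf⟩ := contDiffWithinAt_momentum_force hL he hS hs hc hy hu
  have hne : momentum L e S c s ≠ 0 := fderiv_chartLagrangian_ne_zero hL he hy hu
  -- On such a `z` the Euler-Lagrange equation can be solved for `w` as a quotient of continuous
  -- functions.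
  obtain ⟨z, hz⟩ : ∃ z, momentum L e S c s z ≠ 0 := by
    by_contra! h
    exact hne (ContinuousLinearMap.ext h)
  have h1 : ContDiffWithinAt ℝ ∞ (derivWithin (momentum L e S c) S) S s :=
    (hm.fderivWithin_right (m := ∞) hS (by simp) hs).clm_apply contDiffWithinAt_const
  have hmz : ContinuousWithinAt (fun t => momentum L e S c t z) S s :=
    hm.continuousWithinAt.clm_apply continuousWithinAt_const
  have h2 : ContinuousWithinAt (fun t => (derivWithin (momentum L e S c) S t z -
      force L e S c t z) / momentum L e S c t z) S s :=
    ((h1.continuousWithinAt.clm_apply continuousWithinAt_const).sub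
      (hf.continuousWithinAt.clm_apply continuousWithinAt_const)).div hmz hz
  have hww : ∀ t ∈ S, momentum L e S c t z ≠ 0 → HasDerivWithinAt (momentum L e S c)
      (force L e S c t + w t • momentum L e S c t) S t → w t =
      (derivWithin (momentum L e S c) S t z - force L e S c t z) / momentum L e S c t z := by
    intro t ht hz hd
    rw [hd.derivWithin (hS t ht)]
    simp
    field_simp
  refine h2.congr_of_eventuallyEq ?_ ?_
  · filter_upwards [hw, self_mem_nhdsWithin,
      hmz.eventually (isOpen_compl_singleton.mem_nhds hz)] with t h3 h4 h5
    exact hww t h4 h5 h3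
  · exact hww s hs hz (hw.self_of_nhdsWithin hs)

end Momentum

/-! ### The arrival time and the final tangent vector. -/

section Arrival

variable {E : Type*} [NormedAddCommGroup E] [NormedSpace ℝ E]
  {M : Type*} [TopologicalSpace M] [ChartedSpace E M]
  {L : TangentBundle 𝓘(ℝ, E) M → ℝ} {q : M} {I : Set ℝ} {γ lam : ℝ → M}

theorem IsTimelikeEmbedding.injOn (hγ : IsTimelikeEmbedding L I γ) : InjOn γ I := by
  intro a ha b hb hab
  have := hγ.embedding.injective (a₁ := ⟨a, ha⟩) (a₂ := ⟨b, hb⟩) hab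
  simpa using this

theorem arrivalTime_eq (hγ : IsTimelikeEmbedding L I γ) {t : ℝ} (ht : t ∈ I) (h : lam 1 = γ t) :
    arrivalTime I γ lam = t := by
  have hex : ∃ t ∈ I, γ t = lam 1 := ⟨t, ht, h.symm⟩
  exact hγ.injOn (Function.invFunOn_mem hex) ht ((Function.invFunOn_eq hex).trans h)

theorem mem_lightCone_iff {x : M} {u v : E} : pt x v ∈ lightCone L (pt x u) ↔
    v ≠ 0 ∧ v ∈ frontier
      (connectedComponentIn (IsFibreLagrangian.timelike fun v : E => L (pt x v)) u) := by
  constructor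
  · rintro ⟨v', ⟨h1, h2⟩, h3⟩
    have : v' = v := by
      injection h3 with _ h4
    subst this
    exact ⟨h1, h2⟩
  · rintro ⟨h1, h2⟩
    exact ⟨v, ⟨h1, h2⟩, rfl⟩

/-- The data of a trial curve at its arrival. -/
theorem IsTrialCurve.arrival_eq (hγ : IsTimelikeEmbedding L I γ)
    (hlam : IsTrialCurve L q I γ lam) :
    arrivalTime I γ lam ∈ I ∧ lam 1 = γ (arrivalTime I γ lam) ∧
      (tangentOf lam (Icc 0 1) 1 1 : E) ∈ frontier (connectedComponentIn
        (IsFibreLagrangian.timelike fun v : E => L (pt (lam 1) v))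
        (tangentOf γ I (arrivalTime I γ lam) 1)) := by
  obtain ⟨t, ht, h1, h2⟩ := hlam.arrival
  rw [arrivalTime_eq hγ ht h1]
  refine ⟨ht, h1, ?_⟩
  have h3 : (velocity I γ t : TangentBundle 𝓘(ℝ, E) M) =
      pt (lam 1) (tangentOf (E := E) γ I t 1) := pt_congr h1.symm rfl
  rw [h3, velocity_eq] at h2
  exact (mem_lightCone_iff.1 h2).2

end Arrival

/-! ### First variation of the Lagrangian. -/

section FirstVariation

variable {E : Type*} [NormedAddCommGroup E] [NormedSpace ℝ E]
  {M : Type*} [TopologicalSpace M] [ChartedSpace E M] [IsManifold 𝓘(ℝ, E) ∞ M]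
  {L : TangentBundle 𝓘(ℝ, E) M → ℝ} {e : OpenPartialHomeomorph M E}
  {W : Type*} [NormedAddCommGroup W] [NormedSpace ℝ W]

/-- The differential of the Lagrangian along the partial derivative of a map in the direction `b`.
-/
theorem hasFDerivWithinAt_chartLagrangian_comp (hL : IsFinslerLagrangian L)
    (he : e ∈ IsManifold.maximalAtlas 𝓘(ℝ, E) ∞ M) {D : Set W} (hD : UniqueDiffOn ℝ D)
    {Y : W → E} {z b : W} (hz : z ∈ D) (hzi : z ∈ closure (interior D))
    (hY : ContDiffWithinAt ℝ ∞ Y D z) (hy : Y z ∈ e.target) (hu : fderivWithin ℝ Y D z b ≠ 0) :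
    ∃ A : W →L[ℝ] ℝ, HasFDerivWithinAt
      (fun x => chartLagrangian L e (Y x) (fderivWithin ℝ Y D x b)) A D z ∧
      ∀ a, ∃ J : W →L[ℝ] E, HasFDerivWithinAt (fun x => fderivWithin ℝ Y D x a) J D z ∧
        A a = fderiv ℝ (fun y => chartLagrangian L e y (fderivWithin ℝ Y D z b)) (Y z)
            (fderivWithin ℝ Y D z a) +
          fderiv ℝ (fun u => chartLagrangian L e (Y z) u) (fderivWithin ℝ Y D z b) (J b) := by
  have h1 : HasFDerivWithinAt Y (fderivWithin ℝ Y D z) D z :=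
    (hY.differentiableWithinAt (by simp)).hasFDerivWithinAt
  have h2 : HasFDerivWithinAt (fderivWithin ℝ Y D) (fderivWithin ℝ (fderivWithin ℝ Y D) D z) D z :=
    ((hY.fderivWithin_right (m := ∞) hD (by simp) hz).differentiableWithinAt
      (by simp)).hasFDerivWithinAt
  -- Symmetry of the second derivative turns the `a`-derivative of the velocity into the
  -- `b`-derivative of the variational field. At boundary points it holds because they are limits of
  -- interior points.
  have hsymm : IsSymmSndFDerivWithinAt ℝ Y D z :=
    hY.isSymmSndFDerivWithinAt (by
      rw [minSmoothness_of_isRCLikeNormedField]; exact WithTop.coe_le_coe.2 le_top) hD hzi hz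
  have h3 : ∀ a, HasFDerivWithinAt (fun x => fderivWithin ℝ Y D x a)
      ((fderivWithin ℝ (fderivWithin ℝ Y D) D z).flip a) D z := by
    intro a
    refine (h2.clm_apply (hasFDerivWithinAt_const a z D)).congr_fderiv ?_
    ext v
    simp
  have h4 := (hasFDerivAt_chartLagrangian hL he hy hu).comp_hasFDerivWithinAt z
    (h1.prodMk (h3 b))
  refine ⟨_, h4, fun a => ⟨_, h3 a, ?_⟩⟩
  simp [hsymm a b]

end FirstVariation

/-! ### Differentiability of the arrival time. -/

section ArrivalTime

variable {E : Type*} [NormedAddCommGroup E] [NormedSpace ℝ E]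
  {M : Type*} [TopologicalSpace M] [ChartedSpace E M] [IsManifold 𝓘(ℝ, E) ∞ M]
  {L : TangentBundle 𝓘(ℝ, E) M → ℝ} {e : OpenPartialHomeomorph M E}
  {q : M} {I : Set ℝ} {γ lam : ℝ → M} {ε₀ : ℝ} {Lam : ℝ → ℝ → M}

/-- As `γ` is an embedding, `τ` is continuous; as `γ` is an immersion, a suitable linear coordinate
of `γ` is locally invertible, and `τ` is that inverse applied to the moving end-point. -/
theorem hasDerivAt_arrivalTime (hγ : IsTimelikeEmbedding L I γ)
    (hτ : arrivalTime I γ lam ∈ interior I)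
    (hLam : IsAllowedVariation L q I γ lam ε₀ Lam) :
    ∃ τ' : ℝ, HasDerivAt (fun ε => arrivalTime I γ (Lam ε)) τ' 0 ∧
      (tangentOf (fun z : ℝ × ℝ => Lam z.1 z.2) (Ioo (-ε₀) ε₀ ×ˢ Icc (0 : ℝ) 1) (0, 1) (1, 0) : E)
        = τ' • (tangentOf γ I (arrivalTime I γ lam) 1 : E) := by
  have hbase : Lam 0 1 = lam 1 := hLam.base 1 (by simp)
  set D := Ioo (-ε₀) ε₀ ×ˢ Icc (0 : ℝ) 1 with hDdef
  set Λ : ℝ × ℝ → M := fun z => Lam z.1 z.2 with hΛ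
  have hD : UniqueDiffOn ℝ D := uniqueDiffOn_strip
  have hpos := hLam.pos
  have h0 : (0, 1) ∈ D := ⟨⟨by simpa using hpos, hpos⟩, by simp⟩
  set τ : ℝ → ℝ := fun ε => arrivalTime I γ (Lam ε) with hτdef
  have hτ0 : arrivalTime I γ lam = τ 0 := by simp [hτdef, arrivalTime, hbase]
  rw [hτ0] at hτ ⊢
  have hnear : ∀ᶠ ε : ℝ in 𝓝 0, ε ∈ Ioo (-ε₀) ε₀ := Ioo_mem_nhds (by simpa using hpos) hpos
  have hτI : ∀ ε ∈ Ioo (-ε₀) ε₀, τ ε ∈ I ∧ Lam ε 1 = γ (τ ε) := fun ε hε =>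
    ⟨((hLam.trial ε hε).arrival_eq hγ).1, ((hLam.trial ε hε).arrival_eq hγ).2.1⟩
  have hτΛ : ∀ ε ∈ Ioo (-ε₀) ε₀, Λ (ε, 1) = γ (τ ε) := fun ε hε => (hτI ε hε).2
  have hI : I ∈ 𝓝 (τ 0) := mem_interior_iff_mem_nhds.1 hτ
  have hτ0I : τ 0 ∈ I := mem_of_mem_nhds hI
  have hγd := hγ.smooth (τ 0) hτ0I
  have hcurve : ContinuousWithinAt (fun ε : ℝ => (ε, (1 : ℝ))) (Ioo (-ε₀) ε₀) 0 := by fun_prop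
  have hmaps : MapsTo (fun ε : ℝ => (ε, (1 : ℝ))) (Ioo (-ε₀) ε₀) D := fun ε hε => ⟨hε, by simp⟩
  -- continuity of the arrival time
  have hτc : ContinuousAt τ 0 := by
    have h1 : Filter.Tendsto (fun ε : Ioo (-ε₀) ε₀ => (⟨τ ε, (hτI ε ε.2).1⟩ : I))
        (𝓝 ⟨0, h0.1⟩) (𝓝 ⟨τ 0, hτ0I⟩) := by
      rw [hγ.embedding.isInducing.tendsto_nhds_iff]
      have h2 : ContinuousWithinAt (Λ ∘ fun ε : ℝ => (ε, (1 : ℝ))) (Ioo (-ε₀) ε₀) 0 :=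
        ContinuousWithinAt.comp (t := D) (g := Λ) (x := (0 : ℝ))
          (hLam.smooth (0, 1) h0).continuousWithinAt hcurve hmaps
      have h3 := (continuousWithinAt_iff_continuousAt_domRestrict _ h0.1).1 h2
      have h4 : (Ioo (-ε₀) ε₀).domRestrict (Λ ∘ fun ε : ℝ => (ε, (1 : ℝ))) =
          (fun t : I => γ t) ∘ fun ε : Ioo (-ε₀) ε₀ => (⟨τ ε, (hτI ε ε.2).1⟩ : I) := by
        funext ε
        exact (hτI ε ε.2).2
      rw [h4] at h3
      exact h3
    have h5 : ContinuousWithinAt τ (Ioo (-ε₀) ε₀) 0 := by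
      rw [continuousWithinAt_iff_continuousAt_domRestrict _ h0.1]
      exact (continuous_subtype_val.tendsto _).comp h1
    exact h5.continuousAt hnear
  set e := chartAt E (γ (τ 0)) with hedef
  have he : e ∈ IsManifold.maximalAtlas 𝓘(ℝ, E) ∞ M := IsManifold.chart_mem_maximalAtlas _
  have hs : γ (τ 0) ∈ e.source := mem_chart_source E _
  have hs' : Λ (0, 1) ∈ e.source := by
    rw [hτΛ 0 h0.1]; exact hs
  have hIu : UniqueDiffWithinAt ℝ I (τ 0) := (uniqueDiffWithinAt_of_mem_nhds hI)
  have hc1 : ContDiffAt ℝ ∞ (e ∘ γ) (τ 0) :=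
    (contDiffWithinAt_chart_comp he hγd hs).contDiffAt hI
  set c' : E := fderivWithin ℝ (e ∘ γ) I (τ 0) 1 with hc'
  have hc'0 : c' ≠ 0 := (tangentOf_ne_zero_iff he hIu (hγd.mdifferentiableWithinAt (by simp)) hs
    1).1 (hγ.immersion (τ 0) hτ0I)
  have hc2 : HasStrictDerivAt (e ∘ γ) c' (τ 0) := by
    have := hc1.hasStrictFDerivAt (by simp)
    rw [← fderivWithin_of_mem_nhds hI] at this
    exact this.hasStrictDerivAt
  have hy : HasDerivAt (fun ε => e (Λ (ε, 1))) (fderivWithin ℝ (e ∘ Λ) D (0, 1) (1, 0)) 0 := by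
    have h1 := ((contDiffWithinAt_chart_comp he (hLam.smooth (0, 1) h0) hs').differentiableWithinAt
      (by simp)).hasFDerivWithinAt
    have h2 : HasDerivWithinAt (fun ε : ℝ => (ε, (1 : ℝ))) ((1 : ℝ), (0 : ℝ)) (Ioo (-ε₀) ε₀) 0 :=
      (hasDerivWithinAt_id _ _).prodMk (hasDerivWithinAt_const _ _ _)
    exact (h1.comp_hasDerivWithinAt 0 h2 hmaps).hasDerivAt hnear
  -- The functional `l` is normalized on the coordinate velocity of `γ`, so `l ∘ e ∘ γ` has
  -- derivative 1 at `τ 0`.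
  obtain ⟨l, hl⟩ := SeparatingDual.exists_eq_one (R := ℝ) hc'0
  have hg : HasStrictDerivAt (fun t => l (e (γ t))) 1 (τ 0) :=
    hl ▸ (l.hasStrictFDerivAt.comp_hasStrictDerivAt (τ 0) hc2)
  have hτd : HasDerivAt τ (l (fderivWithin ℝ (e ∘ Λ) D (0, 1) (1, 0))) 0 := by
    have h1 := hg.to_localInverse one_ne_zero
    have h2 : HasDerivAt (fun ε => l (e (Λ (ε, 1)))) _ 0 := l.hasFDerivAt.comp_hasDerivAt 0 hy
    have h3 : l (e (Λ (0, 1))) = l (e (γ (τ 0))) := by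
      rw [← hτΛ 0 h0.1]
    have h4 := HasDerivAt.comp (0 : ℝ) (h₂ := hg.localInverse _ _ _ one_ne_zero)
      (h := fun ε => l (e (Λ (ε, 1)))) (by rw [h3]; exact h1.hasDerivAt) h2
    rw [inv_one, one_mul] at h4
    refine h4.congr_of_eventuallyEq ?_
    filter_upwards [hτc.eventually
      ((hg.hasStrictFDerivAt_equiv one_ne_zero).eventually_left_inverse), hnear] with ε h5 h6
    simp only [Function.comp]
    rw [hτΛ ε h6]
    exact h5.symm
  refine ⟨_, hτd, ?_⟩
  -- The end-point is `γ (τ ε)`; comparing this derivative with `hy` identifies the variational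
  -- field at the arrival.
  have h5 : HasDerivAt (fun ε => e (Λ (ε, 1)))
      ((l (fderivWithin ℝ (e ∘ Λ) D (0, 1) (1, 0))) • c') 0 := by
    have h6 := HasDerivAt.scomp (0 : ℝ) hc2.hasDerivAt hτd
    refine h6.congr_of_eventuallyEq ?_
    filter_upwards [hnear] with ε hε
    simp only [Function.comp]
    rw [← hτΛ ε hε]
  rw [tangentOf_eq he (hD _ h0) ((hLam.smooth (0, 1) h0).mdifferentiableWithinAt (by simp)) hs',
    tangentOf_eq he hIu (hγd.mdifferentiableWithinAt (by simp)) hs, ← hc', hy.unique h5, map_smul,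
    ← hy.unique h5]
  change _ • chartDeriv e (e (Λ (0, 1))) c' = _
  rw [hτΛ 0 h0.1]

end ArrivalTime

/-! ### Geodesics are stationary. -/

section Geodesic

variable {E : Type*} [NormedAddCommGroup E] [NormedSpace ℝ E]
  {M : Type*} [TopologicalSpace M] [ChartedSpace E M]

theorem pt_injective {x : M} {v w : E} (h : (pt x v : TangentBundle 𝓘(ℝ, E) M) = pt x w) :
    v = w := by
  injection h

variable [IsManifold 𝓘(ℝ, E) ∞ M]
  {L : TangentBundle 𝓘(ℝ, E) M → ℝ} {e : OpenPartialHomeomorph M E}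
  {q : M} {I : Set ℝ} {γ lam : ℝ → M} {ε₀ : ℝ} {Lam : ℝ → ℝ → M}

theorem closure_interior_strip {a b : ℝ} (h : a < b) :
    Ioo a b ×ˢ Icc (0 : ℝ) 1 ⊆ closure (interior (Ioo a b ×ˢ Icc (0 : ℝ) 1)) := by
  rw [interior_prod_eq, closure_prod_eq, isOpen_Ioo.interior_eq, interior_Icc,
    closure_Ioo h.ne, closure_Ioo zero_ne_one]
  exact prod_mono_left Ioo_subset_Icc_self

/-- The pairing of the momentum of a geodesic with the variational vector field satisfies a linear
homogeneous differential equation. -/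
theorem hasDerivWithinAt_momentum_variation (hL : IsFinslerLagrangian L)
    (hLam : IsAllowedVariation L q I γ lam ε₀ Lam) {w : ℝ → ℝ} {s : ℝ} (hs : s ∈ Icc (0 : ℝ) 1)
    (hw : ∀ e ∈ IsManifold.maximalAtlas 𝓘(ℝ, E) ∞ M,
      lam s ∈ e.source → HasDerivWithinAt (momentum L e (Icc 0 1) (e ∘ lam))
        (force L e (Icc 0 1) (e ∘ lam) s + w s • momentum L e (Icc 0 1) (e ∘ lam) s)
        (Icc 0 1) s) :
    let Λ : ℝ × ℝ → M := fun z => Lam z.1 z.2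
    let D : Set (ℝ × ℝ) := Ioo (-ε₀) ε₀ ×ˢ Icc (0 : ℝ) 1
    let P : ℝ → ℝ := fun s => fderiv ℝ (fun v : E => L (pt (Λ (0, s)) v))
      (tangentOf Λ D (0, s) (0, 1)) (tangentOf Λ D (0, s) (1, 0))
    HasDerivWithinAt P (w s * P s) (Icc 0 1) s := by
  intro Λ D P
  have hpos := hLam.pos
  have hD : UniqueDiffOn ℝ D := uniqueDiffOn_strip
  have h0 : (0 : ℝ) ∈ Ioo (-ε₀) ε₀ := ⟨by simpa using hpos, hpos⟩
  have hmem : ∀ t ∈ Icc (0 : ℝ) 1, ((0 : ℝ), t) ∈ D := fun t ht => ⟨h0, ht⟩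
  have hmaps : MapsTo (fun t : ℝ => ((0 : ℝ), t)) (Icc 0 1) D := hmem
  have hline : ∀ t, HasDerivWithinAt (fun t : ℝ => ((0 : ℝ), t)) ((0 : ℝ), (1 : ℝ)) (Icc 0 1) t :=
    fun t => (hasDerivWithinAt_const _ _ _).prodMk (hasDerivWithinAt_id _ _)
  have hΛ : ContMDiffOn 𝓘(ℝ, ℝ × ℝ) 𝓘(ℝ, E) ∞ Λ D := hLam.smooth
  have hmd : ∀ z ∈ D, MDifferentiableWithinAt 𝓘(ℝ, ℝ × ℝ) 𝓘(ℝ, E) Λ D z := fun z hz =>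
    (hΛ z hz).mdifferentiableWithinAt (by simp)
  have hbase : ∀ t ∈ Icc (0 : ℝ) 1, lam t = Λ (0, t) := fun t ht => (hLam.base t ht).symm
  set e := chartAt E (Λ (0, s)) with hedef
  have he : e ∈ IsManifold.maximalAtlas 𝓘(ℝ, E) ∞ M := IsManifold.chart_mem_maximalAtlas _
  have hsrc : Λ (0, s) ∈ e.source := mem_chart_source E _
  have hYs : ∀ t ∈ Icc (0 : ℝ) 1, Λ (0, t) ∈ e.source →
      derivWithin (e ∘ lam) (Icc 0 1) t = fderivWithin ℝ (e ∘ Λ) D (0, t) (0, 1) := by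
    intro t ht h
    have h1 := ((contDiffWithinAt_chart_comp he (hΛ _ (hmem t ht)) h).differentiableWithinAt
      (by simp)).hasFDerivWithinAt
    have h2 := h1.comp_hasDerivWithinAt t (hline t) hmaps
    refine (h2.congr (fun t' ht' => ?_) ?_).derivWithin (uniqueDiffOn_Icc zero_lt_one t ht)
    · simp only [Function.comp, hbase t' ht']
    · simp only [Function.comp, hbase t ht]
  -- `P` is defined without charts, so that the equations found in different charts concern one
  -- function on `[0, 1]`.
  have hP : ∀ t ∈ Icc (0 : ℝ) 1, Λ (0, t) ∈ e.source →
      P t = momentum L e (Icc 0 1) (e ∘ lam) t (fderivWithin ℝ (e ∘ Λ) D (0, t) (1, 0)) ∧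
        fderivWithin ℝ (e ∘ Λ) D (0, t) (0, 1) ≠ 0 := by
    intro t ht h
    have hne : fderivWithin ℝ (e ∘ Λ) D (0, t) (0, 1) ≠ 0 := by
      rw [← tangentOf_ne_zero_iff he (hD _ (hmem t ht)) (hmd _ (hmem t ht)) h]
      have h3 := pt_injective (velocity_comp (uniqueDiffOn_Icc zero_lt_one t ht) (hline t) hmaps
        (hmd _ (hmem t ht)))
      rw [← h3]
      exact (hLam.trial 0 h0).regular t ht
    refine ⟨?_, hne⟩
    rw [momentum, hYs t ht h]
    simp only [Function.comp, hbase t ht]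
    have h4 := fderiv_chartLagrangian_fibre hL he (e.map_source h) hne
      (fderivWithin ℝ (e ∘ Λ) D (0, t) (1, 0))
    rw [← tangentOf_eq he (hD _ (hmem t ht)) (hmd _ (hmem t ht)) h,
      ← tangentOf_eq he (hD _ (hmem t ht)) (hmd _ (hmem t ht)) h, e.left_inv h] at h4
    exact h4.symm
  have hev : ∀ᶠ z in 𝓝[D] (0, s), Λ z ∈ e.source :=
    (hΛ _ (hmem s hs)).continuousWithinAt.eventually (e.open_source.mem_nhds hsrc)
  have hev' : ∀ᶠ t in 𝓝[Icc 0 1] s, Λ (0, t) ∈ e.source :=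
    (tendsto_nhdsWithin_iff.2 ⟨(hline s).continuousWithinAt,
      eventually_nhdsWithin_of_forall hmem⟩).eventually hev
  obtain ⟨A, hA, hA'⟩ := hasFDerivWithinAt_chartLagrangian_comp hL he hD (hmem s hs)
    (closure_interior_strip (by linarith) (hmem s hs))
    (contDiffWithinAt_chart_comp he (hΛ _ (hmem s hs)) hsrc) (e.map_source hsrc) (hP s hs hsrc).2
  -- All curves of the variation are lightlike, so the Lagrangian vanishes identically on the strip.
  have hA0 : A = 0 := by
    refine (hD _ (hmem s hs)).eq hA ?_
    refine (hasFDerivWithinAt_const (0 : ℝ) _ _).congr_of_eventuallyEq ?_ ?_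
    all_goals
      have hz : ∀ z ∈ D, Λ z ∈ e.source →
          chartLagrangian L e ((e ∘ Λ) z) (fderivWithin ℝ (e ∘ Λ) D z (0, 1)) = 0 := by
        intro z hz h
        have h1 := (hLam.trial z.1 hz.1).lightlike z.2 hz.2
        have h2 : HasDerivWithinAt (fun t : ℝ => (z.1, t)) ((0 : ℝ), (1 : ℝ)) (Icc 0 1) z.2 :=
          (hasDerivWithinAt_const _ _ _).prodMk (hasDerivWithinAt_id _ _)
        have h3 := velocity_comp (Φ := Λ) (D := D) (uniqueDiffOn_Icc zero_lt_one z.2 hz.2) h2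
          (fun t ht => ⟨hz.1, ht⟩) (hmd z hz)
        have h4 := pullback_eq (L := L) he (hD _ hz) (hmd _ hz) h (0, 1)
        have h5 : pullback L Λ D (z, (0, 1)) = L (velocity (Icc 0 1) (Lam z.1) z.2) :=
          (congrArg L h3).symm
        exact h4.symm.trans (h5.trans h1)
    · filter_upwards [hev, self_mem_nhdsWithin] with z h1 h2
      exact hz z h2 h1
    · exact hz _ (hmem s hs) hsrc
  obtain ⟨J, hJ, hJ'⟩ := hA' (1, 0)
  have hJd := hJ.comp_hasDerivWithinAt s (hline s) hmaps
  have hm := hw e he (by rw [hbase s hs]; exact hsrc)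
  -- The product rule gives `(f + w p)(ξ) + p(ξ')`, and `f(ξ) + p(ξ') = 0` by `hA0`.
  have hPd := hm.clm_apply hJd
  have h1 : P =ᶠ[𝓝[Icc 0 1] s] fun t => momentum L e (Icc 0 1) (e ∘ lam) t
      (fderivWithin ℝ (e ∘ Λ) D (0, t) (1, 0)) := by
    filter_upwards [hev', self_mem_nhdsWithin] with t ht ht'
    exact (hP t ht' ht).1
  refine (hPd.congr_of_eventuallyEq h1 (hP s hs hsrc).1).congr_deriv ?_
  rw [hA0, ← hYs s hs hsrc] at hJ'
  have h2 : force L e (Icc 0 1) (e ∘ lam) s (fderivWithin ℝ (e ∘ Λ) D (0, s) (1, 0)) +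
      momentum L e (Icc 0 1) (e ∘ lam) s (J (0, 1)) = 0 := by
    rw [force, momentum, show (e ∘ lam) s = (e ∘ Λ) (0, s) by
      simp only [Function.comp, hbase s hs]]
    exact hJ'.symm
  rw [(hP s hs hsrc).1]
  simp only [add_apply, smul_apply, smul_eq_mul,
    Function.comp] at h2 ⊢
  linarith

/-- The position of the tangent vector of `γ` relative to a trial curve that arrives. -/
theorem IsTrialCurve.arrival_timelike [FiniteDimensional ℝ E] (hL : IsFinslerLagrangian L)
    (hγ : IsTimelikeEmbedding L I γ) (hlam : IsTrialCurve L q I γ lam) :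
    let f : E → ℝ := fun v => L (pt (lam 1) v)
    let u : E := tangentOf γ I (arrivalTime I γ lam) 1
    let v : E := tangentOf lam (Icc 0 1) 1 1
    fderiv ℝ f v u < 0 ∧ ∀ σ ∈ Ioc (0 : ℝ) 1,
      v + σ • (u - v) ≠ 0 ∧ f (v + σ • (u - v)) < 0 := by
  intro f u v
  obtain ⟨hτI, harr, hfr⟩ := hlam.arrival_eq hγ
  refine ((isFibreLagrangian hL (lam 1)).of_mem_frontier (u := u) ⟨hγ.immersion _ hτI, ?_⟩
    (hlam.regular 1 (by simp)) hfr).2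
  have := hγ.timelike _ hτI
  rw [velocity_eq, ← harr] at this
  exact this

/-- The pairing `P` solves a linear homogeneous equation and vanishes at 0 because all curves start
at `q`. At 1 it is the derivative of the arrival time multiplied by the momentum on `γ̇`, which is
negative. -/
theorem deriv_arrivalTime_eq_zero [FiniteDimensional ℝ E] (hL : IsFinslerLagrangian L)
    (hγ : IsTimelikeEmbedding L I γ) (hτ : arrivalTime I γ lam ∈ interior I)
    (hgeo : IsArbParamGeodesic L (Icc 0 1) lam)
    (hLam : IsAllowedVariation L q I γ lam ε₀ Lam) :
    deriv (fun ε => arrivalTime I γ (Lam ε)) 0 = 0 := by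
  obtain ⟨w, hw⟩ := hgeo.eulerLagrange
  obtain ⟨τ', hτ', hend⟩ := hasDerivAt_arrivalTime hγ hτ hLam
  rw [hτ'.deriv]
  have hbase1 : Lam 0 1 = lam 1 := hLam.base 1 (by simp)
  have hτ0 : arrivalTime I γ lam = arrivalTime I γ (Lam 0) := by simp [arrivalTime, hbase1]
  rw [hτ0] at hend
  have hder := fun s hs => hasDerivWithinAt_momentum_variation hL hLam hs (hw s hs)
  set Λ : ℝ × ℝ → M := fun z => Lam z.1 z.2
  set D : Set (ℝ × ℝ) := Ioo (-ε₀) ε₀ ×ˢ Icc (0 : ℝ) 1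
  set P : ℝ → ℝ := fun s => fderiv ℝ (fun v : E => L (pt (Λ (0, s)) v))
      (tangentOf Λ D (0, s) (0, 1)) (tangentOf Λ D (0, s) (1, 0)) with hPdef
  have hpos := hLam.pos
  have hD : UniqueDiffOn ℝ D := uniqueDiffOn_strip
  have h0 : (0 : ℝ) ∈ Ioo (-ε₀) ε₀ := ⟨by simpa using hpos, hpos⟩
  have hmem : ∀ t ∈ Icc (0 : ℝ) 1, ((0 : ℝ), t) ∈ D := fun t ht => ⟨h0, ht⟩
  have hmd : ∀ z ∈ D, MDifferentiableWithinAt 𝓘(ℝ, ℝ × ℝ) 𝓘(ℝ, E) Λ D z := fun z hz =>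
    (hLam.smooth z hz).mdifferentiableWithinAt (by simp)
  -- The definition of a geodesic asks nothing of `w`; Grönwall needs it bounded.
  have hwc : ContinuousOn w (Icc 0 1) := by
    intro s hs
    set e := chartAt E (lam s) with hedef
    have he : e ∈ IsManifold.maximalAtlas 𝓘(ℝ, E) ∞ M := IsManifold.chart_mem_maximalAtlas _
    have hsrc : lam s ∈ e.source := mem_chart_source E _
    have hUs := uniqueDiffOn_Icc (zero_lt_one (α := ℝ))
    refine continuousWithinAt_factor hL he hUs hs
      (contDiffWithinAt_chart_comp he (hgeo.smooth s hs) hsrc) (e.map_source hsrc) ?_ ?_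
    · exact (tangentOf_ne_zero_iff he (hUs s hs)
        ((hgeo.smooth s hs).mdifferentiableWithinAt (by simp)) hsrc 1).1 (hgeo.regular s hs)
    · filter_upwards [(hgeo.smooth s hs).continuousWithinAt.eventually
        (e.open_source.mem_nhds hsrc), self_mem_nhdsWithin] with t ht ht'
      exact hw t ht' e he ht
  obtain ⟨K, hK⟩ := isCompact_Icc.exists_bound_of_continuousOn hwc
  have hP0 : P 0 = 0 := by
    have hz : (tangentOf Λ D (0, 0) (1, 0) : E) = 0 := by
      have h00 := hmem 0 (by simp)
      have h2 : HasDerivWithinAt (fun ε : ℝ => (ε, (0 : ℝ))) ((1 : ℝ), (0 : ℝ))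
          (Ioo (-ε₀) ε₀) 0 := (hasDerivWithinAt_id _ _).prodMk (hasDerivWithinAt_const _ _ _)
      have h3 := velocity_comp (Φ := Λ) (D := D) ((uniqueDiffOn_Ioo _ _) _ h0) h2
        (fun t ht => ⟨ht, by simp⟩) (hmd _ h00)
      rw [← pt_injective h3]
      have h4 : HasMFDerivWithinAt 𝓘(ℝ, ℝ) 𝓘(ℝ, E) (fun ε : ℝ => Λ (ε, 0)) (Ioo (-ε₀) ε₀) 0
          (0 : ℝ →L[ℝ] E) :=
        (hasMFDerivWithinAt_const (Λ (0, 0)) (Ioo (-ε₀) ε₀) (0 : ℝ)).congr_of_eventuallyEq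
          (eventually_nhdsWithin_of_forall fun ε hε => by
            simp only [Λ, (hLam.trial ε hε).start, (hLam.trial 0 h0).start]) rfl
      have h5 := h4.mfderivWithin ((uniqueDiffOn_Ioo _ _) _ h0).uniqueMDiffWithinAt
      exact congrArg (fun A : ℝ →L[ℝ] E => A 1) h5
    simp only [hPdef, hz, map_zero]
  have hP1 : P 1 = 0 := by
    have h1 := abs_le_of_abs_deriv_le (f := P) (f' := fun s => w s * P s) (K := max K 1) (c := 0)
      (le_max_right _ _) le_rfl hder hP0 (fun s hs => by
        rw [abs_mul, add_zero]
        exact mul_le_mul_of_nonneg_right ((hK s hs).trans (le_max_left _ _)) (abs_nonneg _))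
      (s := 1) (by simp)
    simpa using h1
  have h1I : (1 : ℝ) ∈ Icc (0 : ℝ) 1 := by simp
  have hv : (tangentOf Λ D (0, 1) (0, 1) : E) = tangentOf (Lam 0) (Icc 0 1) 1 1 := by
    have h2 : HasDerivWithinAt (fun t : ℝ => ((0 : ℝ), t)) ((0 : ℝ), (1 : ℝ)) (Icc 0 1) 1 :=
      (hasDerivWithinAt_const _ _ _).prodMk (hasDerivWithinAt_id _ _)
    exact (pt_injective (velocity_comp (Φ := Λ) (D := D) (uniqueDiffOn_Icc zero_lt_one 1 h1I) h2
      hmem (hmd _ (hmem 1 h1I)))).symm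
  have h2 := ((hLam.trial 0 h0).arrival_timelike hL hγ).1
  have h3 : P 1 = τ' * fderiv ℝ (fun v : E => L (pt (Lam 0 1) v))
      (tangentOf (Lam 0) (Icc 0 1) 1 1) (tangentOf γ I (arrivalTime I γ (Lam 0)) 1) := by
    simp only [hPdef, hv, hend, map_smul, smul_eq_mul]
    rfl
  rw [hP1] at h3
  exact (mul_eq_zero.1 h3.symm).resolve_right h2.ne

end Geodesic

/-! ### Two-parameter families of curves around a given curve. -/

section Families

variable {E : Type*} [NormedAddCommGroup E] [NormedSpace ℝ E]
  {M : Type*} [TopologicalSpace M] [ChartedSpace E M]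

theorem velocity_congr {S : Set ℝ} {s : ℝ} {c c' : ℝ → M} (h : c =ᶠ[𝓝[S] s] c')
    (hs : c s = c' s) :
    (velocity S c s : TangentBundle 𝓘(ℝ, E) M) = velocity S c' s := by
  have h1 : (mfderivWithin 𝓘(ℝ, ℝ) 𝓘(ℝ, E) c S s : ℝ →L[ℝ] E) =
      mfderivWithin 𝓘(ℝ, ℝ) 𝓘(ℝ, E) c' S s := h.mfderivWithin_eq hs
  exact pt_congr hs (congrArg (fun A : ℝ →L[ℝ] E => A 1) h1)

theorem velocity_congr_of_eqOn {S : Set ℝ} {s : ℝ} (hs : s ∈ S) {c c' : ℝ → M} (h : EqOn c c' S) :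
    (velocity S c s : TangentBundle 𝓘(ℝ, E) M) = velocity S c' s :=
  velocity_congr (eventually_nhdsWithin_of_forall h) (h hs)

theorem tangentOf_add_smul {W : Type*} [NormedAddCommGroup W] [NormedSpace ℝ W] (Φ : W → M)
    (D : Set W) (z w w' : W) (c : ℝ) :
    (tangentOf Φ D z (w + c • w') : E) = tangentOf Φ D z w + c • (tangentOf Φ D z w' : E) := by
  have h : ∀ A : W →L[ℝ] E, A (w + c • w') = A w + c • A w' := by simp
  exact h _

/-- A smooth two-parameter family of curves, with parameters `(ε, r)` in a box around the origin,
that contains the curve `lam`. -/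
structure IsFamily (E : Type*) [NormedAddCommGroup E] [NormedSpace ℝ E]
    {M : Type*} [TopologicalSpace M] [ChartedSpace E M] (lam : ℝ → M) (δ : ℝ)
    (Φ : ℝ × ℝ × ℝ → M) : Prop where
  pos : 0 < δ
  smooth : ContMDiffOn 𝓘(ℝ, ℝ × ℝ × ℝ) 𝓘(ℝ, E) ∞ Φ (box δ)
  base : ∀ s ∈ Icc (0 : ℝ) 1, Φ (s, 0, 0) = lam s

/-- The pairing of the momentum of `lam` with the derivative of a family by `r`. -/
def slope (L : TangentBundle 𝓘(ℝ, E) M → ℝ) (lam : ℝ → M) (Φ : ℝ × ℝ × ℝ → M) (s : ℝ) : ℝ :=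
  fderiv ℝ (fun v : E => L (pt (lam s) v)) (tangentOf lam (Icc 0 1) s 1)
    (tangentOf (fun r : ℝ => Φ (s, 0, r)) univ 0 1)

/-- The derivative of the Lagrangian along the curves of a family by `r`. -/
def sensitivity (L : TangentBundle 𝓘(ℝ, E) M → ℝ) (Φ : ℝ × ℝ × ℝ → M) (s : ℝ) : ℝ :=
  deriv (fun r => L (velocity (Icc 0 1) (fun t => Φ (t, 0, r)) s)) 0

variable [IsManifold 𝓘(ℝ, E) ∞ M] {L : TangentBundle 𝓘(ℝ, E) M → ℝ} {lam : ℝ → M} {δ : ℝ}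
  {Φ : ℝ × ℝ × ℝ → M}

namespace IsFamily

omit [IsManifold 𝓘(ℝ, E) ∞ M] in
theorem mdifferentiable (hΦ : IsFamily E lam δ Φ) {z : ℝ × ℝ × ℝ} (hz : z ∈ box δ) :
    MDifferentiableWithinAt 𝓘(ℝ, ℝ × ℝ × ℝ) 𝓘(ℝ, E) Φ (box δ) z :=
  (hΦ.smooth z hz).mdifferentiableWithinAt (by simp)

omit [IsManifold 𝓘(ℝ, E) ∞ M] in
theorem mem (hΦ : IsFamily E lam δ Φ) {s : ℝ} (hs : s ∈ Icc (0 : ℝ) 1) : (s, 0, 0) ∈ box δ :=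
  mem_box_zero hΦ.pos.le hs

omit [IsManifold 𝓘(ℝ, E) ∞ M] in
/-- The velocity of a curve of the family. -/
theorem velocity_curve (hΦ : IsFamily E lam δ Φ) {s ε r : ℝ} (hz : (s, ε, r) ∈ box δ) :
    (velocity (Icc 0 1) (fun t => Φ (t, ε, r)) s : TangentBundle 𝓘(ℝ, E) M) =
      pt (Φ (s, ε, r)) (tangentOf (E := E) Φ (box δ) (s, ε, r) (1, 0, 0)) :=
  velocity_comp (ζ := fun t => (t, ε, r)) (uniqueDiffOn_Icc zero_lt_one s hz.1)
    ((hasDerivWithinAt_id _ _).prodMk (hasDerivWithinAt_const _ _ _))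
    (fun _ ht => ⟨ht, hz.2⟩) (hΦ.mdifferentiable hz)

omit [IsManifold 𝓘(ℝ, E) ∞ M] in
theorem tangentOf_base (hΦ : IsFamily E lam δ Φ) {s : ℝ} (hs : s ∈ Icc (0 : ℝ) 1) :
    (tangentOf Φ (box δ) (s, 0, 0) (1, 0, 0) : E) = tangentOf lam (Icc 0 1) s 1 := by
  have h1 := hΦ.velocity_curve (hΦ.mem hs)
  rw [velocity_congr_of_eqOn hs fun t ht => hΦ.base t ht, hΦ.base s hs] at h1
  exact (pt_injective h1).symm

omit [IsManifold 𝓘(ℝ, E) ∞ M] in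
theorem tangentOf_transversal (hΦ : IsFamily E lam δ Φ) {s : ℝ} (hs : s ∈ Icc (0 : ℝ) 1) :
    (tangentOf Φ (box δ) (s, 0, 0) (0, 0, 1) : E) =
      tangentOf (fun r : ℝ => Φ (s, 0, r)) univ 0 1 := by
  have hpos := hΦ.pos
  have h0 : (0 : ℝ) ∈ Icc (-δ) δ := ⟨by linarith, hpos.le⟩
  have h1 := velocity_comp (Φ := Φ) (D := box δ) (S := Icc (-δ) δ) (s := 0)
    (ζ := fun r => (s, 0, r)) (ζ' := (0, 0, 1)) (uniqueDiffOn_Icc (by linarith) 0 h0)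
    ((hasDerivWithinAt_const _ _ _).prodMk
      ((hasDerivWithinAt_const _ _ _).prodMk (hasDerivWithinAt_id _ _)))
    (fun _ ht => ⟨hs, h0, ht⟩) (hΦ.mdifferentiable (hΦ.mem hs))
  rw [← pt_injective h1]
  have h2 : mfderivWithin 𝓘(ℝ, ℝ) 𝓘(ℝ, E) (fun r : ℝ => Φ (s, 0, r)) (Icc (-δ) δ) 0 =
      mfderivWithin 𝓘(ℝ, ℝ) 𝓘(ℝ, E) (fun r : ℝ => Φ (s, 0, r)) univ 0 := by
    rw [mfderivWithin_univ]
    exact mfderivWithin_of_mem_nhds (Icc_mem_nhds (by linarith) hpos)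
  exact congrArg (fun A : ℝ →L[ℝ] E => A 1) h2

/-- Near `lam`, the curves of a family that solve a differential equation `r' = v` are regular. -/
theorem exists_regular (hΦ : IsFamily E lam δ Φ)
    (hreg : ∀ s ∈ Icc (0 : ℝ) 1, (tangentOf lam (Icc 0 1) s 1 : E) ≠ 0) :
    ∃ δ₁, 0 < δ₁ ∧ δ₁ ≤ δ ∧ ∀ z ∈ box δ₁, ∀ v ∈ Icc (-δ₁) δ₁,
      (tangentOf Φ (box δ) z (1, 0, v) : E) ≠ 0 := by
  have h1 : ∀ᶠ y : (ℝ × ℝ) × ℝ in 𝓝 0, ∀ s ∈ Icc (0 : ℝ) 1, (s, y.1) ∈ box δ →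
      (tangentOf Φ (box δ) (s, y.1) (1, 0, y.2) : E) ≠ 0 := by
    apply isCompact_Icc.eventually_forall_of_forall_eventually
    intro s hs
    have h2 := eventually_tangentOf_ne_zero (uniqueDiffOn_box hΦ.pos) hΦ.smooth
      (q := ((s, 0, 0), (1, 0, 0))) (hΦ.mem hs) (by
        rw [hΦ.tangentOf_base hs]; exact hreg s hs)
    have h3 : Continuous (fun y : ((ℝ × ℝ) × ℝ) × ℝ =>
        (((y.2, y.1.1), (1, 0, y.1.2)) : (ℝ × ℝ × ℝ) × (ℝ × ℝ × ℝ))) := by fun_prop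
    have h4 := (h3.tendsto (0, s)).eventually (eventually_nhdsWithin_iff.1 h2)
    filter_upwards [h4] with y hy hy'
    exact hy ⟨hy', mem_univ _⟩
  obtain ⟨η, hη0, hη⟩ := Metric.eventually_nhds_iff.1 h1
  have hpos := hΦ.pos
  refine ⟨min δ (η / 2), by positivity, min_le_left _ _, fun z hz v hv => ?_⟩
  have h3 : ∀ y ∈ Icc (-(min δ (η / 2))) (min δ (η / 2)), |y| < η := fun y hy =>
    (abs_le.2 hy).trans_lt ((min_le_right _ _).trans_lt (by linarith))
  refine hη (y := (z.2, v)) ?_ z.1 hz.1 (box_mono (min_le_left _ _) hz)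
  rw [dist_zero_right, Prod.norm_def, Prod.norm_def]
  exact max_lt (max_lt (h3 _ hz.2.1) (h3 _ hz.2.2)) (h3 _ hv)

theorem contDiffOn_pullback (hL : IsFinslerLagrangian L) (hΦ : IsFamily E lam δ Φ) {δ₁ : ℝ}
    (hδ₁ : δ₁ ≤ δ) (hreg : ∀ z ∈ box δ₁, ∀ v ∈ Icc (-δ₁) δ₁,
      (tangentOf Φ (box δ) z (1, 0, v) : E) ≠ 0) :
    ContDiffOn ℝ ∞ (fun y : (ℝ × ℝ × ℝ) × ℝ => pullback L Φ (box δ) (y.1, (1, 0, y.2)))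
      (box δ₁ ×ˢ Icc (-δ₁) δ₁) := by
  intro y hy
  have h1 := contDiffWithinAt_pullback hL (uniqueDiffOn_box hΦ.pos) hΦ.smooth
    (q := (y.1, (1, 0, y.2))) (box_mono hδ₁ hy.1) (hreg _ hy.1 _ hy.2)
  have h2 : ContDiff ℝ ∞ (fun y : (ℝ × ℝ × ℝ) × ℝ =>
      ((y.1, (1, 0, y.2)) : (ℝ × ℝ × ℝ) × (ℝ × ℝ × ℝ))) := by fun_prop
  exact ContDiffWithinAt.comp (g := pullback L Φ (box δ)) y h1 h2.contDiffWithinAt fun x hx => ⟨box_mono hδ₁ hx.1, mem_univ _⟩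

variable {δ₁ : ℝ}

/-- The partial derivatives of the Lagrangian along a family. -/
theorem fderivWithin_pullback (hL : IsFinslerLagrangian L) (hΦ : IsFamily E lam δ Φ)
    (h0 : 0 < δ₁) (hδ₁ : δ₁ ≤ δ) (hreg : ∀ z ∈ box δ₁, ∀ v ∈ Icc (-δ₁) δ₁,
      (tangentOf Φ (box δ) z (1, 0, v) : E) ≠ 0) {s : ℝ} (hs : s ∈ Icc (0 : ℝ) 1) :
    let A := fderivWithin ℝ (fun y : (ℝ × ℝ × ℝ) × ℝ => pullback L Φ (box δ) (y.1, (1, 0, y.2)))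
      (box δ₁ ×ˢ Icc (-δ₁) δ₁) ((s, 0, 0), 0)
    A (0, 1) = slope L lam Φ s ∧ A ((0, 0, 1), 0) = sensitivity L Φ s ∧
      HasDerivAt (fun ε => L (velocity (Icc 0 1) (fun t => Φ (t, ε, 0)) s))
        (A ((0, 1, 0), 0)) 0 := by
  intro A
  have hI : (0 : ℝ) ∈ Icc (-δ₁) δ₁ := ⟨by linarith, h0.le⟩
  have hn : Icc (-δ₁) δ₁ ∈ 𝓝 (0 : ℝ) := Icc_mem_nhds (by linarith) h0
  have hmem : ((s, 0, 0), 0) ∈ box δ₁ ×ˢ Icc (-δ₁) δ₁ := ⟨mem_box_zero h0.le hs, hI⟩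
  have hA : HasFDerivWithinAt _ A _ _ :=
    ((hΦ.contDiffOn_pullback hL hδ₁ hreg).differentiableOn (by simp) _ hmem).hasFDerivWithinAt
  have hcurve : ∀ (ζ : ℝ → (ℝ × ℝ × ℝ) × ℝ) (ζ' : (ℝ × ℝ × ℝ) × ℝ),
      HasDerivWithinAt ζ ζ' (Icc (-δ₁) δ₁) 0 → ζ 0 = ((s, 0, 0), 0) →
      MapsTo ζ (Icc (-δ₁) δ₁) (box δ₁ ×ˢ Icc (-δ₁) δ₁) →
      HasDerivAt (fun x => pullback L Φ (box δ) ((ζ x).1, (1, 0, (ζ x).2))) (A ζ') 0 := by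
    intro ζ ζ' hζ h00 hm
    rw [← h00] at hA
    exact (hA.comp_hasDerivWithinAt (0 : ℝ) hζ hm).hasDerivAt hn
  refine ⟨?_, ?_, ?_⟩
  · have h1 := hcurve (fun v => ((s, 0, 0), v)) (0, 1)
      ((hasDerivWithinAt_const _ _ _).prodMk (hasDerivWithinAt_id _ _)) rfl
      (fun v hv => ⟨hmem.1, hv⟩)
    -- A delay with `r' = v` adds `v ∂Φ/∂r` to the velocity, so the derivative of the Lagrangian in
    -- `v` is the momentum on `∂Φ/∂r`.
    have h2 : ∀ v : ℝ, (tangentOf Φ (box δ) (s, 0, 0) (1, 0, v) : E) =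
        tangentOf lam (Icc 0 1) s 1 +
          v • tangentOf (fun r : ℝ => Φ (s, 0, r)) univ 0 1 := by
      intro v
      rw [← hΦ.tangentOf_base hs, ← hΦ.tangentOf_transversal hs]
      rw [← tangentOf_add_smul]
      simp
    have hne : (tangentOf lam (Icc 0 1) s 1 : E) ≠ 0 := by
      have := hreg _ hmem.1 0 hI
      rwa [hΦ.tangentOf_base hs] at this
    have h3 := ((isFibreLagrangian hL (lam s)).differentiableAt hne).hasFDerivAt
    have h4 : HasDerivAt (fun v : ℝ => (tangentOf lam (Icc 0 1) s 1 : E) +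
          v • (tangentOf (fun r : ℝ => Φ (s, 0, r)) univ 0 1 : E))
        (tangentOf (fun r : ℝ => Φ (s, 0, r)) univ 0 1 : E) 0 := by
      simpa using ((hasDerivAt_id (0 : ℝ)).smul_const
        (tangentOf (fun r : ℝ => Φ (s, 0, r)) univ 0 1 : E)).const_add
        (tangentOf lam (Icc 0 1) s 1 : E)
    have h5 := HasFDerivAt.comp_hasDerivAt (0 : ℝ) (by simpa using h3) h4
    refine h1.unique ?_
    refine h5.congr_of_eventuallyEq (Filter.Eventually.of_forall fun v => ?_)
    exact congrArg L (pt_congr (hΦ.base s hs) (h2 v))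
  · have h1 := hcurve (fun r => ((s, 0, r), 0)) ((0, 0, 1), 0)
      (((hasDerivWithinAt_const _ _ _).prodMk ((hasDerivWithinAt_const _ _ _).prodMk
        (hasDerivWithinAt_id _ _))).prodMk (hasDerivWithinAt_const _ _ _)) rfl
      (fun v hv => ⟨⟨hs, hI, hv⟩, hI⟩)
    refine (HasDerivAt.deriv ?_).symm
    refine h1.congr_of_eventuallyEq ?_
    filter_upwards [hn] with r hr
    exact congrArg L (hΦ.velocity_curve (box_mono hδ₁ ⟨hs, hI, hr⟩))
  · have h1 := hcurve (fun r => ((s, r, 0), 0)) ((0, 1, 0), 0)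
      (((hasDerivWithinAt_const _ _ _).prodMk ((hasDerivWithinAt_id _ _).prodMk
        (hasDerivWithinAt_const _ _ _))).prodMk (hasDerivWithinAt_const _ _ _)) rfl
      (fun v hv => ⟨⟨hs, hv, hI⟩, hI⟩)
    refine h1.congr_of_eventuallyEq ?_
    filter_upwards [hn] with r hr
    exact congrArg L (hΦ.velocity_curve (box_mono hδ₁ ⟨hs, hr, hI⟩))

/-- Both are components of the differential of one smooth function on a box, evaluated along its
core. -/
theorem contDiffOn_slope_sensitivity (hL : IsFinslerLagrangian L) (hΦ : IsFamily E lam δ Φ)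
    (hreg : ∀ s ∈ Icc (0 : ℝ) 1, (tangentOf lam (Icc 0 1) s 1 : E) ≠ 0) :
    ContDiffOn ℝ ∞ (slope L lam Φ) (Icc 0 1) ∧ ContDiffOn ℝ ∞ (sensitivity L Φ) (Icc 0 1) := by
  obtain ⟨δ₁, h0, hδ₁, hr⟩ := hΦ.exists_regular hreg
  have hI : (0 : ℝ) ∈ Icc (-δ₁) δ₁ := ⟨by linarith, h0.le⟩
  have hU : UniqueDiffOn ℝ (box δ₁ ×ˢ Icc (-δ₁) δ₁) :=
    (uniqueDiffOn_box h0).prod (uniqueDiffOn_Icc (by linarith))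
  have h1 := (hΦ.contDiffOn_pullback hL hδ₁ hr).fderivWithin hU (m := ∞) (by simp)
  have h2 : ContDiff ℝ ∞ (fun s : ℝ => (((s, 0, 0), 0) : (ℝ × ℝ × ℝ) × ℝ)) := by fun_prop
  have h3 := h1.comp (s := Icc 0 1) h2.contDiffOn (fun s hs => ⟨mem_box_zero h0.le hs, hI⟩)
  constructor
  · exact (h3.clm_apply (contDiffOn_const (c := (0, 1)))).congr fun s hs =>
      ((hΦ.fderivWithin_pullback hL h0 hδ₁ hr hs).1).symm
  · exact (h3.clm_apply (contDiffOn_const (c := ((0, 0, 1), 0)))).congr fun s hs =>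
      ((hΦ.fderivWithin_pullback hL h0 hδ₁ hr hs).2.1).symm

end IsFamily

end Families

/-! ### Perturbing a family by a bump in a chart. -/

section Perturbation

variable {E : Type*} [NormedAddCommGroup E] [NormedSpace ℝ E]
  {M : Type*} [TopologicalSpace M] [ChartedSpace E M]

open Classical in
/-- The perturbation of a family by `ρ • B` in a chart that covers the support of `ρ`. -/
def perturb (e : OpenPartialHomeomorph M E) (ρ : ℝ → ℝ) (B : ℝ × ℝ → E) (Φ : ℝ × ℝ × ℝ → M)
    (z : ℝ × ℝ × ℝ) : M :=
  if z.1 ∈ tsupport ρ then e.symm (e (Φ z) + ρ z.1 • B z.2) else Φ z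

variable {L : TangentBundle 𝓘(ℝ, E) M → ℝ} {lam : ℝ → M} {δ : ℝ} {Φ : ℝ × ℝ × ℝ → M}
  {e : OpenPartialHomeomorph M E} {ρ : ℝ → ℝ} {B : ℝ × ℝ → E} {V : Set (ℝ × ℝ)}

omit [ChartedSpace E M] in
theorem perturb_of_notMem {z : ℝ × ℝ × ℝ} (hz : z.1 ∉ tsupport ρ) : perturb e ρ B Φ z = Φ z :=
  if_neg hz

omit [ChartedSpace E M] in
theorem perturb_of_mem_source {z : ℝ × ℝ × ℝ} (hz : Φ z ∈ e.source) :
    perturb e ρ B Φ z = e.symm (e (Φ z) + ρ z.1 • B z.2) := by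
  by_cases h : z.1 ∈ tsupport ρ
  · exact if_pos h
  · rw [perturb_of_notMem h, image_eq_zero_of_notMem_tsupport h, zero_smul, add_zero,
      e.left_inv hz]

omit [ChartedSpace E M] in
theorem perturb_of_eq_zero {z : ℝ × ℝ × ℝ} (hz : z.1 ∈ tsupport ρ → Φ z ∈ e.source)
    (h : ρ z.1 • B z.2 = 0) : perturb e ρ B Φ z = Φ z := by
  by_cases h' : z.1 ∈ tsupport ρ
  · rw [perturb_of_mem_source (hz h'), h, add_zero, e.left_inv (hz h')]
  · exact perturb_of_notMem h'

/-- Along the core the perturbation is zero, so by compactness a small box keeps everything inside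
the chart where `ρ` is supported. Smoothness follows from the chart expression on the closed support
and from `Φ` off it. -/
theorem IsFamily.exists_perturb [IsManifold 𝓘(ℝ, E) ∞ M] (hΦ : IsFamily E lam δ Φ)
    (he : e ∈ IsManifold.maximalAtlas 𝓘(ℝ, E) ∞ M) (hρ : ContDiff ℝ ∞ ρ) (hV : IsOpen V)
    (h0V : 0 ∈ V) (hB : ContDiffOn ℝ ∞ B V) (hB0 : B 0 = 0)
    (hsrc : ∀ s ∈ Icc (0 : ℝ) 1, s ∈ tsupport ρ → lam s ∈ e.source) :
    ∃ δ', 0 < δ' ∧ δ' ≤ δ ∧ IsFamily E lam δ' (perturb e ρ B Φ) ∧ ∀ z ∈ box δ', z.2 ∈ V ∧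
      (z.1 ∈ tsupport ρ → Φ z ∈ e.source ∧ e (Φ z) + ρ z.1 • B z.2 ∈ e.target) := by
  have h1 : ∀ s ∈ Icc (0 : ℝ) 1, ∀ᶠ z in 𝓝[box δ] (s, 0, 0), z.2 ∈ V ∧
      (z.1 ∈ tsupport ρ → Φ z ∈ e.source ∧ e (Φ z) + ρ z.1 • B z.2 ∈ e.target) := by
    intro s hs
    have hz := hΦ.mem hs
    have h2 : ∀ᶠ z : ℝ × ℝ × ℝ in 𝓝[box δ] (s, 0, 0), z.2 ∈ V :=
      nhdsWithin_le_nhds ((continuous_snd.tendsto _).eventually (hV.mem_nhds h0V))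
    refine h2.and ?_
    by_cases h : s ∈ tsupport ρ
    · have hs' : Φ (s, 0, 0) ∈ e.source := by rw [hΦ.base s hs]; exact hsrc s hs h
      have h3 := (contDiffWithinAt_chart_comp he (hΦ.smooth _ hz) hs').continuousWithinAt
      have h4 : ContinuousWithinAt (fun z : ℝ × ℝ × ℝ => ρ z.1 • B z.2) (box δ) (s, 0, 0) := by
        refine ContinuousAt.continuousWithinAt ?_
        refine (hρ.continuous.comp continuous_fst).continuousAt.smul ?_
        exact ContinuousAt.comp (g := B) (x := ((s, 0, 0) : ℝ × ℝ × ℝ))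
          (hB.continuousOn.continuousAt (hV.mem_nhds h0V)) continuous_snd.continuousAt
      have h5 : (e ∘ Φ) (s, 0, 0) + ρ s • B (0, 0) ∈ e.target := by
        rw [← Prod.zero_eq_mk, hB0, smul_zero, add_zero]
        exact e.map_source hs'
      filter_upwards [(h3.add h4).eventually (e.open_target.mem_nhds h5),
        (hΦ.smooth _ hz).continuousWithinAt.eventually (e.open_source.mem_nhds hs')] with z h6 h7 _
      exact ⟨h7, h6⟩
    · have h3 : ∀ᶠ z : ℝ × ℝ × ℝ in 𝓝[box δ] (s, 0, 0), z.1 ∉ tsupport ρ :=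
        nhdsWithin_le_nhds ((continuous_fst.tendsto _).eventually
          ((isClosed_tsupport ρ).isOpen_compl.mem_nhds (show s ∈ (tsupport ρ)ᶜ from h)))
      filter_upwards [h3] with z hz hz'
      exact absurd hz' hz
  obtain ⟨δ', h0, hle, h⟩ := eventually_box h1 hΦ.pos
  refine ⟨δ', h0, hle, ⟨h0, ?_, ?_⟩, h⟩
  · intro z hz
    by_cases hzs : z.1 ∈ tsupport ρ
    · obtain ⟨h2, h3⟩ := (h z hz).2 hzs
      have hΦz := (hΦ.smooth z (box_mono hle hz)).mono (box_mono hle)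
      have h4 : ContDiffWithinAt ℝ ∞ (fun z : ℝ × ℝ × ℝ => (e ∘ Φ) z + ρ z.1 • B z.2)
          (box δ') z := by
        refine (contDiffWithinAt_chart_comp he hΦz h2).add ?_
        refine ((hρ.comp contDiff_fst).contDiffWithinAt).smul ?_
        exact ContDiffAt.comp_contDiffWithinAt (g := B) z
          (hB.contDiffAt (hV.mem_nhds (h z hz).1)) contDiffWithinAt_snd
      have h5 := ((contMDiffOn_symm_of_mem_maximalAtlas he).contMDiffAt
        (e.open_target.mem_nhds h3)).comp_contMDiffWithinAt z h4.contMDiffWithinAt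
      refine h5.congr_of_eventuallyEq ?_ (perturb_of_mem_source h2)
      filter_upwards [hΦz.continuousWithinAt.eventually (e.open_source.mem_nhds h2)] with y hy
      exact perturb_of_mem_source hy
    · refine ((hΦ.smooth z (box_mono hle hz)).mono (box_mono hle)).congr_of_eventuallyEq ?_
        (perturb_of_notMem hzs)
      filter_upwards [nhdsWithin_le_nhds ((continuous_fst.tendsto z).eventually
        ((isClosed_tsupport ρ).isOpen_compl.mem_nhds hzs))] with y hy
      exact perturb_of_notMem hy
  · intro s hs
    rw [perturb_of_eq_zero (fun h' => ((h _ (mem_box_zero h0.le hs)).2 h').1), hΦ.base s hs]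
    change ρ s • B 0 = 0
    rw [hB0, smul_zero]

variable [IsManifold 𝓘(ℝ, E) ∞ M]

/-- In a chart the slope is visibly linear in the coordinate derivative `∂(e ∘ Φ)/∂r`, which a
perturbation changes by a known amount. -/
theorem slope_eq (hL : IsFinslerLagrangian L) (hΦ : IsFamily E lam δ Φ)
    (he : e ∈ IsManifold.maximalAtlas 𝓘(ℝ, E) ∞ M)
    (hlam : ContMDiffOn 𝓘(ℝ, ℝ) 𝓘(ℝ, E) ∞ lam (Icc 0 1))
    (hreg : ∀ s ∈ Icc (0 : ℝ) 1, (tangentOf lam (Icc 0 1) s 1 : E) ≠ 0) {s : ℝ}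
    (hs : s ∈ Icc (0 : ℝ) 1) (hsrc : lam s ∈ e.source) :
    ∃ U, HasDerivAt (fun r => e (Φ (s, 0, r))) U 0 ∧
      slope L lam Φ s = momentum L e (Icc 0 1) (e ∘ lam) s U := by
  have hpos := hΦ.pos
  have h0 : (0 : ℝ) ∈ Icc (-δ) δ := ⟨by linarith, hpos.le⟩
  have hsrc' : Φ (s, 0, 0) ∈ e.source := by rw [hΦ.base s hs]; exact hsrc
  have hd : ContMDiffWithinAt 𝓘(ℝ, ℝ) 𝓘(ℝ, E) ∞ (fun r : ℝ => Φ (s, 0, r)) univ 0 := by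
    have h1 : ContMDiffWithinAt 𝓘(ℝ, ℝ) 𝓘(ℝ, ℝ × ℝ × ℝ) ∞
        (fun r : ℝ => ((s, 0, r) : ℝ × ℝ × ℝ)) (Icc (-δ) δ) 0 := by
      apply ContDiffWithinAt.contMDiffWithinAt
      fun_prop
    have h2 : ContMDiffWithinAt 𝓘(ℝ, ℝ) 𝓘(ℝ, E) ∞ (Φ ∘ fun r : ℝ => ((s, 0, r) : ℝ × ℝ × ℝ))
        (Icc (-δ) δ) 0 := ContMDiffWithinAt.comp (g := Φ) (t := box δ) 0
        (hΦ.smooth (s, 0, 0) (hΦ.mem hs)) h1 (fun r hr => ⟨hs, h0, hr⟩)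
    exact (h2.contMDiffAt (Icc_mem_nhds (by linarith) hpos)).contMDiffWithinAt
  have h3 := (contDiffWithinAt_chart_comp he hd hsrc')
  rw [contDiffWithinAt_univ] at h3
  have h4 := (h3.differentiableAt (by simp)).hasDerivAt
  refine ⟨_, h4, ?_⟩
  have hU := uniqueDiffOn_Icc (zero_lt_one (α := ℝ)) s hs
  have hmd := (hlam s hs).mdifferentiableWithinAt (by simp)
  have hne := (tangentOf_ne_zero_iff he hU hmd hsrc 1).1 (hreg s hs)
  have h5 := fderiv_chartLagrangian_fibre hL he (e.map_source hsrc) hne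
    (deriv (e ∘ fun r : ℝ => Φ (s, 0, r)) 0)
  rw [← tangentOf_eq he hU hmd hsrc, e.left_inv hsrc] at h5
  have h6 : (tangentOf (fun r : ℝ => Φ (s, 0, r)) univ 0 1 : E) =
      chartDeriv e (e (lam s)) (deriv (e ∘ fun r : ℝ => Φ (s, 0, r)) 0) := by
    rw [tangentOf_eq he uniqueDiffWithinAt_univ (hd.mdifferentiableWithinAt (by simp)) hsrc',
      fderivWithin_univ, hΦ.base s hs]
    rfl
  rw [slope, h6]
  exact h5.symm

theorem slope_perturb (hL : IsFinslerLagrangian L) (hΦ : IsFamily E lam δ Φ) {δ' : ℝ}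
    (hΦ' : IsFamily E lam δ' (perturb e ρ B Φ))
    (he : e ∈ IsManifold.maximalAtlas 𝓘(ℝ, E) ∞ M)
    (hlam : ContMDiffOn 𝓘(ℝ, ℝ) 𝓘(ℝ, E) ∞ lam (Icc 0 1))
    (hreg : ∀ s ∈ Icc (0 : ℝ) 1, (tangentOf lam (Icc 0 1) s 1 : E) ≠ 0)
    (hsrc : ∀ s ∈ Icc (0 : ℝ) 1, s ∈ tsupport ρ → lam s ∈ e.source)
    (hδ' : ∀ z ∈ box δ', z.1 ∈ tsupport ρ →
      Φ z ∈ e.source ∧ e (Φ z) + ρ z.1 • B z.2 ∈ e.target) {U : E}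
    (hU : HasDerivAt (fun r => B (0, r)) U 0) {s : ℝ} (hs : s ∈ Icc (0 : ℝ) 1) :
    slope L lam (perturb e ρ B Φ) s =
      slope L lam Φ s + ρ s * momentum L e (Icc 0 1) (e ∘ lam) s U := by
  by_cases h : s ∈ tsupport ρ
  · obtain ⟨U₁, h1, h2⟩ := slope_eq hL hΦ he hlam hreg hs (hsrc s hs h)
    obtain ⟨U₂, h3, h4⟩ := slope_eq hL hΦ' he hlam hreg hs (hsrc s hs h)
    have h5 : HasDerivAt (fun r => e (perturb e ρ B Φ (s, 0, r))) (U₁ + ρ s • U) 0 := by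
      refine (h1.add (hU.const_smul (ρ s))).congr_of_eventuallyEq ?_
      have hpos := hΦ'.pos
      filter_upwards [Icc_mem_nhds (show -δ' < 0 by linarith) hpos] with r hr
      obtain ⟨h6, h7⟩ := hδ' (s, 0, r) ⟨hs, ⟨by linarith, hpos.le⟩, hr⟩ h
      rw [perturb_of_mem_source h6, e.right_inv h7]
      rfl
    rw [h2, h4, h3.unique h5, map_add, map_smul, smul_eq_mul]
  · have : (fun r : ℝ => perturb e ρ B Φ (s, 0, r)) = fun r => Φ (s, 0, r) := by
      funext r
      exact perturb_of_notMem h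
    rw [slope, this, image_eq_zero_of_notMem_tsupport h, zero_mul, add_zero, slope]

/-- A perturbation by a bump function near `s₀` that decreases the slope of every family. -/
theorem exists_perturb_slope_lt (hL : IsFinslerLagrangian L)
    (he : e ∈ IsManifold.maximalAtlas 𝓘(ℝ, E) ∞ M)
    (hlam : ContMDiffOn 𝓘(ℝ, ℝ) 𝓘(ℝ, E) ∞ lam (Icc 0 1))
    (hreg : ∀ s ∈ Icc (0 : ℝ) 1, (tangentOf lam (Icc 0 1) s 1 : E) ≠ 0) {s₀ : ℝ}
    (hs₀ : s₀ ∈ Icc (0 : ℝ) 1) (hsrc : lam s₀ ∈ e.source) {U : E}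
    (hU : momentum L e (Icc 0 1) (e ∘ lam) s₀ U < 0) {O : Set ℝ} (hO : O ∈ 𝓝 s₀) :
    ∃ ρ : ℝ → ℝ, ρ s₀ = 1 ∧ tsupport ρ ⊆ O ∧ ∃ T ∈ 𝓝[Icc 0 1] s₀, ∀ (δ : ℝ)
      (Φ : ℝ × ℝ × ℝ → M) (B : ℝ × ℝ → E) (V : Set (ℝ × ℝ)), IsFamily E lam δ Φ → IsOpen V →
      0 ∈ V → ContDiffOn ℝ ∞ B V → B 0 = 0 → HasDerivAt (fun r => B (0, r)) U 0 →
      ∃ δ', 0 < δ' ∧ δ' ≤ δ ∧ IsFamily E lam δ' (perturb e ρ B Φ) ∧ (∀ z ∈ box δ', z.2 ∈ V ∧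
        (z.1 ∈ tsupport ρ → Φ z ∈ e.source ∧ e (Φ z) + ρ z.1 • B z.2 ∈ e.target)) ∧
        ∀ s ∈ Icc (0 : ℝ) 1, slope L lam (perturb e ρ B Φ) s ≤ slope L lam Φ s ∧
          (s ∈ T → slope L lam (perturb e ρ B Φ) s < slope L lam Φ s) := by
  have hUs := uniqueDiffOn_Icc (zero_lt_one (α := ℝ))
  have hm : ContinuousWithinAt (fun s => momentum L e (Icc 0 1) (e ∘ lam) s U) (Icc 0 1) s₀ :=
    ((contDiffWithinAt_momentum_force hL he hUs hs₀ (contDiffWithinAt_chart_comp he (hlam s₀ hs₀)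
      hsrc) (e.map_source hsrc) ((tangentOf_ne_zero_iff he (hUs s₀ hs₀)
        ((hlam s₀ hs₀).mdifferentiableWithinAt (by simp)) hsrc 1).1
          (hreg s₀ hs₀))).1.continuousWithinAt).clm_apply continuousWithinAt_const
  have hev : ∀ᶠ s in 𝓝[Icc 0 1] s₀, momentum L e (Icc 0 1) (e ∘ lam) s U < 0 ∧
      lam s ∈ e.source :=
    (hm.eventually (gt_mem_nhds hU)).and
      ((hlam s₀ hs₀).continuousWithinAt.eventually (e.open_source.mem_nhds hsrc))
  rw [eventually_nhdsWithin_iff] at hev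
  -- The bump is non-negative and, on `[0, 1]`, supported where the momentum is negative on `U`, so
  -- it can only lower the slope.
  obtain ⟨ρ, h1, -, hρ, h2, h3⟩ := exists_contDiff_tsupport_subset (n := ⊤)
    (Filter.inter_mem hev hO)
  have hρ0 : ∀ s, 0 ≤ ρ s := fun s => (h2 (mem_range_self s)).1
  have hsrc' : ∀ s ∈ Icc (0 : ℝ) 1, s ∈ tsupport ρ → lam s ∈ e.source :=
    fun s hs h => ((h1 h).1 hs).2
  -- `ρ` and `T` are fixed before the family is given; the covering argument of
  -- `exists_family_slope_neg` relies on this uniformity.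
  refine ⟨ρ, h3, h1.trans inter_subset_right, {s | 0 < ρ s}, nhdsWithin_le_nhds
    (hρ.continuous.continuousAt.eventually (lt_mem_nhds (by rw [h3]; exact one_pos))), ?_⟩
  intro δ Φ B V hΦ hV h0V hB hB0 hBU
  obtain ⟨δ', h4, h5, h6, h7⟩ := hΦ.exists_perturb he hρ hV h0V hB hB0 hsrc'
  refine ⟨δ', h4, h5, h6, h7, fun s hs => ?_⟩
  rw [slope_perturb hL hΦ h6 he hlam hreg hsrc' (fun z hz => (h7 z hz).2) hBU hs]
  have h8 : 0 < ρ s → momentum L e (Icc 0 1) (e ∘ lam) s U < 0 := fun h =>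
    ((h1 (subset_tsupport ρ h.ne')).1 hs).1
  constructor
  · rcases (hρ0 s).eq_or_lt with h | h
    · rw [← h]; simp
    · have := mul_neg_of_pos_of_neg h (h8 h)
      linarith
  · intro h
    have := mul_neg_of_pos_of_neg h (h8 h)
    linarith

omit [IsManifold 𝓘(ℝ, E) ∞ M] in
theorem isFamily_const (hlam : ContMDiffOn 𝓘(ℝ, ℝ) 𝓘(ℝ, E) ∞ lam (Icc 0 1)) :
    IsFamily E lam 1 (fun z => lam z.1) where
  pos := one_pos
  smooth := hlam.comp contDiff_fst.contMDiff.contMDiffOn fun _ hz => hz.1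
  base := fun _ _ => rfl

omit [IsManifold 𝓘(ℝ, E) ∞ M] in
theorem slope_const (L : TangentBundle 𝓘(ℝ, E) M → ℝ) (lam : ℝ → M) (s : ℝ) :
    slope L lam (fun z => lam z.1) s = 0 := by
  have h : (tangentOf (fun _ : ℝ => lam s) univ 0 1 : E) = 0 :=
    congrArg (fun A : ℝ →L[ℝ] E => A 1) (mfderivWithin_const (I := 𝓘(ℝ, ℝ)) (I' := 𝓘(ℝ, E))
      (s := univ) (x := (0 : ℝ)) (c := lam s))
  rw [slope, h, map_zero]

end Perturbation

/-! ### Families that arrive on the curve `γ`, with negative slope. -/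

section ArrivalFamily

variable {E : Type*} [NormedAddCommGroup E] [NormedSpace ℝ E]
  {M : Type*} [TopologicalSpace M] [ChartedSpace E M] [IsManifold 𝓘(ℝ, E) ∞ M]
  {L : TangentBundle 𝓘(ℝ, E) M → ℝ} {q : M} {I : Set ℝ} {γ lam : ℝ → M}

/-- A family of curves that arrive on `γ`, with `r` the delay, and with non-positive slope that is
negative near the arrival. -/
theorem exists_family_slope_nonpos [FiniteDimensional ℝ E] (hL : IsFinslerLagrangian L)
    (hγ : IsTimelikeEmbedding L I γ) (hlam : IsTrialCurve L q I γ lam)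
    (hτ : arrivalTime I γ lam ∈ interior I) :
    ∃ (δ : ℝ) (Φ : ℝ × ℝ × ℝ → M), IsFamily E lam δ Φ ∧
      (∀ z ∈ box δ, z.1 = 1 → Φ z = γ (arrivalTime I γ lam + z.2.2)) ∧
      (∀ s ∈ Icc (0 : ℝ) 1, slope L lam Φ s ≤ 0) ∧
      ∃ T ∈ 𝓝[Icc 0 1] (1 : ℝ), ∀ s ∈ Icc (0 : ℝ) 1, s ∈ T → slope L lam Φ s < 0 := by
  obtain ⟨hτI, harr, -⟩ := hlam.arrival_eq hγ
  have hneg := (hlam.arrival_timelike hL hγ).1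
  set τ := arrivalTime I γ lam
  set e := chartAt E (lam 1)
  have he : e ∈ IsManifold.maximalAtlas 𝓘(ℝ, E) ∞ M := IsManifold.chart_mem_maximalAtlas _
  have hsrc : lam 1 ∈ e.source := mem_chart_source E _
  have h1 : (1 : ℝ) ∈ Icc (0 : ℝ) 1 := by simp
  have hUs := uniqueDiffOn_Icc (zero_lt_one (α := ℝ)) 1 h1
  have hI : I ∈ 𝓝 τ := mem_interior_iff_mem_nhds.1 hτ
  have hIu : UniqueDiffWithinAt ℝ I τ := uniqueDiffWithinAt_of_mem_nhds hI
  have hγmd := (hγ.smooth τ hτI).mdifferentiableWithinAt (n := ∞) (by simp)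
  set U : E := fderivWithin ℝ (e ∘ γ) I τ 1 with hU
  have hsrcγ : γ τ ∈ e.source := harr ▸ hsrc
  -- This is where the condition on the final tangent vector enters: it fixes the sign of the
  -- momentum on `γ̇`.
  have hmom : momentum L e (Icc 0 1) (e ∘ lam) 1 U < 0 := by
    have hmd := (hlam.smooth 1 h1).mdifferentiableWithinAt (n := ∞) (by simp)
    have hne := (tangentOf_ne_zero_iff he hUs hmd hsrc 1).1 (hlam.regular 1 h1)
    have h2 := fderiv_chartLagrangian_fibre hL he (e.map_source hsrc) hne U
    rw [← tangentOf_eq he hUs hmd hsrc, e.left_inv hsrc, harr, hU,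
      ← tangentOf_eq he hIu hγmd hsrcγ, ← harr] at h2
    exact h2.trans_lt hneg
  have hγc : ContinuousOn γ (interior I) := hγ.smooth.continuousOn.mono interior_subset
  set J : Set ℝ := interior I ∩ γ ⁻¹' e.source
  have hJ : IsOpen J := hγc.isOpen_inter_preimage isOpen_interior e.open_source
  have hJτ : τ ∈ J := ⟨hτ, hsrcγ⟩
  have hsm : ContDiffOn ℝ ∞ (e ∘ γ) J := fun t ht =>
    (contDiffWithinAt_chart_comp he (hγ.smooth t (interior_subset ht.1)) ht.2).mono fun x hx =>
      interior_subset hx.1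
  set V : Set (ℝ × ℝ) := (fun y => τ + y.2) ⁻¹' J
  have hV : IsOpen V := hJ.preimage (by fun_prop)
  have h0V : 0 ∈ V := by simpa [V] using hJτ
  -- As `ρ 1 = 1`, adding this coordinate difference moves the end-point exactly to `γ (τ + r)`.
  set B : ℝ × ℝ → E := fun y => (e ∘ γ) (τ + y.2) - (e ∘ γ) τ with hBdef
  have hB : ContDiffOn ℝ ∞ B V := by
    refine (hsm.comp (t := J) (s := V) (f := fun y : ℝ × ℝ => τ + y.2) ?_ fun y hy => hy).sub
      contDiffOn_const
    fun_prop
  have hB0 : B 0 = 0 := by simp [hBdef]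
  have hBU : HasDerivAt (fun r => B (0, r)) U 0 := by
    have h2 : HasDerivAt (e ∘ γ) U τ := by
      have h3 := ((hsm.contDiffAt (hJ.mem_nhds hJτ)).differentiableAt (by simp)).hasFDerivAt
      rw [← fderivWithin_of_mem_nhds hI] at h3
      exact h3.hasDerivAt
    have h4 : HasDerivAt (fun r : ℝ => τ + r) 1 0 := (hasDerivAt_id _).const_add _
    have h5 := HasDerivAt.scomp (0 : ℝ) (g₁ := e ∘ γ) (by simpa using h2) h4
    rw [one_smul] at h5
    exact h5.sub_const _
  obtain ⟨ρ, hρ1, -, T, hT, hstep⟩ := exists_perturb_slope_lt hL he hlam.smooth hlam.regular h1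
    hsrc hmom Filter.univ_mem
  obtain ⟨δ, -, -, hfam, hV', hsl⟩ := hstep 1 _ B V (isFamily_const hlam.smooth) hV h0V hB hB0 hBU
  refine ⟨δ, _, hfam, ?_, ?_, T, hT, ?_⟩
  · rintro ⟨s, y⟩ hz rfl
    rw [perturb_of_mem_source (show lam 1 ∈ e.source from hsrc)]
    have hy : τ + y.2 ∈ J := (hV' _ hz).1
    simp only [hρ1, one_smul, hBdef, Function.comp, ← harr, add_sub_cancel]
    exact e.left_inv hy.2
  · intro s hs
    exact (hsl s hs).1.trans (slope_const L lam s).le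
  · intro s hs h
    exact ((hsl s hs).2 h).trans_le (slope_const L lam s).le

/-- A family of curves that arrive on `γ`, with `r` the delay, and with negative slope. -/
theorem exists_family_slope_neg [FiniteDimensional ℝ E] (hL : IsFinslerLagrangian L)
    (hγ : IsTimelikeEmbedding L I γ) (hlam : IsTrialCurve L q I γ lam)
    (hτ : arrivalTime I γ lam ∈ interior I) :
    ∃ (δ : ℝ) (Φ : ℝ × ℝ × ℝ → M), IsFamily E lam δ Φ ∧
      (∀ z ∈ box δ, z.1 = 1 → Φ z = γ (arrivalTime I γ lam + z.2.2)) ∧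
      (∀ s ∈ Icc (0 : ℝ) 1, slope L lam Φ s < 0) ∧
      ∀ s ε r, Φ (s, ε, r) = Φ (s, 0, r) := by
  obtain ⟨δ₀, Φ₀, hfam₀, harr₀, hle₀, T₁, hT₁, hlt₀⟩ := exists_family_slope_nonpos hL hγ hlam hτ
  set τ := arrivalTime I γ lam
  let good : ℝ → (ℝ × ℝ × ℝ → M) → Prop := fun δ Φ => IsFamily E lam δ Φ ∧
    (∀ z ∈ box δ, z.1 = 1 → Φ z = γ (τ + z.2.2)) ∧
    ∀ s ∈ Icc (0 : ℝ) 1, slope L lam Φ s ≤ slope L lam Φ₀ s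
  -- Slopes never increase under the improvements, so gains on two sets can be accumulated one after
  -- the other, and a local gain at each point suffices on the compact interval.
  let p : Set ℝ → Prop := fun T => ∀ δ Φ, good δ Φ → ∃ δ' Φ', good δ' Φ' ∧
    ∀ s ∈ Icc (0 : ℝ) 1, slope L lam Φ' s ≤ slope L lam Φ s ∧ (s ∈ T → slope L lam Φ' s < 0)
  have hp : p (Icc 0 1) := by
    refine isCompact_Icc.induction_on (p := p) ?_ ?_ ?_ ?_
    · exact fun δ Φ h => ⟨δ, Φ, h, fun s _ => ⟨le_rfl, fun h => h.elim⟩⟩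
    · intro T T' hTT' hT' δ Φ h
      obtain ⟨δ', Φ', h1, h2⟩ := hT' δ Φ h
      exact ⟨δ', Φ', h1, fun s hs => ⟨(h2 s hs).1, fun hsT => (h2 s hs).2 (hTT' hsT)⟩⟩
    · intro T T' hT hT' δ Φ h
      obtain ⟨δ', Φ', h1, h2⟩ := hT δ Φ h
      obtain ⟨δ'', Φ'', h3, h4⟩ := hT' δ' Φ' h1
      refine ⟨δ'', Φ'', h3, fun s hs => ⟨(h4 s hs).1.trans (h2 s hs).1, ?_⟩⟩
      rintro (hs' | hs')
      · exact (h4 s hs).1.trans_lt ((h2 s hs).2 hs')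
      · exact (h4 s hs).2 hs'
    · intro s₀ hs₀
      rcases eq_or_ne s₀ 1 with rfl | hne
      · exact ⟨T₁, hT₁, fun δ Φ h => ⟨δ, Φ, h, fun s hs =>
          ⟨le_rfl, fun hsT => (h.2.2 s hs).trans_lt (hlt₀ s hs hsT)⟩⟩⟩
      · set e := chartAt E (lam s₀)
        have he : e ∈ IsManifold.maximalAtlas 𝓘(ℝ, E) ∞ M :=
          IsManifold.chart_mem_maximalAtlas _
        have hsrc : lam s₀ ∈ e.source := mem_chart_source E _
        have hUs := uniqueDiffOn_Icc (zero_lt_one (α := ℝ)) s₀ hs₀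
        have hmd := (hlam.smooth s₀ hs₀).mdifferentiableWithinAt (n := ∞) (by simp)
        have hm : momentum L e (Icc 0 1) (e ∘ lam) s₀ ≠ 0 :=
          fderiv_chartLagrangian_ne_zero hL he (e.map_source hsrc)
            ((tangentOf_ne_zero_iff he hUs hmd hsrc 1).1 (hlam.regular s₀ hs₀))
        obtain ⟨U, hU⟩ : ∃ U, momentum L e (Icc 0 1) (e ∘ lam) s₀ U < 0 := by
          by_contra! h
          refine hm (ContinuousLinearMap.ext fun v => le_antisymm ?_ (h v))
          have := h (-v)
          rw [map_neg] at this
          simpa using this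
        -- The support avoids 1, so the arrival on `γ` is kept. Near 0 the start may move for `r ≠
        -- 0`; this is harmless because the delay will vanish at `s = 0`.
        obtain ⟨ρ, -, hO, T, hT, hstep⟩ := exists_perturb_slope_lt hL he hlam.smooth hlam.regular
          hs₀ hsrc hU (isOpen_compl_singleton.mem_nhds (show s₀ ∈ ({1} : Set ℝ)ᶜ from hne))
        refine ⟨T, hT, fun δ Φ h => ?_⟩
        obtain ⟨δ', hδ', hle, hfam, -, hsl⟩ := hstep δ Φ (fun y => y.2 • U) univ h.1 isOpen_univ
          (mem_univ _) (by fun_prop) (by simp)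
          (by simpa using (hasDerivAt_id (0 : ℝ)).smul_const U)
        refine ⟨δ', _, ⟨hfam, fun z hz hz1 => ?_, fun s hs => (hsl s hs).1.trans (h.2.2 s hs)⟩,
          fun s hs => ⟨(hsl s hs).1, fun hsT => ((hsl s hs).2 hsT).trans_le
            ((h.2.2 s hs).trans (hle₀ s hs))⟩⟩
        rw [perturb_of_notMem fun hz' => hO hz' hz1]
        exact h.2.1 z (box_mono hle hz) hz1
  obtain ⟨δ, Φ, ⟨hfam, harr, -⟩, hneg⟩ := hp δ₀ Φ₀ ⟨hfam₀, harr₀, fun s _ => le_rfl⟩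
  have h0 : (0 : ℝ) ∈ Icc (-δ) δ := ⟨by linarith [hfam.pos], hfam.pos.le⟩
  -- Freezing `ε` at 0 leaves that parameter free for the later perturbation.
  refine ⟨δ, fun z => Φ (z.1, 0, z.2.2), ⟨hfam.pos, ?_, hfam.base⟩, ?_,
    fun s hs => (hneg s hs).2 hs, fun _ _ _ => rfl⟩
  · have h1 : ContDiff ℝ ∞ (fun z : ℝ × ℝ × ℝ => ((z.1, 0, z.2.2) : ℝ × ℝ × ℝ)) := by fun_prop
    exact hfam.smooth.comp h1.contMDiff.contMDiffOn fun z hz => ⟨hz.1, h0, hz.2.2⟩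
  · exact fun z hz hz1 => harr _ ⟨hz.1, h0, hz.2.2⟩ hz1

end ArrivalFamily

/-! ### Stability of the condition on the final tangent vector. -/

section LightConeStability

variable {E : Type*} [NormedAddCommGroup E] [NormedSpace ℝ E]
  {M : Type*} [TopologicalSpace M] [ChartedSpace E M] [IsManifold 𝓘(ℝ, E) ∞ M]
  {L : TangentBundle 𝓘(ℝ, E) M → ℝ} {e : OpenPartialHomeomorph M E}

theorem fderiv_chartLagrangian_self (hL : IsFinslerLagrangian L)
    (he : e ∈ IsManifold.maximalAtlas 𝓘(ℝ, E) ∞ M) {y v : E} (hy : y ∈ e.target) (hv : v ≠ 0) :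
    fderiv ℝ (fun u => chartLagrangian L e y u) v v = 2 * chartLagrangian L e y v := by
  rw [fderiv_chartLagrangian_fibre hL he hy hv,
    (isFibreLagrangian hL (e.symm y)).fderiv_self ((chartDeriv_ne_zero he hy).2 hv)]
  rfl

/-- If the segment from a lightlike vector to `u` is timelike and transversal to the light cone,
then the same holds for nearby pairs of vectors. -/
theorem eventually_segment_timelike (hL : IsFinslerLagrangian L)
    (he : e ∈ IsManifold.maximalAtlas 𝓘(ℝ, E) ∞ M) {y₀ u₀ v₀ : E} (hy : y₀ ∈ e.target)
    (hv : v₀ ≠ 0) (hnull : chartLagrangian L e y₀ v₀ = 0)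
    (hneg : fderiv ℝ (fun u => chartLagrangian L e y₀ u) v₀ u₀ < 0)
    (hseg : ∀ σ ∈ Ioc (0 : ℝ) 1, v₀ + σ • (u₀ - v₀) ≠ 0 ∧
      chartLagrangian L e y₀ (v₀ + σ • (u₀ - v₀)) < 0) :
    ∀ᶠ x : E × E × E in 𝓝 (y₀, u₀, v₀), chartLagrangian L e x.1 x.2.2 = 0 →
      ∀ σ ∈ Ioc (0 : ℝ) 1, x.2.2 + σ • (x.2.1 - x.2.2) ≠ 0 ∧
        chartLagrangian L e x.1 (x.2.2 + σ • (x.2.1 - x.2.2)) < 0 := by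
  set K : E × E → ℝ := fun p => chartLagrangian L e p.1 p.2
  have hopen : IsOpen (e.target ×ˢ ({0}ᶜ : Set E)) := e.open_target.prod isOpen_compl_singleton
  have hK := contDiffOn_chartLagrangian hL he
  let w : (E × E × E) × ℝ → E × E := fun z => (z.1.1, z.1.2.2 + z.2 • (z.1.2.1 - z.1.2.2))
  have hw : Continuous w := by fun_prop
  -- Near the lightlike end of the segment the Lagrangian tends to zero, so its sign is controlled
  -- through its derivative along the segment.
  obtain ⟨N, hN, η, hη, hloc⟩ : ∃ N ∈ 𝓝 (y₀, u₀, v₀), ∃ η > 0, ∀ x ∈ N, ∀ σ ∈ Icc (0 : ℝ) η,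
      w (x, σ) ∈ e.target ×ˢ ({0}ᶜ : Set E) ∧ fderiv ℝ K (w (x, σ)) (0, x.2.1 - x.2.2) < 0 := by
    have h1 : w ((y₀, u₀, v₀), 0) = (y₀, v₀) := by simp [w]
    have h2 : ContinuousAt (fun z => fderiv ℝ K (w z) (0, z.1.2.1 - z.1.2.2))
        ((y₀, u₀, v₀), 0) := by
      refine ContinuousAt.clm_apply ?_ (by fun_prop)
      refine ContinuousAt.comp (g := fderiv ℝ K) ?_ hw.continuousAt
      rw [h1]
      exact (contDiffAt_fderiv_chartLagrangian hL he hy hv).continuousAt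
    have h3 : fderiv ℝ K (w ((y₀, u₀, v₀), 0)) (0, u₀ - v₀) < 0 := by
      rw [h1, (hasFDerivAt_chartLagrangian hL he hy hv).fderiv]
      simp only [ContinuousLinearMap.coprod_apply, map_zero, zero_add, map_sub]
      rw [fderiv_chartLagrangian_self hL he hy hv, hnull]
      simpa using hneg
    have h4 := (hw.continuousAt.eventually (hopen.mem_nhds
      (show w ((y₀, u₀, v₀), 0) ∈ _ by rw [h1]; exact ⟨hy, hv⟩))).and
      (h2.eventually (gt_mem_nhds h3))
    rw [nhds_prod_eq, Filter.eventually_prod_iff] at h4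
    obtain ⟨p, hp, p', hp', h5⟩ := h4
    obtain ⟨η, hη, h6⟩ := Metric.eventually_nhds_iff.1 hp'
    refine ⟨{x | p x}, hp, η / 2, by positivity, fun x hx σ hσ => h5 hx (h6 ?_)⟩
    rw [dist_zero_right, Real.norm_eq_abs, abs_of_nonneg hσ.1]
    linarith [hσ.2]
  -- Away from that end, negativity itself is stable by compactness.
  have hfar : ∀ᶠ x in 𝓝 (y₀, u₀, v₀), ∀ σ ∈ Icc η 1,
      w (x, σ) ∈ e.target ×ˢ ({0}ᶜ : Set E) ∧ K (w (x, σ)) < 0 := by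
    apply isCompact_Icc.eventually_forall_of_forall_eventually
    intro σ hσ
    have h1 := hseg σ ⟨hη.trans_le hσ.1, hσ.2⟩
    have h2 : w ((y₀, u₀, v₀), σ) ∈ e.target ×ˢ ({0}ᶜ : Set E) := ⟨hy, h1.1⟩
    have h3 : ContinuousAt (K ∘ w) ((y₀, u₀, v₀), σ) :=
      ContinuousAt.comp (hK.continuousOn.continuousAt (hopen.mem_nhds h2)) hw.continuousAt
    exact (hw.continuousAt.eventually (hopen.mem_nhds h2)).and
      (h3.eventually (gt_mem_nhds h1.2))
  filter_upwards [hN, hfar] with x hx hx' h0 σ hσ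
  rcases le_total η σ with h | h
  · exact ⟨(hx' σ ⟨h, hσ.2⟩).1.2, (hx' σ ⟨h, hσ.2⟩).2⟩
  · refine ⟨(hloc x hx σ ⟨hσ.1.le, h⟩).1.2, ?_⟩
    have hd : ∀ t ∈ Icc 0 η, HasDerivAt (fun t => K (w (x, t)))
        (fderiv ℝ K (w (x, t)) (0, x.2.1 - x.2.2)) t := by
      intro t ht
      have h1 : HasDerivAt (fun t => w (x, t)) (0, x.2.1 - x.2.2) t := by
        refine (hasDerivAt_const t x.1).prodMk ?_
        simpa using ((hasDerivAt_id t).smul_const (x.2.1 - x.2.2)).const_add x.2.2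
      exact ((hK.contDiffAt (hopen.mem_nhds (hloc x hx t ht).1)).differentiableAt
        (by simp)).hasFDerivAt.comp_hasDerivAt t h1
    have hanti : StrictAntiOn (fun t => K (w (x, t))) (Icc 0 η) := by
      refine strictAntiOn_of_deriv_neg (convex_Icc _ _)
        (fun t ht => (hd t ht).continuousAt.continuousWithinAt) fun t ht => ?_
      rw [(hd t (interior_subset ht)).deriv]
      exact (hloc x hx t (interior_subset ht)).2
    have h1 := hanti (left_mem_Icc.2 hη.le) ⟨hσ.1.le, h⟩ hσ.1
    have h2 : K (w (x, 0)) = 0 := by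
      simpa [w, K] using h0
    exact h1.trans_eq h2

variable {q : M} {I : Set ℝ} {γ lam : ℝ → M}

/-- In a smooth variation by lightlike curves with end-points on `γ`, the condition on the tangent
vector at the arrival is stable. -/
theorem eventually_velocity_mem_lightCone [FiniteDimensional ℝ E] (hL : IsFinslerLagrangian L)
    (hγ : IsTimelikeEmbedding L I γ) (hlam : IsTrialCurve L q I γ lam)
    (hτ : arrivalTime I γ lam ∈ interior I) {ε₀ : ℝ} (hε₀ : 0 < ε₀) {Λ : ℝ × ℝ → M}
    (hΛ : ContMDiffOn 𝓘(ℝ, ℝ × ℝ) 𝓘(ℝ, E) ∞ Λ (Ioo (-ε₀) ε₀ ×ˢ Icc (0 : ℝ) 1))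
    (hbase : ∀ s ∈ Icc (0 : ℝ) 1, Λ (0, s) = lam s) {θ : ℝ → ℝ} (hθ : ContinuousAt θ 0)
    (hθ0 : θ 0 = arrivalTime I γ lam) (hend : ∀ ε ∈ Ioo (-ε₀) ε₀, Λ (ε, 1) = γ (θ ε))
    (hreg : ∀ ε ∈ Ioo (-ε₀) ε₀, (tangentOf (fun s => Λ (ε, s)) (Icc 0 1) 1 1 : E) ≠ 0)
    (hnull : ∀ ε ∈ Ioo (-ε₀) ε₀, L (velocity (Icc 0 1) (fun s => Λ (ε, s)) 1) = 0) :
    ∀ᶠ ε in 𝓝 0, velocity (Icc 0 1) (fun s => Λ (ε, s)) 1 ∈ lightCone L (velocity I γ (θ ε)) := by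
  obtain ⟨hτI, harr, -⟩ := hlam.arrival_eq hγ
  obtain ⟨hneg, hseg⟩ := hlam.arrival_timelike hL hγ
  set τ := arrivalTime I γ lam
  set D := Ioo (-ε₀) ε₀ ×ˢ Icc (0 : ℝ) 1
  have hD : UniqueDiffOn ℝ D := uniqueDiffOn_strip
  have h1I : (1 : ℝ) ∈ Icc (0 : ℝ) 1 := by simp
  have hUs := uniqueDiffOn_Icc (zero_lt_one (α := ℝ)) 1 h1I
  have h0 : (0 : ℝ) ∈ Ioo (-ε₀) ε₀ := ⟨by simpa using hε₀, hε₀⟩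
  have hnear : ∀ᶠ ε : ℝ in 𝓝 0, ε ∈ Ioo (-ε₀) ε₀ := Ioo_mem_nhds h0.1 h0.2
  have hmem : ∀ ε ∈ Ioo (-ε₀) ε₀, (ε, (1 : ℝ)) ∈ D := fun ε hε => ⟨hε, h1I⟩
  have hmd : ∀ z ∈ D, MDifferentiableWithinAt 𝓘(ℝ, ℝ × ℝ) 𝓘(ℝ, E) Λ D z := fun z hz =>
    (hΛ z hz).mdifferentiableWithinAt (by simp)
  have hvel : ∀ ε ∈ Ioo (-ε₀) ε₀, (tangentOf (fun s => Λ (ε, s)) (Icc 0 1) 1 1 : E) =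
      tangentOf Λ D (ε, 1) (0, 1) := fun ε hε =>
    pt_injective (velocity_comp (Φ := Λ) (D := D) hUs (ζ := fun s => (ε, s))
      ((hasDerivWithinAt_const _ _ _).prodMk (hasDerivWithinAt_id _ _))
      (fun t ht => ⟨hε, ht⟩) (hmd _ (hmem ε hε)))
  set e := chartAt E (lam 1)
  have he : e ∈ IsManifold.maximalAtlas 𝓘(ℝ, E) ∞ M := IsManifold.chart_mem_maximalAtlas _
  have hsrc : lam 1 ∈ e.source := mem_chart_source E _
  have hsrcΛ : Λ (0, 1) ∈ e.source := by rw [hbase 1 h1I]; exact hsrc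
  have hI : I ∈ 𝓝 τ := mem_interior_iff_mem_nhds.1 hτ
  have hγd := hγ.smooth τ hτI
  have hsrcγ : γ τ ∈ e.source := harr ▸ hsrc
  have hcΛ := contDiffWithinAt_chart_comp he (hΛ _ (hmem 0 h0)) hsrcΛ
  have hcγ := contDiffWithinAt_chart_comp he hγd hsrcγ
  have hline : Filter.Tendsto (fun ε : ℝ => (ε, (1 : ℝ))) (𝓝 0) (𝓝[D] (0, 1)) := by
    refine tendsto_nhdsWithin_iff.2 ⟨(continuous_id.prodMk continuous_const).tendsto _, ?_⟩
    filter_upwards [hnear] with ε hε using hmem ε hε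
  have hIθ : ∀ᶠ ε in 𝓝 0, θ ε ∈ interior I :=
    hθ.eventually (by rw [hθ0]; exact isOpen_interior.mem_nhds hτ)
  have hy : Filter.Tendsto (fun ε => e (Λ (ε, 1))) (𝓝 0) (𝓝 (e (Λ (0, 1)))) :=
    hcΛ.continuousWithinAt.tendsto.comp hline
  have hv : Filter.Tendsto (fun ε => fderivWithin ℝ (e ∘ Λ) D (ε, 1) (0, 1)) (𝓝 0)
      (𝓝 (fderivWithin ℝ (e ∘ Λ) D (0, 1) (0, 1))) :=
    (((hcΛ.fderivWithin_right (m := ∞) hD (by simp) (hmem 0 h0)).clm_apply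
      contDiffWithinAt_const).continuousWithinAt.tendsto.comp hline)
  have hIo : interior I ∈ 𝓝 τ := isOpen_interior.mem_nhds hτ
  have hu : Filter.Tendsto (fun ε => fderivWithin ℝ (e ∘ γ) (interior I) (θ ε) 1) (𝓝 0)
      (𝓝 (fderivWithin ℝ (e ∘ γ) (interior I) τ 1)) := by
    have h2 := (((hcγ.mono interior_subset).fderivWithin_right (m := ∞)
      isOpen_interior.uniqueDiffOn (by simp) hτ).clm_apply
      (contDiffWithinAt_const (c := (1 : ℝ)))).continuousWithinAt.continuousAt hIo
    rw [← hθ0] at h2 ⊢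
    exact h2.tendsto.comp hθ
  have hderiv : ∀ t ∈ interior I, γ t ∈ e.source → (tangentOf γ I t 1 : E) =
      chartDeriv e (e (γ t)) (fderivWithin ℝ (e ∘ γ) (interior I) t 1) := by
    intro t ht hts
    have hIt : I ∈ 𝓝 t := mem_interior_iff_mem_nhds.1 ht
    rw [tangentOf_eq he (uniqueDiffWithinAt_of_mem_nhds hIt)
      ((hγ.smooth t (interior_subset ht)).mdifferentiableWithinAt (by simp)) hts,
      fderivWithin_of_mem_nhds hIt, fderivWithin_of_mem_nhds (isOpen_interior.mem_nhds ht)]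
  let vΛ : ℝ → E := fun ε => tangentOf (fun s => Λ (ε, s)) (Icc 0 1) 1 1
  let uγ : ℝ → E := fun ε => tangentOf γ I (θ ε) 1
  have hpt : ∀ ε ∈ Ioo (-ε₀) ε₀, θ ε ∈ interior I → Λ (ε, 1) ∈ e.source → ∀ σ : ℝ,
      vΛ ε + σ • (uγ ε - vΛ ε) =
      chartDeriv e (e (Λ (ε, 1))) (fderivWithin ℝ (e ∘ Λ) D (ε, 1) (0, 1) +
        σ • (fderivWithin ℝ (e ∘ γ) (interior I) (θ ε) 1 -
          fderivWithin ℝ (e ∘ Λ) D (ε, 1) (0, 1))) := by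
    intro ε hε hθε hs σ
    simp only [vΛ, uγ]
    rw [hvel ε hε, tangentOf_eq he (hD _ (hmem ε hε)) (hmd _ (hmem ε hε)) hs,
      hderiv _ hθε (by rw [← hend ε hε]; exact hs), ← hend ε hε]
    simp only [map_add, map_smul, map_sub]
  have hptL : ∀ ε ∈ Ioo (-ε₀) ε₀, θ ε ∈ interior I → Λ (ε, 1) ∈ e.source → ∀ σ : ℝ,
      L (pt (Λ (ε, 1)) (vΛ ε + σ • (uγ ε - vΛ ε))) =
      chartLagrangian L e (e (Λ (ε, 1))) (fderivWithin ℝ (e ∘ Λ) D (ε, 1) (0, 1) +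
        σ • (fderivWithin ℝ (e ∘ γ) (interior I) (θ ε) 1 -
          fderivWithin ℝ (e ∘ Λ) D (ε, 1) (0, 1))) := by
    intro ε hε hθε hs σ
    rw [chartLagrangian_eq]
    exact congrArg L (pt_congr (e.left_inv hs).symm (hpt ε hε hθε hs σ))
  have hv0 : (tangentOf (fun s => Λ (0, s)) (Icc 0 1) 1 1 : E) = tangentOf lam (Icc 0 1) 1 1 := by
    have h2 := velocity_congr_of_eqOn (E := E) h1I (c := fun s => Λ (0, s)) (c' := lam)
      fun s hs => hbase s hs
    rw [velocity_eq, velocity_eq] at h2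
    exact pt_injective (h2.trans (pt_congr (hbase 1 h1I).symm rfl))
  have hne0 : fderivWithin ℝ (e ∘ Λ) D (0, 1) (0, 1) ≠ 0 :=
    (tangentOf_ne_zero_iff he (hD _ (hmem 0 h0)) (hmd _ (hmem 0 h0)) hsrcΛ _).1
      (by rw [← hvel 0 h0]; exact hreg 0 h0)
  have hnull' : ∀ ε ∈ Ioo (-ε₀) ε₀, θ ε ∈ interior I → Λ (ε, 1) ∈ e.source →
      chartLagrangian L e (e (Λ (ε, 1))) (fderivWithin ℝ (e ∘ Λ) D (ε, 1) (0, 1)) = 0 := by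
    intro ε hε hθε hs
    have h2 := hptL ε hε hθε hs 0
    simp only [zero_smul, add_zero] at h2
    rw [← h2]
    exact hnull ε hε
  have hev := eventually_segment_timelike hL he (e.map_source hsrcΛ) hne0
    (u₀ := fderivWithin ℝ (e ∘ γ) (interior I) τ 1) (hnull' 0 h0 (hθ0 ▸ hτ) hsrcΛ) ?_ ?_
  · have hev' := (hy.prodMk_nhds (hu.prodMk_nhds hv)).eventually hev
    have hsrcev : ∀ᶠ ε in 𝓝 0, Λ (ε, 1) ∈ e.source :=
      hline.eventually ((hΛ _ (hmem 0 h0)).continuousWithinAt.eventually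
        (e.open_source.mem_nhds hsrcΛ))
    filter_upwards [hev', hnear, hIθ, hsrcev] with ε h2 h3 h4 h5
    have h6 := h2 (hnull' ε h3 h4 h5)
    have h7 : (velocity I γ (θ ε) : TangentBundle 𝓘(ℝ, E) M) =
        pt (Λ (ε, 1)) (tangentOf (E := E) γ I (θ ε) 1) := pt_congr (hend ε h3).symm rfl
    rw [h7, velocity_eq, mem_lightCone_iff]
    -- A timelike segment to the velocity of `γ` certifies membership in the boundary of the right
    -- component.
    refine ⟨hreg ε h3, (isFibreLagrangian hL (Λ (ε, 1))).mem_frontier (hnull ε h3) ?_⟩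
    intro σ hσ
    refine ⟨?_, ?_⟩
    · change vΛ ε + σ • (uγ ε - vΛ ε) ≠ 0
      rw [hpt ε h3 h4 h5 σ, chartDeriv_ne_zero he (e.map_source h5)]
      exact (h6 σ hσ).1
    · change L (pt (Λ (ε, 1)) (vΛ ε + σ • (uγ ε - vΛ ε))) < 0
      rw [hptL ε h3 h4 h5 σ]
      exact (h6 σ hσ).2
  · have h2 := fderiv_chartLagrangian_fibre hL he (e.map_source hsrcΛ) hne0
      (fderivWithin ℝ (e ∘ γ) (interior I) τ 1)
    rw [h2, ← tangentOf_eq he (hD _ (hmem 0 h0)) (hmd _ (hmem 0 h0)) hsrcΛ, ← hvel 0 h0, hv0,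
      hbase 1 h1I, e.left_inv hsrc, harr, ← hderiv τ hτ hsrcγ, ← harr]
    exact hneg
  · intro σ hσ
    have h2 := hpt 0 h0 (hθ0 ▸ hτ) hsrcΛ σ
    have h3 := hptL 0 h0 (hθ0 ▸ hτ) hsrcΛ σ
    simp only [vΛ, uγ] at h2 h3
    rw [hθ0] at h2 h3
    rw [hv0] at h2 h3
    rw [← h3, ← chartDeriv_ne_zero he (e.map_source hsrcΛ), ← h2]
    refine ⟨(hseg σ hσ).1, ?_⟩
    rw [hbase 1 h1I]
    exact (hseg σ hσ).2

end LightConeStability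

/-! ### Allowed variations obtained by solving for the delay. -/

section Converse

variable {E : Type*} [NormedAddCommGroup E] [NormedSpace ℝ E]
  {M : Type*} [TopologicalSpace M] [ChartedSpace E M] [IsManifold 𝓘(ℝ, E) ∞ M]
  {L : TangentBundle 𝓘(ℝ, E) M → ℝ} {q : M} {I : Set ℝ} {γ lam : ℝ → M} {δ : ℝ}
  {Φ : ℝ × ℝ × ℝ → M}

/-- From a family of curves that arrive on `γ`, an allowed variation is obtained by solving the
equation `L = 0` for the delay. -/
theorem exists_allowedVariation [FiniteDimensional ℝ E] (hL : IsFinslerLagrangian L)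
    (hγ : IsTimelikeEmbedding L I γ) (hlam : IsTrialCurve L q I γ lam)
    (hτ : arrivalTime I γ lam ∈ interior I) (hΦ : IsFamily E lam δ Φ)
    (harr : ∀ z ∈ box δ, z.1 = 1 → Φ z = γ (arrivalTime I γ lam + z.2.2))
    (hstart : ∀ ε, Φ (0, ε, 0) = q) (hslope : ∀ s ∈ Icc (0 : ℝ) 1, slope L lam Φ s < 0) :
    ∃ (ε₀ : ℝ) (Lam : ℝ → ℝ → M), IsAllowedVariation L q I γ lam ε₀ Lam ∧ ∃ ρ ρ' : ℝ → ℝ,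
      HasDerivAt (fun ε => arrivalTime I γ (Lam ε)) (ρ 1) 0 ∧ ρ 0 = 0 ∧
      ∀ s ∈ Icc (0 : ℝ) 1, HasDerivWithinAt ρ (ρ' s) (Icc 0 1) s ∧
        ∃ a, HasDerivAt (fun ε => L (velocity (Icc 0 1) (fun t => Φ (t, ε, 0)) s)) a 0 ∧
          a + ρ s * sensitivity L Φ s + ρ' s * slope L lam Φ s = 0 := by
  obtain ⟨δ₁, h0, hδ₁, hreg⟩ := hΦ.exists_regular hlam.regular
  have hA := fun s hs => hΦ.fderivWithin_pullback hL h0 hδ₁ hreg (s := s) hs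
  have hF := hΦ.contDiffOn_pullback hL hδ₁ hreg
  obtain ⟨ε₀, hε₀, r, hr, hr0, hsol, ρ, ρ', hρ⟩ := exists_implicit_solution h0 hF
    (fun s hs => by
      have h1 := hΦ.velocity_curve (hΦ.mem hs)
      rw [velocity_congr_of_eqOn hs fun t ht => hΦ.base t ht] at h1
      exact (congrArg L h1).symm.trans (hlam.lightlike s hs))
    (fun s hs => by rw [(hA s hs).1]; exact hslope s hs)
  set τ := arrivalTime I γ lam
  -- The implicit equation for `r` says precisely that these curves are lightlike; their arrival
  -- time is `τ + r (ε, 1)`.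
  set Λ : ℝ × ℝ → M := fun p => Φ (p.2, p.1, r p)
  have h1I : (1 : ℝ) ∈ Icc (0 : ℝ) 1 := by simp
  have h0I : (0 : ℝ) ∈ Icc (0 : ℝ) 1 := by simp
  have hbox : ∀ ε ∈ Ioo (-ε₀) ε₀, ∀ s ∈ Icc (0 : ℝ) 1, (s, ε, r (ε, s)) ∈ box δ :=
    fun ε hε s hs => box_mono hδ₁ ((hsol ε hε).2 s hs).1
  have hΛ : ContMDiffOn 𝓘(ℝ, ℝ × ℝ) 𝓘(ℝ, E) ∞ Λ (Ioo (-ε₀) ε₀ ×ˢ Icc (0 : ℝ) 1) := by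
    have h1 : ContDiffOn ℝ ∞ (fun p : ℝ × ℝ => ((p.2, p.1, r p) : ℝ × ℝ × ℝ))
        (Ioo (-ε₀) ε₀ ×ˢ Icc (0 : ℝ) 1) :=
      contDiffOn_snd.prodMk (contDiffOn_fst.prodMk hr)
    exact hΦ.smooth.comp h1.contMDiffOn fun p hp => hbox p.1 hp.1 p.2 hp.2
  have hbase : ∀ s ∈ Icc (0 : ℝ) 1, Λ (0, s) = lam s := by
    intro s hs
    simp only [Λ, hr0 s hs]
    exact hΦ.base s hs
  have hvel : ∀ ε ∈ Ioo (-ε₀) ε₀, ∀ s ∈ Icc (0 : ℝ) 1, ∃ v ∈ Icc (-δ₁) δ₁,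
      (velocity (Icc 0 1) (fun t => Λ (ε, t)) s : TangentBundle 𝓘(ℝ, E) M) =
        pt (Λ (ε, s)) (tangentOf (E := E) Φ (box δ) (s, ε, r (ε, s)) (1, 0, v)) ∧
      pullback L Φ (box δ) ((s, ε, r (ε, s)), (1, 0, v)) = 0 := by
    intro ε hε s hs
    obtain ⟨-, v, hv, hd, hz⟩ := (hsol ε hε).2 s hs
    exact ⟨v, hv, velocity_comp (ζ := fun t => (t, ε, r (ε, t)))
      (uniqueDiffOn_Icc zero_lt_one s hs)
      ((hasDerivWithinAt_id _ _).prodMk ((hasDerivWithinAt_const _ _ _).prodMk hd))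
      (fun t ht => hbox ε hε t ht) (hΦ.mdifferentiable (hbox ε hε s hs)), hz⟩
  have hregΛ : ∀ ε ∈ Ioo (-ε₀) ε₀, ∀ s ∈ Icc (0 : ℝ) 1,
      (tangentOf (fun t => Λ (ε, t)) (Icc 0 1) s 1 : E) ≠ 0 := by
    intro ε hε s hs
    obtain ⟨v, hv, h1, -⟩ := hvel ε hε s hs
    rw [velocity_eq] at h1
    rw [pt_injective h1]
    exact hreg _ ((hsol ε hε).2 s hs).1 v hv
  have hnull : ∀ ε ∈ Ioo (-ε₀) ε₀, ∀ s ∈ Icc (0 : ℝ) 1,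
      L (velocity (Icc 0 1) (fun t => Λ (ε, t)) s) = 0 := by
    intro ε hε s hs
    obtain ⟨v, hv, h1, h2⟩ := hvel ε hε s hs
    rw [h1]
    exact h2
  have hend : ∀ ε ∈ Ioo (-ε₀) ε₀, Λ (ε, 1) = γ (τ + r (ε, 1)) := fun ε hε =>
    harr _ (hbox ε hε 1 h1I) rfl
  have hnear : ∀ᶠ ε : ℝ in 𝓝 0, ε ∈ Ioo (-ε₀) ε₀ := Ioo_mem_nhds (by simpa using hε₀) hε₀
  have hθ : HasDerivAt (fun ε => τ + r (ε, 1)) (ρ 1) 0 := (hρ 1 h1I).1.const_add τ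
  have hθ0 : τ + r (0, 1) = τ := by rw [hr0 1 h1I, add_zero]
  have hcone := eventually_velocity_mem_lightCone hL hγ hlam hτ hε₀ hΛ hbase hθ.continuousAt hθ0
    hend (fun ε hε => hregΛ ε hε 1 h1I) (fun ε hε => hnull ε hε 1 h1I)
  have hθI : ∀ᶠ ε in 𝓝 0, τ + r (ε, 1) ∈ I :=
    hθ.continuousAt.eventually (by simp only [hθ0]; exact mem_interior_iff_mem_nhds.1 hτ)
  -- The variation is shortened so that the cone condition holds and the arrival parameter stays in
  -- `I`.
  obtain ⟨ε₁, hε₁, hball⟩ := Metric.eventually_nhds_iff.1 (hcone.and (hθI.and hnear))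
  have hsmall : ∀ ε ∈ Ioo (-ε₁) ε₁,
      velocity (Icc 0 1) (fun s => Λ (ε, s)) 1 ∈ lightCone L (velocity I γ (τ + r (ε, 1))) ∧
        τ + r (ε, 1) ∈ I ∧ ε ∈ Ioo (-ε₀) ε₀ := fun ε hε =>
    hball (by rw [dist_zero_right, Real.norm_eq_abs]; exact abs_lt.2 hε)
  refine ⟨ε₁, fun ε s => Λ (ε, s), ⟨hε₁, hΛ.mono ?_, ?_, hbase⟩, ρ, ρ', ?_, ?_, ?_⟩
  · exact prod_mono_left fun ε hε => (hsmall ε hε).2.2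
  · intro ε hε
    obtain ⟨h1, h2, h3⟩ := hsmall ε hε
    refine ⟨?_, ?_, hregΛ ε h3, hnull ε h3, _, h2, hend ε h3, h1⟩
    · have h4 : ContDiffOn ℝ ∞ (fun s : ℝ => (ε, s)) (Icc 0 1) := by fun_prop
      exact hΛ.comp h4.contMDiffOn fun s hs => ⟨h3, hs⟩
    · simp only [Λ, (hsol ε h3).1]
      exact hstart ε
  · refine hθ.congr_of_eventuallyEq ?_
    filter_upwards [hnear, hθI] with ε h1 h2
    exact arrivalTime_eq hγ h2 (hend ε h1)
  · refine (hρ 0 h0I).1.unique ((hasDerivAt_const (0 : ℝ) (0 : ℝ)).congr_of_eventuallyEq ?_)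
    filter_upwards [hnear] with ε hε
    exact (hsol ε hε).1
  · intro s hs
    refine ⟨(hρ s hs).2.1, _, (hA s hs).2.2, ?_⟩
    have h1 := (hρ s hs).2.2
    rw [← (hA s hs).1, ← (hA s hs).2.1]
    set A := fderivWithin ℝ (fun y : (ℝ × ℝ × ℝ) × ℝ => pullback L Φ (box δ) (y.1, (1, 0, y.2)))
      (box δ₁ ×ˢ Icc (-δ₁) δ₁) ((s, 0, 0), 0)
    have h2 : (((0, 1, ρ s), ρ' s) : (ℝ × ℝ × ℝ) × ℝ) =
        ((0, 1, 0), 0) + ρ s • ((0, 0, 1), 0) + ρ' s • (0, 1) := by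
      simp
    rw [h2, map_add, map_add, map_smul, map_smul] at h1
    exact h1

/-- The derivative of the Lagrangian along a perturbation in a chart. -/
theorem hasDerivAt_lagrangian_perturb (hL : IsFinslerLagrangian L)
    {e : OpenPartialHomeomorph M E} (he : e ∈ IsManifold.maximalAtlas 𝓘(ℝ, E) ∞ M)
    (hlam : ContMDiffOn 𝓘(ℝ, ℝ) 𝓘(ℝ, E) ∞ lam (Icc 0 1))
    (hreg : ∀ s ∈ Icc (0 : ℝ) 1, (tangentOf lam (Icc 0 1) s 1 : E) ≠ 0) {ρ : ℝ → ℝ}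
    (hρ : ContDiff ℝ ∞ ρ) {z : E} (hΦ : ∀ s ∈ Icc (0 : ℝ) 1, ∀ ε, Φ (s, ε, 0) = lam s)
    (hsrc : ∀ s ∈ Icc (0 : ℝ) 1, s ∈ tsupport ρ → lam s ∈ e.source) (hδ : 0 < δ)
    (htar : ∀ x ∈ box δ, x.1 ∈ tsupport ρ → e (Φ x) + ρ x.1 • x.2.1 • z ∈ e.target) {s : ℝ}
    (hs : s ∈ Icc (0 : ℝ) 1) :
    HasDerivAt (fun ε => L (velocity (Icc 0 1)
        (fun t => perturb e ρ (fun y => y.1 • z) Φ (t, ε, 0)) s))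
      (ρ s * force L e (Icc 0 1) (e ∘ lam) s z +
        deriv ρ s * momentum L e (Icc 0 1) (e ∘ lam) s z) 0 := by
  by_cases h : s ∈ tsupport ρ
  · have hss := hsrc s hs h
    have hUs := uniqueDiffOn_Icc (zero_lt_one (α := ℝ)) s hs
    have hmd := (hlam s hs).mdifferentiableWithinAt (n := ∞) (by simp)
    have hne := (tangentOf_ne_zero_iff he hUs hmd hss 1).1 (hreg s hs)
    have hc : HasDerivWithinAt (e ∘ lam) (derivWithin (e ∘ lam) (Icc 0 1) s) (Icc 0 1) s :=
      ((contDiffWithinAt_chart_comp he (hlam s hs) hss).differentiableWithinAt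
        (by simp)).hasDerivWithinAt
    have hρd : HasDerivAt ρ (deriv ρ s) s := (hρ.differentiable (by simp) s).hasDerivAt
    -- In the chart, position and velocity of the perturbed curve are affine in `ε`, with directions
    -- `ρ z` and `ρ' z`.
    have hline : HasDerivAt (fun ε : ℝ => (((e ∘ lam) s + ε • ρ s • z,
        derivWithin (e ∘ lam) (Icc 0 1) s + ε • deriv ρ s • z) : E × E))
        (ρ s • z, deriv ρ s • z) 0 := by
      refine HasDerivAt.prodMk ?_ ?_
      · simpa using ((hasDerivAt_id (0 : ℝ)).smul_const (ρ s • z)).const_add ((e ∘ lam) s)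
      · simpa using ((hasDerivAt_id (0 : ℝ)).smul_const (deriv ρ s • z)).const_add
          (derivWithin (e ∘ lam) (Icc 0 1) s)
    have hK := hasFDerivAt_chartLagrangian hL he (e.map_source hss)
      (u := derivWithin (e ∘ lam) (Icc 0 1) s) hne
    have h1 := HasFDerivAt.comp_hasDerivAt (0 : ℝ) (by
      rw [zero_smul, zero_smul, add_zero, add_zero]; exact hK) hline
    refine (h1.congr_of_eventuallyEq ?_).congr_deriv ?_
    · filter_upwards [Icc_mem_nhds (show -δ < 0 by linarith) hδ] with ε hε
      have hbox : ∀ t ∈ Icc (0 : ℝ) 1, (t, ε, 0) ∈ box δ := fun t ht =>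
        ⟨ht, hε, by linarith, hδ.le⟩
      set c : ℝ → M := fun t => perturb e ρ (fun y => y.1 • z) Φ (t, ε, 0)
      have hc1 : ∀ t ∈ Icc (0 : ℝ) 1, lam t ∈ e.source →
          (e ∘ lam) t + ε • ρ t • z ∈ e.target ∧
            c t = e.symm ((e ∘ lam) t + ε • ρ t • z) := by
        intro t ht hts
        constructor
        · by_cases h' : t ∈ tsupport ρ
          · have := htar _ (hbox t ht) h'
            simp only [hΦ t ht, smul_comm (ρ t) ε] at this
            exact this
          · rw [image_eq_zero_of_notMem_tsupport h', zero_smul, smul_zero, add_zero]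
            exact e.map_source hts
        · have hts' : Φ (t, ε, 0) ∈ e.source := by rw [hΦ t ht]; exact hts
          simp only [c]
          rw [perturb_of_mem_source hts', hΦ t ht, smul_comm (ρ t) ε]
          rfl
      have hcs := hc1 s hs hss
      have hevs : ∀ᶠ t in 𝓝[Icc 0 1] s, lam t ∈ e.source :=
        (hlam s hs).continuousWithinAt.eventually (e.open_source.mem_nhds hss)
      have hYd : HasDerivWithinAt (fun t => (e ∘ lam) t + ε • ρ t • z)
          (derivWithin (e ∘ lam) (Icc 0 1) s + ε • deriv ρ s • z) (Icc 0 1) s :=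
        hc.add (((hρd.smul_const z).const_smul ε).hasDerivWithinAt)
      have hcsrc : c s ∈ e.source := by rw [hcs.2]; exact e.map_target hcs.1
      have hcm : MDifferentiableWithinAt 𝓘(ℝ, ℝ) 𝓘(ℝ, E) c (Icc 0 1) s := by
        have h2 := ((mdifferentiable_chart_of_mem he).mdifferentiableAt_symm
          hcs.1).comp_mdifferentiableWithinAt s
            hYd.differentiableWithinAt.mdifferentiableWithinAt
        refine h2.congr_of_eventuallyEq ?_ hcs.2
        filter_upwards [hevs, self_mem_nhdsWithin] with t ht ht'
        exact (hc1 t ht' ht).2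
      have hcd : HasDerivWithinAt (e ∘ c)
          (derivWithin (e ∘ lam) (Icc 0 1) s + ε • deriv ρ s • z) (Icc 0 1) s := by
        have h2 : ∀ t ∈ Icc (0 : ℝ) 1, lam t ∈ e.source →
            (e ∘ c) t = (e ∘ lam) t + ε • ρ t • z := fun t ht hts => by
          simp only [Function.comp_apply, (hc1 t ht hts).2]
          exact e.right_inv (hc1 t ht hts).1
        refine hYd.congr_of_eventuallyEq ?_ (h2 s hs hss)
        filter_upwards [hevs, self_mem_nhdsWithin] with t ht ht'
        exact h2 t ht' ht
      have h3 := pullback_eq (L := L) he hUs hcm hcsrc 1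
      have h4 : fderivWithin ℝ (e ∘ c) (Icc 0 1) s 1 =
          derivWithin (e ∘ lam) (Icc 0 1) s + ε • deriv ρ s • z := by
        rw [← hcd.derivWithin hUs]
        rfl
      rw [h4, hcs.2, e.right_inv hcs.1] at h3
      exact h3
    · simp only [ContinuousLinearMap.coprod_apply, map_smul, smul_eq_mul]
      rfl
  -- Off the closed support the perturbed curve coincides with `lam` near `s`, and both `ρ` and `ρ'`
  -- vanish.
  · have h1 : ∀ ε, (velocity (Icc 0 1)
        (fun t => perturb e ρ (fun y => y.1 • z) Φ (t, ε, 0)) s : TangentBundle 𝓘(ℝ, E) M) =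
        velocity (Icc 0 1) lam s := by
      intro ε
      refine velocity_congr ?_ ?_
      · filter_upwards [nhdsWithin_le_nhds ((isClosed_tsupport ρ).isOpen_compl.mem_nhds h),
          self_mem_nhdsWithin] with t ht ht'
        rw [perturb_of_notMem (show ((t, ε, 0) : ℝ × ℝ × ℝ).1 ∉ tsupport ρ from ht), hΦ t ht']
      · rw [perturb_of_notMem (show ((s, ε, 0) : ℝ × ℝ × ℝ).1 ∉ tsupport ρ from h), hΦ s hs]
    have h2 : deriv ρ s = 0 := by
      by_contra h3
      exact h (support_deriv_subset h3)
    simp only [h1]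
    rw [image_eq_zero_of_notMem_tsupport h, h2]
    simpa using hasDerivAt_const (0 : ℝ) (L (velocity (Icc 0 1) lam s))

end Converse

/-! ### Stationary curves are geodesics. -/

section EulerLagrange

variable {E : Type*} [NormedAddCommGroup E] [NormedSpace ℝ E]
  {M : Type*} [TopologicalSpace M] [ChartedSpace E M] [IsManifold 𝓘(ℝ, E) ∞ M]
  {L : TangentBundle 𝓘(ℝ, E) M → ℝ} {q : M} {I : Set ℝ} {γ lam : ℝ → M} {δ : ℝ}
  {Ψ : ℝ × ℝ × ℝ → M}

/-- The multiplier rule: a stationary trial curve satisfies the Euler-Lagrange equation in the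
interior of the parameter interval, with a factor that depends only on the family `Ψ`. -/
theorem eulerLagrange_interior [FiniteDimensional ℝ E] (hL : IsFinslerLagrangian L)
    (hγ : IsTimelikeEmbedding L I γ) (hlam : IsTrialCurve L q I γ lam)
    (hτ : arrivalTime I γ lam ∈ interior I)
    (hstat : ∀ (ε₀ : ℝ) (Lam : ℝ → ℝ → M), IsAllowedVariation L q I γ lam ε₀ Lam →
      deriv (fun ε => arrivalTime I γ (Lam ε)) 0 = 0)
    (hΨ : IsFamily E lam δ Ψ)
    (harr : ∀ z ∈ box δ, z.1 = 1 → Ψ z = γ (arrivalTime I γ lam + z.2.2))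
    (hslope : ∀ s ∈ Icc (0 : ℝ) 1, slope L lam Ψ s < 0)
    (hΨε : ∀ s ε r, Ψ (s, ε, r) = Ψ (s, 0, r))
    {e : OpenPartialHomeomorph M E} (he : e ∈ IsManifold.maximalAtlas 𝓘(ℝ, E) ∞ M) {s₀ : ℝ}
    (hs₀ : s₀ ∈ Ioo (0 : ℝ) 1) (hsrc : lam s₀ ∈ e.source) (z : E) :
    derivWithin (momentum L e (Icc 0 1) (e ∘ lam)) (Icc 0 1) s₀ z =
      force L e (Icc 0 1) (e ∘ lam) s₀ z +
        (derivWithin (slope L lam Ψ) (Icc 0 1) s₀ - sensitivity L Ψ s₀) / slope L lam Ψ s₀ *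
          momentum L e (Icc 0 1) (e ∘ lam) s₀ z := by
  have hU := uniqueDiffOn_Icc (zero_lt_one (α := ℝ))
  obtain ⟨hSs, hRs⟩ := hΨ.contDiffOn_slope_sensitivity hL hlam.regular
  set S := slope L lam Ψ
  set R := sensitivity L Ψ
  set S' := derivWithin S (Icc 0 1)
  set p := momentum L e (Icc 0 1) (e ∘ lam)
  set f := force L e (Icc 0 1) (e ∘ lam)
  have hS : ∀ s ∈ Icc (0 : ℝ) 1, HasDerivWithinAt S (S' s) (Icc 0 1) s := fun s hs =>
    ((hSs s hs).differentiableWithinAt (by simp)).hasDerivWithinAt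
  have hS'c : ContinuousOn S' (Icc 0 1) := hSs.continuousOn_derivWithin hU (by simp)
  have hpf : ∀ s ∈ Icc (0 : ℝ) 1, lam s ∈ e.source →
      ContDiffWithinAt ℝ ∞ p (Icc 0 1) s ∧ ContDiffWithinAt ℝ ∞ f (Icc 0 1) s := by
    intro s hs hss
    have hmd := (hlam.smooth s hs).mdifferentiableWithinAt (n := ∞) (by simp)
    exact contDiffWithinAt_momentum_force hL he hU hs
      (contDiffWithinAt_chart_comp he (hlam.smooth s hs) hss) (e.map_source hss)
      ((tangentOf_ne_zero_iff he (hU s hs) hmd hss 1).1 (hlam.regular s hs))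
  -- The defect in the Euler-Lagrange equation for the factor `w = (S' - R) / S`, evaluated on `z`.
  let X : E → ℝ → ℝ := fun z s => (R s - S' s) / S s * p s z + derivWithin p (Icc 0 1) s z - f s z
  have hXc : ∀ z, ∀ s ∈ Icc (0 : ℝ) 1, lam s ∈ e.source →
      ContinuousWithinAt (X z) (Icc 0 1) s := by
    intro z s hs hss
    obtain ⟨h1, h2⟩ := hpf s hs hss
    have h3 : ContDiffWithinAt ℝ ∞ (derivWithin p (Icc 0 1)) (Icc 0 1) s :=
      (h1.fderivWithin_right (m := ∞) hU (by simp) hs).clm_apply contDiffWithinAt_const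
    exact (((((hRs.continuousOn s hs).sub (hS'c s hs)).div (hSs.continuousOn s hs)
      (hslope s hs).ne).mul (h1.continuousWithinAt.clm_apply continuousWithinAt_const)).add
      (h3.continuousWithinAt.clm_apply continuousWithinAt_const)).sub
      (h2.continuousWithinAt.clm_apply continuousWithinAt_const)
  have hs₀' : s₀ ∈ Icc (0 : ℝ) 1 := Ioo_subset_Icc_self hs₀
  have hkey : ∀ z, ¬ 0 < X z s₀ := by
    intro z hpos
    have hnhds : Icc (0 : ℝ) 1 ∈ 𝓝 s₀ := Icc_mem_nhds hs₀.1 hs₀.2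
    have hev : ∀ᶠ s in 𝓝 s₀, s ∈ Ioo (0 : ℝ) 1 ∧ lam s ∈ e.source ∧ 0 < X z s :=
      (isOpen_Ioo.eventually_mem hs₀).and
        ((((hlam.smooth s₀ hs₀').continuousWithinAt.continuousAt hnhds).eventually
          (e.open_source.mem_nhds hsrc)).and
          (((hXc z s₀ hs₀' hsrc).continuousAt hnhds).eventually (lt_mem_nhds hpos)))
    -- The bump lives where `X z` is positive and away from both end-points, so start and arrival of
    -- the family are untouched.
    obtain ⟨ρ, h1, -, hρ, h2, h3⟩ := exists_contDiff_tsupport_subset (n := ⊤) hev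
    have hρ' : ∀ s, HasDerivAt ρ (deriv ρ s) s := fun s =>
      (hρ.differentiable (by simp) s).hasDerivAt
    have hρ0 : ρ 0 = 0 := image_eq_zero_of_notMem_tsupport fun h => (h1 h).1.1.ne rfl
    have h1n : (1 : ℝ) ∉ tsupport ρ := fun h => (h1 h).1.2.ne rfl
    have hρ1 : ρ 1 = 0 := image_eq_zero_of_notMem_tsupport h1n
    have hsrcρ : ∀ s ∈ Icc (0 : ℝ) 1, s ∈ tsupport ρ → lam s ∈ e.source :=
      fun s _ h => (h1 h).2.1
    obtain ⟨δ', hδ', hle, hfam, htar⟩ := hΨ.exists_perturb he hρ (B := fun y => y.1 • z)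
      (V := univ) isOpen_univ (mem_univ _) (by fun_prop) (by simp) hsrcρ
    set Φ := perturb e ρ (fun y => y.1 • z) Ψ with hΦdef
    have hΨlam : ∀ s ∈ Icc (0 : ℝ) 1, ∀ ε, Ψ (s, ε, 0) = lam s := fun s hs ε => by
      rw [hΨε, hΨ.base s hs]
    -- The perturbation is proportional to `ε`, so at `ε = 0` slope and sensitivity are those of
    -- `Ψ`, whatever `ρ` and `z` are.
    have hcoin : ∀ r ∈ Icc (-δ') δ', ∀ t ∈ Icc (0 : ℝ) 1, Φ (t, 0, r) = Ψ (t, 0, r) := by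
      intro r hr t ht
      refine perturb_of_eq_zero (fun h => ((htar (t, 0, r) ⟨ht, ?_, hr⟩).2 h).1) (by simp)
      exact ⟨by linarith, hδ'.le⟩
    have hnear : ∀ᶠ r : ℝ in 𝓝 0, r ∈ Icc (-δ') δ' := Icc_mem_nhds (by linarith) hδ'
    have hSΦ : ∀ s ∈ Icc (0 : ℝ) 1, slope L lam Φ s = S s := by
      intro s hs
      rw [slope_perturb hL hΨ hfam he hlam.smooth hlam.regular hsrcρ (fun z hz => (htar z hz).2)
        (U := 0) (by simpa using hasDerivAt_const (0 : ℝ) (0 : E)) hs, map_zero, mul_zero, add_zero]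
    have hRΦ : ∀ s ∈ Icc (0 : ℝ) 1, sensitivity L Φ s = R s := by
      intro s hs
      refine Filter.EventuallyEq.deriv_eq ?_
      filter_upwards [hnear] with r hr
      exact congrArg L (velocity_congr_of_eqOn hs (hcoin r hr))
    obtain ⟨ε₀, Lam, hLam, η, η', hη1, hη0, hη⟩ := exists_allowedVariation hL hγ hlam hτ hfam
      (fun x hx hx1 => by
        rw [hΦdef, perturb_of_notMem (by rw [hx1]; exact h1n)]
        exact harr x (box_mono hle hx) hx1)
      (fun ε => by
        rw [hΦdef, perturb_of_notMem (show ((0, ε, 0) : ℝ × ℝ × ℝ).1 ∉ tsupport ρ from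
          fun h => (h1 h).1.1.ne rfl), hΨlam 0 (by simp), hlam.start])
      (fun s hs => by rw [hSΦ s hs]; exact hslope s hs)
    have hη1' : η 1 = 0 := by rw [← hη1.deriv]; exact hstat ε₀ Lam hLam
    have hlin : ∀ s ∈ Icc (0 : ℝ) 1,
        ρ s * f s z + deriv ρ s * p s z + η s * R s + η' s * S s = 0 := by
      intro s hs
      obtain ⟨-, a, ha, h4⟩ := hη s hs
      have h5 := hasDerivAt_lagrangian_perturb hL he hlam.smooth hlam.regular hρ (z := z) hΨlam
        hsrcρ hδ' (fun x hx h => ((htar x hx).2 h).2) hs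
      rw [ha.unique h5, hSΦ s hs, hRΦ s hs] at h4
      exact h4
    -- Integrating factor of `η' + (R / S) η`.
    let μ : ℝ → ℝ := fun s => Real.exp (∫ t in (0 : ℝ)..s, R t / S t)
    have hμ : ∀ s ∈ Icc (0 : ℝ) 1, HasDerivWithinAt μ (μ s * (R s / S s)) (Icc 0 1) s :=
      fun s hs => (hasDerivWithinAt_integral (hRs.continuousOn.div hSs.continuousOn
        fun s hs => (hslope s hs).ne) hs).exp
    have hμpos : ∀ s, 0 < μ s := fun s => Real.exp_pos _
    -- The second term absorbs `ρ'` by partial integration, so neither `η` nor `ρ'` remains in the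
    -- derivative of `G`. It vanishes at 0, and by stationarity also at 1.
    let G : ℝ → ℝ := fun s => μ s * η s + μ s / S s * (ρ s * p s z)
    have hG : ∀ s ∈ Icc (0 : ℝ) 1,
        HasDerivWithinAt G (μ s / S s * ρ s * X z s) (Icc 0 1) s := by
      intro s hs
      have hS0 := (hslope s hs).ne
      have hd : ∃ d, HasDerivWithinAt (fun s => ρ s * p s z) d (Icc 0 1) s ∧
          d = deriv ρ s * p s z + ρ s * derivWithin p (Icc 0 1) s z := by
        by_cases h : s ∈ tsupport ρ
        · have h4 := ((hpf s hs (hsrcρ s hs h)).1.differentiableWithinAt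
            (by simp)).hasDerivWithinAt.clm_apply (hasDerivWithinAt_const s (Icc 0 1) z)
          rw [map_zero, add_zero] at h4
          exact ⟨_, (hρ' s).hasDerivWithinAt.mul h4, rfl⟩
        · have h4 : deriv ρ s = 0 := by
            by_contra h4
            exact h (support_deriv_subset h4)
          refine ⟨0, (hasDerivWithinAt_const s (Icc 0 1) (0 : ℝ)).congr_of_eventuallyEq ?_ ?_, ?_⟩
          · filter_upwards [nhdsWithin_le_nhds
              ((isClosed_tsupport ρ).isOpen_compl.mem_nhds h)] with t ht
            rw [image_eq_zero_of_notMem_tsupport ht, zero_mul]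
          · rw [image_eq_zero_of_notMem_tsupport h, zero_mul]
          · rw [h4, image_eq_zero_of_notMem_tsupport h]; simp
      obtain ⟨d, hd, hd'⟩ := hd
      refine (((hμ s hs).mul (hη s hs).1).add
        (((hμ s hs).div (hS s hs) hS0).mul hd)).congr_deriv ?_
      have h6 : η' s = -(ρ s * f s z + deriv ρ s * p s z + η s * R s) / S s := by
        rw [eq_div_iff hS0]
        linarith [hlin s hs]
      simp only [X, Pi.div_apply]
      rw [hd', h6]
      field_simp
      ring
    have hm : ∀ s ∈ Icc (0 : ℝ) 1, μ s / S s < 0 := fun s hs =>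
      div_neg_of_pos_of_neg (hμpos s) (hslope s hs)
    have hle0 : ∀ s ∈ Icc (0 : ℝ) 1, μ s / S s * ρ s * X z s ≤ 0 := by
      intro s hs
      by_cases h : s ∈ tsupport ρ
      · exact mul_nonpos_of_nonpos_of_nonneg
          (mul_nonpos_of_nonpos_of_nonneg (hm s hs).le (h2 (mem_range_self s)).1) (h1 h).2.2.le
      · rw [image_eq_zero_of_notMem_tsupport h]; simp
    have hanti : AntitoneOn G (Icc 0 1) := by
      refine antitoneOn_of_deriv_nonpos (convex_Icc _ _)
        (fun s hs => (hG s hs).continuousWithinAt) (fun s hs => ?_) fun s hs => ?_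
      · exact ((hG s (interior_subset hs)).mono interior_subset).differentiableWithinAt
      · rw [((hG s (interior_subset hs)).hasDerivAt (mem_interior_iff_mem_nhds.1 hs)).deriv]
        exact hle0 s (interior_subset hs)
    have hG0 : G 0 = 0 := by simp [G, hη0, hρ0]
    have hG1 : G 1 = 0 := by simp [G, hη1', hρ1]
    have hzero : ∀ s ∈ Icc (0 : ℝ) 1, G s = 0 := fun s hs => le_antisymm
      (hG0 ▸ hanti (by simp) hs hs.1) (hG1 ▸ hanti hs (by simp) hs.2)
    have h4 := (hU s₀ hs₀').eq_deriv _ (hG s₀ hs₀')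
      ((hasDerivWithinAt_const s₀ (Icc 0 1) (0 : ℝ)).congr hzero (hzero s₀ hs₀'))
    rw [h3, mul_one] at h4
    exact (mul_neg_of_neg_of_pos (hm s₀ hs₀') hpos).ne h4
  -- `X` is linear in `z`, so the bound for `-z` gives the opposite sign.
  have h1 := hkey z
  have h2 := hkey (-z)
  have h3 : X (-z) s₀ = -X z s₀ := by simp only [X, map_neg]; ring
  have h4 : X z s₀ = 0 := by linarith
  simp only [X] at h4
  have h5 : (S' s₀ - R s₀) / S s₀ = -((R s₀ - S' s₀) / S s₀) := by ring
  rw [h5]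
  linarith

/-- One family `Ψ` is fixed for all charts, so the factor does not depend on the chart. The
end-points follow from the interior because both sides of the equation are continuous on `[0, 1]`
within the chart. -/
theorem isArbParamGeodesic_of_stationary [FiniteDimensional ℝ E] (hL : IsFinslerLagrangian L)
    (hγ : IsTimelikeEmbedding L I γ) (hlam : IsTrialCurve L q I γ lam)
    (hτ : arrivalTime I γ lam ∈ interior I)
    (hstat : ∀ (ε₀ : ℝ) (Lam : ℝ → ℝ → M), IsAllowedVariation L q I γ lam ε₀ Lam →
      deriv (fun ε => arrivalTime I γ (Lam ε)) 0 = 0) :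
    IsArbParamGeodesic L (Icc 0 1) lam := by
  refine ⟨hlam.smooth, hlam.regular, ?_⟩
  obtain ⟨δ, Ψ, hΨ, harr, hslope, hΨε⟩ := exists_family_slope_neg hL hγ hlam hτ
  have hU := uniqueDiffOn_Icc (zero_lt_one (α := ℝ))
  obtain ⟨hSs, hRs⟩ := hΨ.contDiffOn_slope_sensitivity hL hlam.regular
  refine ⟨fun s => (derivWithin (slope L lam Ψ) (Icc 0 1) s - sensitivity L Ψ s) /
    slope L lam Ψ s, fun s hs e he hss => ?_⟩
  have hmd := (hlam.smooth s hs).mdifferentiableWithinAt (n := ∞) (by simp)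
  obtain ⟨hp, hf⟩ := contDiffWithinAt_momentum_force hL he hU hs
    (contDiffWithinAt_chart_comp he (hlam.smooth s hs) hss) (e.map_source hss)
    ((tangentOf_ne_zero_iff he (hU s hs) hmd hss 1).1 (hlam.regular s hs))
  have hw : ContinuousWithinAt (fun s => (derivWithin (slope L lam Ψ) (Icc 0 1) s -
      sensitivity L Ψ s) / slope L lam Ψ s) (Icc 0 1) s :=
    ((hSs.continuousOn_derivWithin hU (by simp) s hs).sub (hRs.continuousOn s hs)).div
      (hSs.continuousOn s hs) (hslope s hs).ne
  have hp' : ContDiffWithinAt ℝ ∞ (derivWithin (momentum L e (Icc 0 1) (e ∘ lam)) (Icc 0 1))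
      (Icc 0 1) s :=
    (hp.fderivWithin_right (m := ∞) hU (by simp) hs).clm_apply contDiffWithinAt_const
  have hsub : 𝓝[Ioo 0 1] s ≤ 𝓝[Icc 0 1] s := nhdsWithin_mono s Ioo_subset_Icc_self
  have hne : (𝓝[Ioo (0 : ℝ) 1] s).NeBot := by
    rw [← mem_closure_iff_nhdsWithin_neBot, closure_Ioo zero_ne_one]
    exact hs
  have hlim := (hf.continuousWithinAt.add (hw.smul hp.continuousWithinAt)).tendsto.mono_left hsub
  have heq : derivWithin (momentum L e (Icc 0 1) (e ∘ lam)) (Icc 0 1) s =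
      force L e (Icc 0 1) (e ∘ lam) s + ((derivWithin (slope L lam Ψ) (Icc 0 1) s -
        sensitivity L Ψ s) / slope L lam Ψ s) • momentum L e (Icc 0 1) (e ∘ lam) s := by
    refine tendsto_nhds_unique_of_eventuallyEq
      (hp'.continuousWithinAt.tendsto.mono_left hsub) hlim ?_
    have hev : ∀ᶠ t in 𝓝[Ioo 0 1] s, lam t ∈ e.source :=
      hsub ((hlam.smooth s hs).continuousWithinAt.eventually (e.open_source.mem_nhds hss))
    filter_upwards [hev, self_mem_nhdsWithin] with t ht ht'
    ext z
    exact eulerLagrange_interior hL hγ hlam hτ hstat hΨ harr hslope hΨε he ht' ht z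
  have h := (hp.differentiableWithinAt (by simp)).hasDerivWithinAt
  rw [heq] at h
  exact h

end EulerLagrange

end Finsler

end

theorem theorem1
    {E : Type*} [NormedAddCommGroup E] [NormedSpace ℝ E] [FiniteDimensional ℝ E]
    {M : Type*} [TopologicalSpace M] [ChartedSpace E M] [IsManifold 𝓘(ℝ, E) ∞ M]
    [T2Space M] [SecondCountableTopology M]
    (L : TangentBundle 𝓘(ℝ, E) M → ℝ) (hL : Finsler.IsFinslerLagrangian L)
    (q : M) (I : Set ℝ) (γ : ℝ → M) (hγ : Finsler.IsTimelikeEmbedding L I γ)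
    (lam : ℝ → M) (hlam : Finsler.IsTrialCurve L q I γ lam)
    (hτ : Finsler.arrivalTime I γ lam ∈ interior I) :
    (∀ (ε₀ : ℝ) (Lam : ℝ → ℝ → M), Finsler.IsAllowedVariation L q I γ lam ε₀ Lam →
      DifferentiableAt ℝ (fun ε => Finsler.arrivalTime I γ (Lam ε)) 0) ∧
    (Finsler.IsArbParamGeodesic L (Icc 0 1) lam ↔
      ∀ (ε₀ : ℝ) (Lam : ℝ → ℝ → M), Finsler.IsAllowedVariation L q I γ lam ε₀ Lam →
        deriv (fun ε => Finsler.arrivalTime I γ (Lam ε)) 0 = 0) := by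
  refine ⟨fun ε₀ Lam hLam => ?_, fun hgeo ε₀ Lam hLam => ?_, fun hstat => ?_⟩
  · obtain ⟨τ', h, -⟩ := Finsler.hasDerivAt_arrivalTime hγ hτ hLam
    exact h.differentiableAt
  · exact Finsler.deriv_arrivalTime_eq_zero hL hγ hτ hgeo hLam
  · exact Finsler.isArbParamGeodesic_of_stationary hL hγ hlam hτ hstat
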